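/- Let $X=(X_t)_{t\in[0,\infty)}$ be a spectrally negative Lévy process under the probabilities $(\mathsf P_x)_{x\in\mathbb R}$: a càdlàg real-valued process with no positive jumps and (a.s.) non-monotone paths, which under $\mathsf P_0$ a.s. vanishes at zero and has stationary independent increments, the law of $X$ under $\mathsf P_x$ being that of $x+X$ under $\mathsf P_0$. Let $q\in[0,\infty)$ and let $e_q$ be a $[0,\infty]$-valued random variable which under every $\mathsf P_x$ is independent of $X$ and exponentially distributed with mean $q^{-1}$ ($e_0=\infty$ a.s.). Let $\omega:\mathbb R\to[0,\infty)$ be Borel measurable and locally bounded. For $c\in\mathbb R$ let $\tau_c^+:=\inf\{t\in(0,\infty):X_t>c\}$ ($\inf\emptyset=\infty$), and for real $x\le c$ put $$\mathcal B^{(\omega)}_q(x,c):=\mathsf P_x\Big[\exp\Big\{-\int_0^{\tau_c^+}\omega(X_u)\,du\Big\};\,\tau_c^+<e_q\Big].$$ Let $\mathcal H^{(\omega)}_q:\mathbb R\to(0,\infty)$ be the unique function with $\mathcal H^{(\omega)}_q(0)=1$ and $\mathcal B^{(\omega)}_q(x,c)=\mathcal H^{(\omega)}_q(x)/\mathcal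 H^{(\omega)}_q(c)$ for all real $x\le c$; that is, $\mathcal H^{(\omega)}_q(x)=\mathcal B^{(\omega)}_q(x,c)/\mathcal B^{(\omega)}_q(0,c)$ for any $c\ge\max\{x,0\}$. Let $\mathcal F=(\mathcal F_t)_{t\in[0,\infty)}$ be any filtration relative to which $X$ is adapted and has independent increments (under every $\mathsf P_x$), with $\mathcal F_\infty:=\bigvee_t\mathcal F_t$, and let $c\in\mathbb R$, $\gamma\in(0,\infty)$. (i) Let $Z_t:=\exp\big(-\int_0^t\omega(X_u)\,du-qt\big)\,\mathcal H^{(\omega)}_q(X_t)$, $t\in[0,\infty)$. For every $x\in\mathbb R$, the stopped process $Z^{\tau_c^+}=(Z_{t\wedge\tau_c^+})_{t\in[0,\infty)}$ is, under $\mathsf P_x$, a bounded càdlàg martingale in the filtration $\mathcal F$. If moreover $x\le c$, then its $\mathsf P_x$-terminal value is $$\xi:=\mathcal H^{(\omega)}_q(c)\exp\Big\{-\int_0^{\tau_c^+}\omega(X_u)\,du-q\tau_c^+\Big\}\mathbf 1_{\{\tau_c^+<\infty\}},$$ i.e. $\lim_{t\to\infty}Z_{t\wedge\tau_c^+}=\xi$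 $\mathsf P_x$-a.s., and $Z_{t\wedge\tau_c^+}=\mathsf P_x[\xi\mid\mathcal F_t]$ $\mathsf P_x$-a.s. for each $t\in[0,\infty)$. (ii) Assume that $\omega$ is strictly positive everywhere and that $e_q$ is independent of $\mathcal F_\infty$ under $\mathsf P_x$ for each $x\in\mathbb R$. Put $\zeta:=\int_0^{e_q}\omega(X_u)\,du$ and $\rho_s:=\inf\{t\in[0,\infty):\int_0^t\omega(X_u)\,du>s\}$ for $s\in[0,\infty)$; let $Y_s:=X_{\rho_s}$ for $s\in[0,\zeta)$ and $Y_s:=\partial$, a cemetery state, for $s\ge\zeta$; let $T_c^+:=\inf\{s\in(0,\infty):Y_s\in(c,\infty)\}$; and let $W_s:=e^{-\gamma s}\,\mathcal H^{(\gamma\omega)}_q(Y_s)\,\mathbf 1_{\{s<\zeta\}}$, $s\in[0,\infty)$. Then every $\rho_s$ is an $\mathcal F$-stopping time, $\mathcal G=(\mathcal G_s)_{s\in[0,\infty)}$ with $\mathcal G_s:=\mathcal F_{\rho_s}\vee\sigma(\{\{\rho_u<e_q\}:u\in[0,s]\})$ is a filtration, and for every $x\in\mathbb R$ the stopped process $W^{T_c^+}=(W_{s\wedge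 T_c^+})_{s\in[0,\infty)}$ is, under $\mathsf P_x$, a bounded (a.s.) càdlàg martingale in the filtration $\mathcal G$. -/

import Mathlib

open MeasureTheory ProbabilityTheory Filter Topology
open scoped NNReal ENNReal

namespace SNLP

/-- A path that is right-continuous and has (finite) left limits at every time. -/
def IsCadlag (f : ℝ≥0 → ℝ) : Prop :=
  ∀ t, ContinuousWithinAt f (Set.Ici t) t ∧ ∃ l : ℝ, Tendsto f (𝓝[<] t) (𝓝 l)

/-- `X` is a spectrally negative Lévy process under the probabilities `(P x)`, `x ∈ ℝ`:
a càdlàg real process without positive jumps and with (almost surely) non-monotone paths, which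
under `P 0` almost surely starts at zero and has stationary independent increments; and the law of
`X` under `P x` is that of `x + X` under `P 0`. -/
structure IsSpectrallyNegativeLevy {Ω : Type*} [MeasurableSpace Ω]
    (P : ℝ → Measure Ω) (X : ℝ≥0 → Ω → ℝ) : Prop where
  prob : ∀ x, IsProbabilityMeasure (P x)
  measurable : ∀ t, Measurable (X t)
  cadlag : ∀ ω, IsCadlag (fun t => X t ω)
  no_pos_jump : ∀ ω t, 0 < t → ∀ l : ℝ, Tendsto (fun s => X s ω) (𝓝[<] t) (𝓝 l) → X t ω ≤ l
  not_monotone : ∀ᵐ ω ∂(P 0), ¬ Monotone (fun t => X t ω) ∧ ¬ Antitone (fun t => X t ω)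
  start : ∀ᵐ ω ∂(P 0), X 0 ω = 0
  indep_incr : HasIndepIncrements X (P 0)
  stat_incr : ∀ s t : ℝ≥0,
    (P 0).map (fun ω => X (s + t) ω - X s ω) = (P 0).map (fun ω => X t ω - X 0 ω)
  law_shift : ∀ x : ℝ,
    (P x).map (fun ω (t : ℝ≥0) => X t ω) = (P 0).map (fun ω (t : ℝ≥0) => x + X t ω)

/-- Under each `P x`, the `[0,∞]`-valued random time `e` is exponentially distributed with rate `q`
(almost surely infinite if `q = 0`) and independent of the process `X`. -/
structure IsIndepExpTime {Ω : Type*} [MeasurableSpace Ω]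
    (P : ℝ → Measure Ω) (X : ℝ≥0 → Ω → ℝ) (q : ℝ≥0) (e : Ω → ℝ≥0∞) : Prop where
  measurable : Measurable e
  survival : ∀ (x : ℝ) (t : ℝ≥0),
    P x {ω | (t : ℝ≥0∞) < e ω} = ENNReal.ofReal (Real.exp (-((q : ℝ) * t)))
  indep : ∀ x, IndepFun e (fun ω (t : ℝ≥0) => X t ω) (P x)

/-- `X` is adapted to the filtration `ℱ` and, under each `P x`, has independent increments
relative to it. -/
structure HasIndepIncrementsRel {Ω : Type*} {m : MeasurableSpace Ω}
    (P : ℝ → Measure Ω) (X : ℝ≥0 → Ω → ℝ) (ℱ : Filtration ℝ≥0 m) : Prop where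
  adapted : ∀ t, Measurable[ℱ t] (X t)
  indep : ∀ (x : ℝ) (s t : ℝ≥0), s ≤ t →
    Indep (MeasurableSpace.comap (fun ω => X t ω - X s ω) inferInstance) (ℱ s) (P x)

noncomputable section

variable {Ω : Type*} [MeasurableSpace Ω]

/-- The first passage time `inf {t > 0 : X t > c}`, with `inf ∅ = ∞`. -/
def passageTime (X : ℝ≥0 → Ω → ℝ) (c : ℝ) (ω : Ω) : ℝ≥0∞ :=
  ⨅ (t : ℝ≥0) (_ : 0 < t ∧ c < X t ω), (t : ℝ≥0∞)

/-- The additive functional `∫_[0,T) w (X u) du ∈ [0,∞]`, for `T ∈ [0,∞]`. -/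
def addFun (X : ℝ≥0 → Ω → ℝ) (w : ℝ → ℝ≥0) (T : ℝ≥0∞) (ω : Ω) : ℝ≥0∞ :=
  ∫⁻ u in {u : ℝ | 0 ≤ u ∧ ENNReal.ofReal u < T}, (w (X u.toNNReal ω) : ℝ≥0∞)

/-- `ℬ(x,c) = P x [exp (-∫_0^τ w (X u) du); τ < e]`, with `τ` the passage time above `c`. -/
def passageLaplace (P : ℝ → Measure Ω) (X : ℝ≥0 → Ω → ℝ) (e : Ω → ℝ≥0∞) (w : ℝ → ℝ≥0)
    (x c : ℝ) : ℝ :=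
  ∫ ω in {ω | passageTime X c ω < e ω},
    Real.exp (-(addFun X w (passageTime X c ω) ω).toReal) ∂(P x)

/-- The function `ℋ`: `ℋ(x) = ℬ(x,c) / ℬ(0,c)` for any `c ≥ max x 0`. This is the unique strictly
positive function with `ℋ(0) = 1` and `ℬ(x,c) = ℋ(x) / ℋ(c)` for all real `x ≤ c`. -/
def scaleH (P : ℝ → Measure Ω) (X : ℝ≥0 → Ω → ℝ) (e : Ω → ℝ≥0∞) (w : ℝ → ℝ≥0) (x : ℝ) : ℝ :=
  passageLaplace P X e w x (max x 0) / passageLaplace P X e w 0 (max x 0)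

/-- `Z t = exp (-∫_0^t w (X u) du - q t) * ℋ (X t)`. -/
def procZ (P : ℝ → Measure Ω) (X : ℝ≥0 → Ω → ℝ) (q : ℝ≥0) (e : Ω → ℝ≥0∞) (w : ℝ → ℝ≥0)
    (t : ℝ≥0) (ω : Ω) : ℝ :=
  Real.exp (-(addFun X w t ω).toReal - q * t) * scaleH P X e w (X t ω)

/-- `ℋ(c) * exp (-∫_0^τ w (X u) du - q τ) * 1_{τ < ∞}`, with `τ` the passage time above `c`. -/
def terminalZ (P : ℝ → Measure Ω) (X : ℝ≥0 → Ω → ℝ) (q : ℝ≥0) (e : Ω → ℝ≥0∞) (w : ℝ → ℝ≥0)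
    (c : ℝ) (ω : Ω) : ℝ :=
  scaleH P X e w c *
    ({ω' | passageTime X c ω' < ∞}.indicator
      (fun ω' => Real.exp (-(addFun X w (passageTime X c ω') ω').toReal
        - q * (passageTime X c ω').toReal)) ω)

/-- The lifetime `ζ = ∫_0^e w (X u) du`. -/
def lifetime (X : ℝ≥0 → Ω → ℝ) (e : Ω → ℝ≥0∞) (w : ℝ → ℝ≥0) (ω : Ω) : ℝ≥0∞ :=
  addFun X w (e ω) ω

/-- The time change `ρ s = inf {t ≥ 0 : ∫_0^t w (X u) du > s}`, with `inf ∅ = ∞`. -/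
def timeChange (X : ℝ≥0 → Ω → ℝ) (w : ℝ → ℝ≥0) (s : ℝ≥0) (ω : Ω) : ℝ≥0∞ :=
  ⨅ (t : ℝ≥0) (_ : (s : ℝ≥0∞) < addFun X w t ω), (t : ℝ≥0∞)

open Classical in
/-- The process `Y s = X (ρ s)` for `s < ζ`, sent to the cemetery state `none` from time `ζ` on. -/
def procY (X : ℝ≥0 → Ω → ℝ) (e : Ω → ℝ≥0∞) (w : ℝ → ℝ≥0) (s : ℝ≥0) (ω : Ω) : Option ℝ :=
  if (s : ℝ≥0∞) < lifetime X e w ω then some (X (timeChange X w s ω).toNNReal ω) else none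

/-- The first passage time `inf {s > 0 : Y s ∈ (c,∞)}`, with `inf ∅ = ∞`. -/
def passageTimeY (X : ℝ≥0 → Ω → ℝ) (e : Ω → ℝ≥0∞) (w : ℝ → ℝ≥0) (c : ℝ) (ω : Ω) : ℝ≥0∞ :=
  ⨅ (s : ℝ≥0) (_ : 0 < s ∧ ∃ y, procY X e w s ω = some y ∧ c < y), (s : ℝ≥0∞)

/-- `W s = exp (-γ s) * ℋ (Y s) * 1_{s < ζ}`, where `ℋ` is the function associated to `γ w`, and
`Y`, `ζ` to `w`. (`Y s` is the cemetery state `none` exactly off `{s < ζ}`.) -/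
def procW (P : ℝ → Measure Ω) (X : ℝ≥0 → Ω → ℝ) (e : Ω → ℝ≥0∞) (w : ℝ → ℝ≥0) (γ : ℝ≥0)
    (s : ℝ≥0) (ω : Ω) : ℝ :=
  (procY X e w s ω).elim 0
    (fun y => Real.exp (-((γ : ℝ) * s)) * scaleH P X e (fun z => γ * w z) y)

/-- The process `Z` stopped at the passage time of `X` above `c`. -/
def stoppedZ (P : ℝ → Measure Ω) (X : ℝ≥0 → Ω → ℝ) (q : ℝ≥0) (e : Ω → ℝ≥0∞) (w : ℝ → ℝ≥0)
    (c : ℝ) : ℝ≥0 → Ω → ℝ :=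
  stoppedProcess (procZ P X q e w) (passageTime X c)

/-- The process `W` stopped at the passage time of `Y` above `c`. -/
def stoppedW (P : ℝ → Measure Ω) (X : ℝ≥0 → Ω → ℝ) (e : Ω → ℝ≥0∞) (w : ℝ → ℝ≥0) (γ : ℝ≥0)
    (c : ℝ) : ℝ≥0 → Ω → ℝ :=
  stoppedProcess (procW P X e w γ) (passageTimeY X e w c)

end

end SNLP

open SNLP

/-! Write `D_t` for the discount `exp (-∫_0^t w (X u) du - q t)` and `τ` for the passage time above
`c`.

Two path properties carry the argument. Without positive jumps, a path that starts at or below `c`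
sits exactly at `c` at time `τ` whenever `τ < ∞` (`apply_passageTime`). And almost every path
exceeds its starting level immediately (`ae_passageTime_eq_zero`): at `τ_0` the path is back at `0`
and, by the definition of an infimum, the remaining path exceeds `0` at once, so the strong Markov
property gives `p = p * P(τ_0 = 0)` with `p = P(τ_0 < ∞)`; and `p = 0` would make the paths
nonincreasing.

Integrating out the exponential time gives `ℬ(x,c) = P x [D_τ; τ < ∞]` (`passageLaplace_eq`). The
strong Markov property at an intermediate level makes `ℬ` multiplicative, immediate passage makes it
tend to `1` at the diagonal, and together they make it positive. Hence `ℋ` is positive,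
nondecreasing, continuous, and `ℋ(x) = ℬ(x,c) ℋ(c)` for `x ≤ c`.

For (i) with `x ≤ c`, let `ξ` be the terminal value. On `{τ < t}` the stopped process already equals
`ξ`. On `{t ≤ τ}` the Markov property gives `E[ξ | ℱ t] = ℋ(c) D_t ℬ(X_t, c) = D_t ℋ(X_t)`. So `Z^τ`
is a closed martingale (`setIntegral_terminalZ`), bounded by `ℋ(c)`. If `τ = ∞`, convergence to `0`
comes from optional sampling at the first times after `n` at which `Z^τ` exceeds `ε`
(`ae_eventually_stoppedZ_le`). If `x > c` then `τ = 0` and everything is constant.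

For (ii), the clock `A_t = ∫_0^t w (X u) du` is continuous and strictly increasing, and `ρ` is its
inverse. As `∫_0^{ρ_s} γ w (X u) du = γ s`, the process `W_s` is `Z_{ρ_s} exp (q ρ_s)` on `{ρ_s <
e}`, with `Z` built from `γ w`. Independence of `e` and `ℱ_∞` turns the event `{ρ_s < e}` into the
factor `exp (-q ρ_s)`, which cancels the other one, so optional sampling of `Z^τ` at `ρ_s` shows
that `W` is closed by its value at the passage time (`setIntegral_stoppedW_of_stopped`). Events of
`𝒢 s` reduce to events of `ℱ_{ρ_s}` because both have the same traces on `{ρ_s < e}`.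

The filtration is not assumed right-continuous, so passage times are only optional times, `{τ < t} ∈
ℱ t`; sampling and the strong Markov property are therefore proved for these, by discretizing from
the right. -/

namespace SNLP

/-! ### Right-continuous functions and discretization -/

/-- The point of the grid `(n + 1)⁻¹ ℕ` following `u`. -/
noncomputable def gridAbove (n : ℕ) (u : ℝ≥0) : ℝ≥0 := (⌊((n : ℝ≥0) + 1) * u⌋₊ + 1) / (n + 1)

lemma lt_gridAbove (n : ℕ) (u : ℝ≥0) : u < gridAbove n u := by
  unfold gridAbove
  rw [lt_div_iff₀ (by positivity), mul_comm]
  exact Nat.lt_floor_add_one _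

lemma gridAbove_le (n : ℕ) (u : ℝ≥0) : gridAbove n u ≤ u + 1 / (n + 1) := by
  unfold gridAbove
  rw [add_div]
  gcongr
  rw [div_le_iff₀ (by positivity), mul_comm]
  exact Nat.floor_le (by positivity)

lemma tendsto_gridAbove (u : ℝ≥0) : Tendsto (fun n => gridAbove n u) atTop (𝓝[>] u) := by
  refine tendsto_nhdsWithin_iff.2 ⟨?_, Eventually.of_forall fun n => lt_gridAbove n u⟩
  refine tendsto_of_tendsto_of_tendsto_of_le_of_le tendsto_const_nhds ?_
    (fun n => (lt_gridAbove n u).le) (fun n => gridAbove_le n u)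
  have : Tendsto (fun n : ℕ => u + 1 / ((n : ℝ≥0) + 1)) atTop (𝓝 (u + 0)) :=
    tendsto_const_nhds.add tendsto_one_div_add_atTop_nhds_zero_nat
  simpa using this

lemma tendsto_gridAbove_Ici (u : ℝ≥0) : Tendsto (fun n => gridAbove n u) atTop (𝓝[≥] u) :=
  (tendsto_gridAbove u).mono_right (nhdsWithin_mono _ Set.Ioi_subset_Ici_self)

lemma measurable_floor_mul (n : ℕ) : Measurable fun u : ℝ≥0 => ⌊((n : ℝ≥0) + 1) * u⌋₊ :=
  Nat.measurable_floor.comp (measurable_const_mul _)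

/-- A process with right-continuous paths is jointly measurable. -/
lemma measurable_uncurry_of_rightCont {Ω : Type*} {m : MeasurableSpace Ω} {U : ℝ≥0 → Ω → ℝ}
    (hU : ∀ t, Measurable (U t))
    (hc : ∀ ω t, ContinuousWithinAt (fun s => U s ω) (Set.Ici t) t) :
    Measurable fun p : ℝ≥0 × Ω => U p.1 p.2 := by
  refine measurable_of_tendsto_metrizable (f := fun n (p : ℝ≥0 × Ω) => U (gridAbove n p.1) p.2)
    (fun n => ?_) ?_
  · have h : Measurable fun p : ℕ × Ω => U (((p.1 : ℝ≥0) + 1) / (n + 1)) p.2 :=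
      measurable_from_prod_countable_right fun k => hU ((k + 1) / (n + 1))
    have h' : Measurable fun p : ℝ≥0 × Ω => (⌊((n : ℝ≥0) + 1) * p.1⌋₊, p.2) :=
      ((measurable_floor_mul n).comp measurable_fst).prodMk measurable_snd
    have h2 := h.comp h'
    simp only [Function.comp_def] at h2
    simp only [gridAbove]
    exact h2
  · rw [tendsto_pi_nhds]
    intro p
    exact (hc p.2 p.1).tendsto.comp (tendsto_gridAbove_Ici p.1)

lemma IsCadlag.rightCont {f : ℝ≥0 → ℝ} (hf : IsCadlag f) (t : ℝ≥0) :
    ContinuousWithinAt f (Set.Ici t) t := (hf t).1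

lemma IsCadlag.measurable {f : ℝ≥0 → ℝ} (hf : IsCadlag f) : Measurable f := by
  have := measurable_uncurry_of_rightCont (m := ⊤) (Ω := Unit) (U := fun t _ => f t)
    (fun t => measurable_const) (fun _ t => hf.rightCont t)
  exact this.comp (measurable_id.prodMk (measurable_const (a := ())))

/-- A càdlàg function is bounded on bounded sets. -/
lemma IsCadlag.exists_bound {f : ℝ≥0 → ℝ} (hf : IsCadlag f) (t : ℝ≥0) :
    ∃ K : ℝ, ∀ u ≤ t, |f u| ≤ K := by
  have key : ∃ K : ℝ, ∀ u ∈ Set.Icc 0 t, |f u| ≤ K := by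
    refine isCompact_Icc.induction_on (p := fun s => ∃ K : ℝ, ∀ u ∈ s, |f u| ≤ K)
      ⟨0, by simp⟩ (fun s s' h ⟨K, hK⟩ => ⟨K, fun u hu => hK u (h hu)⟩) ?_ ?_
    · rintro s s' ⟨K, hK⟩ ⟨K', hK'⟩
      refine ⟨max K K', fun u hu => ?_⟩
      rcases hu with hu | hu
      · exact (hK u hu).trans (le_max_left _ _)
      · exact (hK' u hu).trans (le_max_right _ _)
    · intro x _
      obtain ⟨l, hl⟩ := (hf x).2
      have h1 : ∀ᶠ u in 𝓝[<] x, |f u| ≤ max (|l| + 1) (|f x| + 1) := by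
        filter_upwards [hl.abs.eventually (gt_mem_nhds (lt_add_one |l|))] with u hu
        exact hu.le.trans (le_max_left _ _)
      have h2 : ∀ᶠ u in 𝓝[≥] x, |f u| ≤ max (|l| + 1) (|f x| + 1) := by
        filter_upwards [(hf x).1.tendsto.abs.eventually (gt_mem_nhds (lt_add_one |f x|))]
          with u hu
        exact hu.le.trans (le_max_right _ _)
      have h3 : ∀ᶠ u in 𝓝 x, |f u| ≤ max (|l| + 1) (|f x| + 1) := by
        rw [← nhdsLT_sup_nhdsGE]
        exact eventually_sup.2 ⟨h1, h2⟩
      exact ⟨{u | |f u| ≤ max (|l| + 1) (|f x| + 1)}, mem_nhdsWithin_of_mem_nhds h3, _,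
        fun u hu => hu⟩
  obtain ⟨K, hK⟩ := key
  exact ⟨K, fun u hu => hK u ⟨zero_le, hu⟩⟩

/-- Stopping keeps a path càdlàg, and only the path up to the stopping time matters. -/
lemma isCadlag_stop {f : ℝ≥0 → ℝ} {T : ℝ≥0∞}
    (hr : ∀ t : ℝ≥0, (t : ℝ≥0∞) < T → ContinuousWithinAt f (Set.Ici t) t)
    (hl : ∀ t : ℝ≥0, (t : ℝ≥0∞) ≤ T → ∃ l : ℝ, Tendsto f (𝓝[<] t) (𝓝 l)) :
    IsCadlag fun t : ℝ≥0 => f (min (t : ℝ≥0∞) T).toNNReal := by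
  have hlt : ∀ t : ℝ≥0, (t : ℝ≥0∞) ≤ T → f (min (t : ℝ≥0∞) T).toNNReal = f t := by
    intro t ht; rw [min_eq_left ht, ENNReal.toNNReal_coe]
  have hgt : ∀ t : ℝ≥0, T ≤ (t : ℝ≥0∞) → f (min (t : ℝ≥0∞) T).toNNReal = f T.toNNReal := by
    intro t ht; rw [min_eq_right ht]
  intro t
  constructor
  · rcases lt_or_ge (t : ℝ≥0∞) T with h | h
    · refine (hr t h).congr_of_eventuallyEq ?_ (hlt t h.le)
      have : ∀ᶠ u : ℝ≥0 in 𝓝 t, (u : ℝ≥0∞) < T :=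
        ENNReal.continuous_coe.continuousAt.eventually (gt_mem_nhds h)
      filter_upwards [nhdsWithin_le_nhds this] with u hu using hlt u hu.le
    · refine (continuousWithinAt_const (b := f T.toNNReal)).congr (fun u hu => hgt u ?_) (hgt t h)
      exact h.trans (by exact_mod_cast hu)
  · rcases le_or_gt (t : ℝ≥0∞) T with h | h
    · obtain ⟨l, hl⟩ := hl t h
      refine ⟨l, hl.congr' ?_⟩
      filter_upwards [self_mem_nhdsWithin] with u hu
      exact (hlt u (le_trans (by exact_mod_cast (le_of_lt hu)) h)).symm
    · refine ⟨f T.toNNReal, tendsto_const_nhds.congr' ?_⟩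
      have : ∀ᶠ u : ℝ≥0 in 𝓝 t, T < (u : ℝ≥0∞) :=
        ENNReal.continuous_coe.continuousAt.eventually (lt_mem_nhds h)
      filter_upwards [nhdsWithin_le_nhds this] with u hu using (hgt u hu.le).symm

/-- The minimum is finite, so `WithTop.untopA` and `ENNReal.toNNReal` read it as the same time. -/
lemma stoppedProcess_apply {Ω β : Type*} (u : ℝ≥0 → Ω → β) (T : Ω → ℝ≥0∞) (t : ℝ≥0) (ω : Ω) :
    stoppedProcess u T t ω = u (min (t : ℝ≥0∞) (T ω)).toNNReal ω := by
  unfold stoppedProcess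
  congr 1
  have h : ∀ a : ℝ≥0∞, a ≠ ∞ → WithTop.untopA (α := ℝ≥0) a = a.toNNReal := by
    intro a ha
    lift a to ℝ≥0 using ha
    rfl
  exact h _ (ne_top_of_le_ne_top ENNReal.coe_ne_top (min_le_left _ _))

/-! ### Paths without positive jumps and their passage times -/

/-- The path is càdlàg and has no positive jumps. -/
def IsSNPath (f : ℝ≥0 → ℝ) : Prop :=
  IsCadlag f ∧ ∀ t, 0 < t → ∀ l : ℝ, Tendsto f (𝓝[<] t) (𝓝 l) → f t ≤ l

section Passage

variable {Ω : Type*} {X : ℝ≥0 → Ω → ℝ} {c : ℝ} {ω : Ω}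

lemma passageTime_lt_iff {T : ℝ≥0∞} :
    passageTime X c ω < T ↔ ∃ t : ℝ≥0, 0 < t ∧ c < X t ω ∧ (t : ℝ≥0∞) < T := by
  simp [passageTime, iInf_lt_iff, and_assoc]

lemma passageTime_le {t : ℝ≥0} (ht : 0 < t) (h : c < X t ω) : passageTime X c ω ≤ t :=
  iInf₂_le t ⟨ht, h⟩

lemma le_of_lt_passageTime {t : ℝ≥0} (ht : 0 < t) (h : (t : ℝ≥0∞) < passageTime X c ω) :
    X t ω ≤ c := by
  by_contra! hc
  exact absurd (passageTime_le ht hc) (not_le.2 h)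

/-- By right-continuity an exceedance persists on a right neighbourhood, which contains a point of
the dense sequence. This countable description gives the measurability of passage times. -/
lemma passageTime_lt_iff_denseSeq
    (hc : ∀ t, ContinuousWithinAt (fun t => X t ω) (Set.Ici t) t) {T : ℝ≥0∞} :
    passageTime X c ω < T ↔ ∃ n, 0 < TopologicalSpace.denseSeq ℝ≥0 n ∧
      c < X (TopologicalSpace.denseSeq ℝ≥0 n) ω ∧
      (TopologicalSpace.denseSeq ℝ≥0 n : ℝ≥0∞) < T := by
  rw [passageTime_lt_iff]
  refine ⟨fun ⟨t, ht, h, hT⟩ => ?_, fun ⟨n, h⟩ => ⟨_, h⟩⟩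
  have h1 : ∀ᶠ u in 𝓝[>] t, c < X u ω :=
    nhdsWithin_mono t Set.Ioi_subset_Ici_self ((hc t).tendsto.eventually (lt_mem_nhds h))
  have h2 : ∀ᶠ u : ℝ≥0 in 𝓝[>] t, (u : ℝ≥0∞) < T :=
    nhdsWithin_le_nhds (ENNReal.continuous_coe.continuousAt.eventually (gt_mem_nhds hT))
  obtain ⟨b, hb, hb'⟩ := (mem_nhdsGT_iff_exists_Ioo_subset).1 (h1.and h2)
  obtain ⟨_, ⟨n, rfl⟩, hn⟩ := (TopologicalSpace.denseRange_denseSeq ℝ≥0).exists_between hb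
  exact ⟨n, ht.trans hn.1, hb' hn⟩

lemma le_of_lt_passageTime' (h0 : X 0 ω ≤ c) {t : ℝ≥0} (h : (t : ℝ≥0∞) < passageTime X c ω) :
    X t ω ≤ c := by
  rcases eq_or_ne t 0 with rfl | ht
  · exact h0
  · exact le_of_lt_passageTime (pos_iff_ne_zero.2 ht) h

/-- If the path were below `c` at the passage time, it would stay below on a right neighbourhood,
and the infimum would be larger. -/
lemma le_apply_passageTime (hc : ∀ t, ContinuousWithinAt (fun t => X t ω) (Set.Ici t) t)
    {t : ℝ≥0} (ht : passageTime X c ω = t) : c ≤ X t ω := by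
  by_contra! h
  obtain ⟨b, hb, hb'⟩ := mem_nhdsGE_iff_exists_Ico_subset.1
    ((hc t).tendsto.eventually (gt_mem_nhds h))
  have hlt : passageTime X c ω < b := by rw [ht]; exact_mod_cast hb
  obtain ⟨u, hu, huc, hub⟩ := passageTime_lt_iff.1 hlt
  have htu : t ≤ u := by
    have := passageTime_le hu huc
    rw [ht] at this
    exact_mod_cast this
  exact absurd (hb' ⟨htu, by exact_mod_cast hub⟩) (not_lt.2 huc.le)

/-- The level is hit without overshoot: before the passage time the path is at most `c`, hence so is
its left limit, and a jump can only go down. -/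
lemma apply_passageTime (hX : IsSNPath fun t => X t ω) (h0 : X 0 ω ≤ c)
    {t : ℝ≥0} (ht : passageTime X c ω = t) : X t ω = c := by
  apply le_antisymm
  · rcases eq_or_ne t 0 with rfl | h
    · exact h0
    · obtain ⟨l, hl⟩ := (hX.1 t).2
      refine (hX.2 t (pos_iff_ne_zero.2 h) l hl).trans ?_
      have : (𝓝[<] t).NeBot := nhdsLT_neBot_of_exists_lt ⟨0, pos_iff_ne_zero.2 h⟩
      refine le_of_tendsto hl ?_
      filter_upwards [self_mem_nhdsWithin] with u hu
      exact le_of_lt_passageTime' h0 (by rw [ht]; exact_mod_cast hu)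
  · exact le_apply_passageTime hX.1.rightCont ht

lemma le_of_le_passageTime (hX : IsSNPath fun t => X t ω) (h0 : X 0 ω ≤ c)
    {t : ℝ≥0} (ht : (t : ℝ≥0∞) ≤ passageTime X c ω) : X t ω ≤ c := by
  rcases ht.lt_or_eq with h | h
  · exact le_of_lt_passageTime' h0 h
  · exact (apply_passageTime hX h0 h.symm).le

/-- The passage time of a path is the sum of an earlier time and of the passage time of the
remaining path. -/
lemma passageTime_eq_add {Ω' : Type*} {X' : ℝ≥0 → Ω' → ℝ} {ω' : Ω'}
    (hX : IsSNPath fun t => X t ω) (h0 : X 0 ω ≤ c) {t : ℝ≥0}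
    (ht : (t : ℝ≥0∞) ≤ passageTime X c ω) (hX' : ∀ s, X' s ω' = X (t + s) ω) :
    passageTime X c ω = t + passageTime X' c ω' := by
  apply le_antisymm
  · rw [passageTime, passageTime, ENNReal.add_iInf]
    refine le_iInf fun s => ?_
    rw [ENNReal.add_iInf]
    refine le_iInf fun hs => ?_
    have := passageTime_le (X := X) (c := c) (ω := ω) (t := t + s) (add_pos_of_nonneg_of_pos
      zero_le hs.1) (by rw [← hX']; exact hs.2)
    exact_mod_cast this
  · refine le_iInf₂ fun u hu => ?_
    -- At time `t` the path is still at or below `c`, so it exceeds `c` strictly later. Strictness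
    -- matters because the passage time of the remaining path ignores its time `0`.
    have htu : t < u := by
      have h1 : (t : ℝ≥0∞) ≤ u := ht.trans (passageTime_le hu.1 hu.2)
      have h1 : t ≤ u := by exact_mod_cast h1
      refine lt_of_le_of_ne h1 fun h => ?_
      subst h
      exact absurd (le_of_le_passageTime hX h0 ht) (not_le.2 hu.2)
    have : passageTime X' c ω' ≤ (u - t : ℝ≥0) :=
      passageTime_le (tsub_pos_of_lt htu) (by rw [hX', add_tsub_cancel_of_le htu.le]; exact hu.2)
    calc (t : ℝ≥0∞) + passageTime X' c ω' ≤ t + (u - t : ℝ≥0) := by gcongr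
      _ = u := by rw [← ENNReal.coe_add, add_tsub_cancel_of_le htu.le]

end Passage

/-! ### The additive functional along a path -/

section AddFun

variable {Ω : Type*} {X : ℝ≥0 → Ω → ℝ} {w : ℝ → ℝ≥0} {ω : Ω}

lemma addFun_mono {S T : ℝ≥0∞} (h : S ≤ T) : addFun X w S ω ≤ addFun X w T ω :=
  lintegral_mono_set fun _ hu => ⟨hu.1, hu.2.trans_le h⟩

lemma measurable_weight (hw : Measurable w) (hc : IsCadlag fun t => X t ω) :
    Measurable fun u : ℝ => w (X u.toNNReal ω) :=
  hw.comp (hc.measurable.comp measurable_real_toNNReal)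

/-- The weight along a path is bounded on bounded time intervals, locally uniformly with respect
to translations of the path. -/
lemma exists_weight_bound (hwb : ∀ a b : ℝ, BddAbove (w '' Set.Icc a b))
    (hc : IsCadlag fun t => X t ω) (t : ℝ≥0) (r : ℝ) :
    ∃ K : ℝ≥0, ∀ u ≤ t, ∀ y, |y| ≤ r → w (y + X u ω) ≤ K := by
  obtain ⟨K, hK⟩ := hc.exists_bound t
  obtain ⟨L, hL⟩ := hwb (-(r + K)) (r + K)
  refine ⟨L, fun u hu y hy => hL ⟨_, ?_, rfl⟩⟩
  have h := (abs_add_le y (X u ω)).trans (add_le_add hy (hK u hu))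
  exact abs_le.1 h

lemma addFun_le (t : ℝ≥0) {K : ℝ≥0} (hK : ∀ u ≤ t, w (X u ω) ≤ K) :
    addFun X w t ω ≤ K * t := by
  calc addFun X w t ω ≤ ∫⁻ u in {u : ℝ | 0 ≤ u ∧ ENNReal.ofReal u < t}, (K : ℝ≥0∞) := by
        refine setLIntegral_mono measurable_const fun u hu => ?_
        have : u.toNNReal ≤ t := by
          have h := hu.2.le
          rw [ENNReal.ofReal] at h
          exact_mod_cast h
        exact_mod_cast hK _ this
    _ ≤ ∫⁻ u in Set.Icc 0 (t : ℝ), (K : ℝ≥0∞) := by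
        refine lintegral_mono_set fun u hu => ⟨hu.1, ?_⟩
        have h := hu.2.le
        rw [ENNReal.ofReal] at h
        have h : u.toNNReal ≤ t := by exact_mod_cast h
        exact Real.toNNReal_le_iff_le_coe.1 h
    _ = K * t := by simp

lemma addFun_lt_top (hwb : ∀ a b : ℝ, BddAbove (w '' Set.Icc a b))
    (hc : IsCadlag fun t => X t ω) (t : ℝ≥0) : addFun X w t ω < ∞ := by
  obtain ⟨K, hK⟩ := exists_weight_bound hwb hc t 0
  refine (addFun_le t (K := K) fun u hu => ?_).trans_lt
    (ENNReal.mul_lt_top ENNReal.coe_lt_top ENNReal.coe_lt_top)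
  simpa using hK u hu 0 (by simp)

lemma addFun_zero : addFun X w 0 ω = 0 := by simp [addFun]

lemma intervalIntegrable_weight (hw : Measurable w) (hwb : ∀ a b : ℝ, BddAbove (w '' Set.Icc a b))
    (hc : IsCadlag fun t => X t ω) (a b : ℝ) :
    IntervalIntegrable (fun u : ℝ => (w (X u.toNNReal ω) : ℝ)) volume a b := by
  obtain ⟨K, hK⟩ := exists_weight_bound hwb hc (max a b).toNNReal 0
  have hm := (measurable_weight hw hc).coe_nnreal_real
  rw [intervalIntegrable_iff]
  refine Measure.integrableOn_of_bounded (M := K) (by simp) hm.aestronglyMeasurable ?_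
  refine (ae_restrict_mem measurableSet_uIoc).mono fun u hu => ?_
  have h2 : w (0 + X u.toNNReal ω) ≤ K := hK u.toNNReal (Real.toNNReal_le_toNNReal hu.2) 0 (by simp)
  simp only [zero_add] at h2
  simpa using h2

/-- At finite times this form yields continuity, additivity and strict monotonicity from the theory
of interval integrals. -/
lemma addFun_eq_intervalIntegral (hw : Measurable w)
    (hc : IsCadlag fun t => X t ω) (t : ℝ≥0) :
    (addFun X w t ω).toReal = ∫ u in (0 : ℝ)..t, (w (X u.toNNReal ω) : ℝ) := by
  have hset : {u : ℝ | 0 ≤ u ∧ ENNReal.ofReal u < t} = Set.Ico 0 (t : ℝ) := by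
    ext u
    simp only [Set.mem_ofPred_eq, Set.mem_Ico]
    refine and_congr_right fun h => ?_
    rw [ENNReal.ofReal_lt_coe_iff h]
  rw [intervalIntegral.integral_of_le t.coe_nonneg, ← integral_Ico_eq_integral_Ioc,
    integral_eq_lintegral_of_nonneg_ae (Eventually.of_forall fun u => by positivity)
    (measurable_weight hw hc).coe_nnreal_real.aestronglyMeasurable, addFun, hset]
  simp

lemma continuous_addFun (hw : Measurable w)
    (hwb : ∀ a b : ℝ, BddAbove (w '' Set.Icc a b)) (hc : IsCadlag fun t => X t ω) :
    Continuous fun t : ℝ≥0 => (addFun X w t ω).toReal := by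
  simp_rw [addFun_eq_intervalIntegral hw hc]
  exact (intervalIntegral.continuous_primitive (intervalIntegrable_weight hw hwb hc) 0).comp
    NNReal.continuous_coe

lemma addFun_add {Ω' : Type*} {X' : ℝ≥0 → Ω' → ℝ} {ω' : Ω'} (hw : Measurable w)
    (hwb : ∀ a b : ℝ, BddAbove (w '' Set.Icc a b)) (hc : IsCadlag fun t => X t ω)
    (hc' : IsCadlag fun t => X' t ω') {t : ℝ≥0} (hX' : ∀ s, X' s ω' = X (t + s) ω) (s : ℝ≥0) :
    (addFun X w (t + s : ℝ≥0) ω).toReal = (addFun X w t ω).toReal + (addFun X' w s ω').toReal := by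
  rw [addFun_eq_intervalIntegral hw hc, addFun_eq_intervalIntegral hw hc,
    addFun_eq_intervalIntegral hw hc',
    ← intervalIntegral.integral_add_adjacent_intervals
      (intervalIntegrable_weight hw hwb hc 0 t) (intervalIntegrable_weight hw hwb hc t _)]
  congr 1
  have := intervalIntegral.integral_comp_add_left (a := 0) (b := s)
    (fun u : ℝ => (w (X u.toNNReal ω) : ℝ)) (t : ℝ)
  rw [add_zero, ← NNReal.coe_add] at this
  rw [← this]
  refine intervalIntegral.integral_congr fun u hu => ?_
  have hu0 : 0 ≤ u := by
    rw [Set.uIcc_of_le s.coe_nonneg] at hu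
    exact hu.1
  simp only [hX']
  rw [Real.toNNReal_add t.coe_nonneg hu0, Real.toNNReal_coe]

lemma strictMono_addFun (hw : Measurable w)
    (hwb : ∀ a b : ℝ, BddAbove (w '' Set.Icc a b)) (hc : IsCadlag fun t => X t ω)
    (hpos : ∀ y, 0 < w y) : StrictMono fun t : ℝ≥0 => (addFun X w t ω).toReal := by
  intro s t hst
  have hst' : (s : ℝ) < t := by exact_mod_cast hst
  simp only [addFun_eq_intervalIntegral hw hc]
  rw [← intervalIntegral.integral_add_adjacent_intervals
      (intervalIntegrable_weight hw hwb hc 0 s) (intervalIntegrable_weight hw hwb hc s t)]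
  have := intervalIntegral.intervalIntegral_pos_of_pos (f := fun u : ℝ => (w (X u.toNNReal ω) : ℝ))
    (intervalIntegrable_weight hw hwb hc s t) (fun u => by exact_mod_cast hpos _) hst'
  linarith

/-- The functional is left-continuous in `T`, also at `T = ∞`, by monotone convergence along times
increasing strictly to `T`. -/
lemma lt_addFun_iff {s T : ℝ≥0∞} :
    s < addFun X w T ω ↔ ∃ t : ℝ≥0, (t : ℝ≥0∞) < T ∧ s < addFun X w t ω := by
  refine ⟨fun h => ?_, fun ⟨t, ht, h⟩ => h.trans_le (addFun_mono ht.le)⟩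
  have hT : 0 < T := by
    rw [pos_iff_ne_zero]
    rintro rfl
    simp [addFun_zero] at h
  obtain ⟨v, hv, hvT, hvl⟩ := exists_seq_strictMono_tendsto' hT
  have hset : {u : ℝ | 0 ≤ u ∧ ENNReal.ofReal u < T} =
      ⋃ n, {u : ℝ | 0 ≤ u ∧ ENNReal.ofReal u < v n} := by
    ext u
    simp only [Set.mem_ofPred_eq, Set.mem_iUnion, exists_and_left]
    refine and_congr_right fun _ => ⟨fun hu => ?_, fun ⟨n, hn⟩ => hn.trans (hvT n).2⟩
    exact (hvl.eventually (lt_mem_nhds hu)).exists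
  have hsup : addFun X w T ω = ⨆ n, addFun X w (v n) ω := by
    unfold addFun
    rw [hset, setLIntegral_iUnion_of_directed]
    exact Monotone.directed_le fun a b hab u hu => ⟨hu.1, hu.2.trans_le (hv.monotone hab)⟩
  rw [hsup, lt_iSup_iff] at h
  obtain ⟨n, hn⟩ := h
  refine ⟨(v n).toNNReal, ?_, ?_⟩ <;> rw [ENNReal.coe_toNNReal ((hvT n).2.ne_top)]
  · exact (hvT n).2
  · exact hn

lemma addFun_const_mul (γ : ℝ≥0) (T : ℝ≥0∞) :
    addFun X (fun z => γ * w z) T ω = γ * addFun X w T ω := by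
  simp only [addFun, ENNReal.coe_mul]
  rw [lintegral_const_mul' _ _ ENNReal.coe_ne_top]

end AddFun

/-! ### Measurability of the functionals of the path -/

section Measurability

lemma measurable_graph_comp {Ω α β : Type*} {m : MeasurableSpace Ω} [MeasurableSpace α]
    [MeasurableSpace β] {g : α × Ω → β} (hg : Measurable g) {f : Ω → α} (hf : Measurable f) :
    Measurable fun ω => g (f ω, ω) :=
  hg.comp (hf.prodMk measurable_id)

variable {Ω : Type*} {m : MeasurableSpace Ω} {X : ℝ≥0 → Ω → ℝ} {w : ℝ → ℝ≥0}

lemma measurable_passageTime (hX : ∀ t, Measurable (X t)) (hc : ∀ ω, IsCadlag fun t => X t ω)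
    (c : ℝ) : Measurable (passageTime X c) := by
  refine measurable_of_Iio fun T => ?_
  have : passageTime X c ⁻¹' Set.Iio T = ⋃ n, {ω | 0 < TopologicalSpace.denseSeq ℝ≥0 n ∧
      c < X (TopologicalSpace.denseSeq ℝ≥0 n) ω ∧
      (TopologicalSpace.denseSeq ℝ≥0 n : ℝ≥0∞) < T} := by
    ext ω
    simp only [Set.mem_preimage, Set.mem_Iio, Set.mem_iUnion, Set.mem_ofPred_eq]
    exact passageTime_lt_iff_denseSeq (hc ω).rightCont
  rw [this]
  refine MeasurableSet.iUnion fun n => ?_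
  exact (MeasurableSet.const _).inter
    ((measurableSet_lt measurable_const (hX _)).inter (MeasurableSet.const _))

lemma measurable_addFun (hX : ∀ t, Measurable (X t)) (hc : ∀ ω, IsCadlag fun t => X t ω)
    (hw : Measurable w) : Measurable fun p : ℝ≥0∞ × Ω => addFun X w p.1 p.2 := by
  have hj := measurable_uncurry_of_rightCont hX (fun ω => (hc ω).rightCont)
  have hset : MeasurableSet {p : (ℝ≥0∞ × Ω) × ℝ | 0 ≤ p.2 ∧ ENNReal.ofReal p.2 < p.1.1} := by
    refine (measurableSet_le measurable_const measurable_snd).inter ?_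
    exact measurableSet_lt (ENNReal.measurable_ofReal.comp measurable_snd)
      (measurable_fst.comp measurable_fst)
  have hval : Measurable fun p : (ℝ≥0∞ × Ω) × ℝ => (w (X p.2.toNNReal p.1.2) : ℝ≥0∞) := by
    have h1 : Measurable fun p : (ℝ≥0∞ × Ω) × ℝ => (p.2.toNNReal, p.1.2) :=
      (measurable_real_toNNReal.comp measurable_snd).prodMk (measurable_snd.comp measurable_fst)
    exact (hw.comp (hj.comp h1)).coe_nnreal_ennreal
  have := (hval.indicator hset).lintegral_prod_right' (ν := volume)
  convert this using 1
  funext p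
  rw [addFun, ← lintegral_indicator]
  · rfl
  · exact (measurableSet_le measurable_const measurable_id).inter
      (measurableSet_lt ENNReal.measurable_ofReal measurable_const)

end Measurability

/-! ### Optional times -/

section Optional

variable {Ω : Type*} {m : MeasurableSpace Ω} {ℱ : Filtration ℝ≥0 m}

/-- `σ` is an optional time: `{σ < t}` belongs to `ℱ t` for every `t`. -/
def IsOptionalTime (ℱ : Filtration ℝ≥0 m) (σ : Ω → ℝ≥0∞) : Prop :=
  ∀ t : ℝ≥0, MeasurableSet[ℱ t] {ω | σ ω < t}

lemma IsOptionalTime.measurable_min {σ : Ω → ℝ≥0∞} (hσ : IsOptionalTime ℱ σ) (t : ℝ≥0) :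
    Measurable[ℱ t] fun ω => (min (t : ℝ≥0∞) (σ ω)).toNNReal := by
  have : Measurable[ℱ t] fun ω => min (t : ℝ≥0∞) (σ ω) := by
    refine @measurable_of_Iio _ _ _ _ _ (ℱ t) _ _ _ _ fun s => ?_
    rcases lt_or_ge (t : ℝ≥0∞) s with h | h
    · convert @MeasurableSet.univ _ (ℱ t)
      ext ω
      simp [h]
    · lift s to ℝ≥0 using ne_top_of_le_ne_top ENNReal.coe_ne_top h
      convert ℱ.mono (show s ≤ t by exact_mod_cast h) _ (hσ s) using 1
      ext ω
      simp [not_lt.2 h]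
  exact ENNReal.measurable_toNNReal.comp this

lemma IsOptionalTime.measurable_iSup {σ : Ω → ℝ≥0∞} (hσ : IsOptionalTime ℱ σ) :
    Measurable[⨆ t, ℱ t] σ := by
  refine @measurable_of_Iio _ _ _ _ _ (⨆ t, ℱ t) _ _ _ _ fun s => ?_
  have : σ ⁻¹' Set.Iio s = ⋃ n, {ω | σ ω < (TopologicalSpace.denseSeq ℝ≥0 n : ℝ≥0∞) ∧
      (TopologicalSpace.denseSeq ℝ≥0 n : ℝ≥0∞) ≤ s} := by
    ext ω
    simp only [Set.mem_preimage, Set.mem_Iio, Set.mem_iUnion, Set.mem_ofPred_eq]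
    refine ⟨fun h => ?_, fun ⟨n, h, h'⟩ => h.trans_le h'⟩
    obtain ⟨a, ha, has⟩ := ENNReal.lt_iff_exists_nnreal_btwn.1 h
    obtain ⟨b, hb, hbs⟩ := ENNReal.lt_iff_exists_nnreal_btwn.1 has
    obtain ⟨_, ⟨n, rfl⟩, hn⟩ := (TopologicalSpace.denseRange_denseSeq ℝ≥0).exists_between
      (show a < b by exact_mod_cast hb)
    refine ⟨n, ha.trans (by exact_mod_cast hn.1), le_trans ?_ hbs.le⟩
    exact_mod_cast hn.2.le
  rw [this]
  exact MeasurableSet.iUnion fun n => (le_iSup (fun t => ℱ t) _ _ (hσ _)).inter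
    (MeasurableSet.const _)

lemma IsOptionalTime.measurable {σ : Ω → ℝ≥0∞} (hσ : IsOptionalTime ℱ σ) : Measurable σ :=
  hσ.measurable_iSup.mono (iSup_le ℱ.le) le_rfl

/-- An adapted right-continuous process stopped at an optional time is adapted. -/
lemma IsOptionalTime.measurable_stopped {σ : Ω → ℝ≥0∞} (hσ : IsOptionalTime ℱ σ)
    {U : ℝ≥0 → Ω → ℝ} (hU : ∀ t, Measurable[ℱ t] (U t))
    (hc : ∀ ω t, ContinuousWithinAt (fun s => U s ω) (Set.Ici t) t) (t : ℝ≥0) :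
    Measurable[ℱ t] (stoppedProcess U σ t) := by
  -- The process frozen at time `t` is jointly measurable for `ℱ t`, and a stopped value at time `t`
  -- only reads times up to `t`.
  have hj := measurable_uncurry_of_rightCont (m := ℱ t) (U := fun u ω => U (min u t) ω)
    (fun u => (hU _).mono (ℱ.mono (min_le_right u t)) le_rfl) (fun ω u => by
      refine ContinuousWithinAt.comp (f := fun u => min u t) (t := Set.Ici (min u t))
        (hc ω (min u t)) (continuous_id.min continuous_const).continuousWithinAt ?_
      exact fun v hv => min_le_min (α := ℝ≥0) hv le_rfl)
  have h3 := measurable_graph_comp (m := ℱ t) hj (hσ.measurable_min t)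
  convert h3 using 1
  funext ω
  rw [stoppedProcess_apply]
  simp only
  congr 1
  refine (min_eq_left ?_).symm
  exact ENNReal.toNNReal_mono ENNReal.coe_ne_top (min_le_left _ _)

lemma measurable_addFun_of_adapted {X : ℝ≥0 → Ω → ℝ} {w : ℝ → ℝ≥0}
    (hX : ∀ t, Measurable[ℱ t] (X t)) (hc : ∀ ω, IsCadlag fun t => X t ω)
    (hw : Measurable w) (t : ℝ≥0) : Measurable[ℱ t] fun ω => addFun X w t ω := by
  -- The path frozen at time `t` is `ℱ t`-measurable at all times, and the functional on `[0,t)`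
  -- does not distinguish it from the original path.
  have hc' : ∀ ω, IsCadlag fun u => X (min u t) ω := by
    intro ω
    have := isCadlag_stop (f := fun u => X u ω) (T := (t : ℝ≥0∞))
      (fun s _ => (hc ω).rightCont s) (fun s _ => (hc ω s).2)
    simpa [← ENNReal.coe_min] using this
  have h := measurable_addFun (m := ℱ t) (X := fun u ω => X (min u t) ω)
    (fun u => (hX _).mono (ℱ.mono (min_le_right u t)) le_rfl) hc' hw
  have h3 : Measurable[ℱ t] fun ω => addFun (fun u ω => X (min u t) ω) w t ω :=
    measurable_graph_comp (m := ℱ t) h measurable_const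
  convert h3 using 1
  funext ω
  refine lintegral_congr_ae ?_
  refine (ae_restrict_mem ?_).mono fun u hu => ?_
  · exact (measurableSet_le measurable_const measurable_id).inter
      (measurableSet_lt ENNReal.measurable_ofReal measurable_const)
  · have h := hu.2.le
    rw [ENNReal.ofReal] at h
    have h : u.toNNReal ≤ t := by exact_mod_cast h
    simp only [min_eq_left h]

lemma isOptionalTime_passageTime {X : ℝ≥0 → Ω → ℝ} (hX : ∀ t, Measurable[ℱ t] (X t))
    (hc : ∀ ω t, ContinuousWithinAt (fun t => X t ω) (Set.Ici t) t) (c : ℝ) :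
    IsOptionalTime ℱ (passageTime X c) := by
  intro t
  have : {ω | passageTime X c ω < t} = ⋃ n, {ω | 0 < TopologicalSpace.denseSeq ℝ≥0 n ∧
      c < X (TopologicalSpace.denseSeq ℝ≥0 n) ω ∧
      (TopologicalSpace.denseSeq ℝ≥0 n : ℝ≥0∞) < t} := by
    ext ω
    simp only [Set.mem_iUnion, Set.mem_ofPred_eq]
    exact passageTime_lt_iff_denseSeq (hc ω)
  rw [this]
  refine MeasurableSet.iUnion fun n => ?_
  by_cases hn : (TopologicalSpace.denseSeq ℝ≥0 n : ℝ≥0∞) < t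
  · have h1 : MeasurableSet[ℱ t] {ω | c < X (TopologicalSpace.denseSeq ℝ≥0 n) ω} :=
      measurableSet_lt measurable_const
        ((hX _).mono (ℱ.mono (by exact_mod_cast hn.le)) le_rfl)
    exact (MeasurableSet.const _).inter (h1.inter (MeasurableSet.const _))
  · convert @MeasurableSet.empty _ (ℱ t)
    ext ω
    simp [hn]

/-- Optional sampling: if the bounded right-continuous process `U` integrates to zero at fixed
times over the events of the filtration, then it does so at optional times. -/
lemma IsOptionalTime.setIntegral_eq_zero {μ : Measure Ω} [IsFiniteMeasure μ] {U : ℝ≥0 → Ω → ℝ}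
    (hU : ∀ t, Measurable (U t))
    (hc : ∀ ω t, ContinuousWithinAt (fun s => U s ω) (Set.Ici t) t)
    {C : ℝ} (hC : ∀ᵐ ω ∂μ, ∀ t, |U t ω| ≤ C)
    (h0 : ∀ t F, MeasurableSet[ℱ t] F → ∫ ω in F, U t ω ∂μ = 0)
    {σ : Ω → ℝ≥0∞} (hσ : IsOptionalTime ℱ σ) {F : Set Ω} (hF : MeasurableSet F)
    (hFσ : ∀ t : ℝ≥0, MeasurableSet[ℱ t] (F ∩ {ω | σ ω < t})) :
    ∫ ω in F ∩ {ω | σ ω < ∞}, U (σ ω).toNNReal ω ∂μ = 0 := by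
  have hj := measurable_uncurry_of_rightCont hU hc
  have hσm : Measurable fun ω => (σ ω).toNNReal := hσ.measurable.ennreal_toNNReal
  have hS : MeasurableSet (F ∩ {ω | σ ω < ∞}) :=
    hF.inter (measurableSet_lt hσ.measurable measurable_const)
  have hgm : ∀ n, Measurable fun ω => gridAbove n (σ ω).toNNReal := fun n => by
    have : Measurable fun k : ℕ => ((k : ℝ≥0) + 1) / (n + 1) := measurable_of_countable _
    exact (this.comp (measurable_floor_mul n)).comp hσm
  have hUm : ∀ n, Measurable fun ω => U (gridAbove n (σ ω).toNNReal) ω := fun n =>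
    hj.comp ((hgm n).prodMk measurable_id)
  have hC' : ∀ᵐ ω ∂(μ.restrict (F ∩ {ω | σ ω < ∞})), ∀ t, |U t ω| ≤ C :=
    ae_restrict_of_ae hC
  -- Sampling at the next grid point converges to sampling at `σ` by right-continuity and
  -- boundedness; for each grid the sampled integral will be shown to vanish.
  have hlim : Tendsto (fun n => ∫ ω in F ∩ {ω | σ ω < ∞}, U (gridAbove n (σ ω).toNNReal) ω ∂μ)
      atTop (𝓝 (∫ ω in F ∩ {ω | σ ω < ∞}, U (σ ω).toNNReal ω ∂μ)) := by
    refine tendsto_integral_of_dominated_convergence (fun _ => C)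
      (fun n => (hUm n).aestronglyMeasurable) (integrable_const _)
      (fun n => hC'.mono fun ω h => h _) (Eventually.of_forall fun ω => ?_)
    exact (hc ω _).tendsto.comp (tendsto_gridAbove_Ici _)
  refine tendsto_nhds_unique hlim (tendsto_const_nhds.congr fun n => ?_)
  symm
  -- `S k` is the part of `F` where `σ` lies in `[k/(n+1), (k+1)/(n+1))`. There the next grid point
  -- is the constant `(k+1)/(n+1)`, and since only strict inequalities on `σ` are used, `S k` is an
  -- event of the filtration at that time.
  set S : ℕ → Set Ω := fun k =>
    (F ∩ {ω | σ ω < (((k + 1) / (n + 1) : ℝ≥0) : ℝ≥0∞)}) \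
      (F ∩ {ω | σ ω < ((k / (n + 1) : ℝ≥0) : ℝ≥0∞)}) with hSdef
  have hSk : ∀ k, MeasurableSet[ℱ (((k : ℕ) + 1) / (n + 1))] (S k) := fun k =>
    (hFσ _).diff (ℱ.mono (by gcongr; simp) _ (hFσ _))
  have hmem : ∀ k ω, ω ∈ S k ↔ ω ∈ F ∧ σ ω < ∞ ∧ ⌊((n : ℝ≥0) + 1) * (σ ω).toNNReal⌋₊ = k := by
    intro k ω
    simp only [hSdef, Set.mem_sdiff, Set.mem_inter_iff, Set.mem_ofPred_eq, not_and, not_lt]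
    by_cases hω : ω ∈ F
    swap
    · simp [hω]
    by_cases htop : σ ω = ∞
    · simp [htop]
    lift σ ω to ℝ≥0 using htop with s
    have hn : (0 : ℝ≥0) < n + 1 := by positivity
    simp only [hω, true_and, forall_const, ENNReal.coe_lt_top, ENNReal.coe_lt_coe,
      ENNReal.coe_le_coe, ENNReal.toNNReal_coe, Nat.floor_eq_iff (zero_le (a := (n + 1) * s))]
    rw [lt_div_iff₀ hn, div_le_iff₀ hn, mul_comm s, and_comm]
  have hun : F ∩ {ω | σ ω < ∞} = ⋃ k, S k := by
    ext ω
    simp only [Set.mem_iUnion, hmem]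
    simp
  rw [hun, integral_iUnion (fun k => ℱ.le _ _ (hSk k))]
  · refine (tsum_congr fun k => ?_).trans tsum_zero
    rw [← h0 _ _ (hSk k)]
    refine setIntegral_congr_fun (ℱ.le _ _ (hSk k)) fun ω hω => ?_
    simp only [gridAbove, ((hmem k ω).1 hω).2.2]
  · intro k l hkl
    refine Set.disjoint_left.2 fun ω h1 h2 => hkl ?_
    rw [← ((hmem k ω).1 h1).2.2, ← ((hmem l ω).1 h2).2.2]
  · rw [← hun]
    refine Integrable.mono' (integrable_const C) (hUm n).aestronglyMeasurable ?_
    exact hC'.mono fun ω h => h _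

end Optional

/-! ### The space of paths -/

lemma tendsto_add_left_nhdsLT (t s : ℝ≥0) :
    Tendsto (fun u => t + u) (𝓝[<] s) (𝓝[<] (t + s)) := by
  refine tendsto_nhdsWithin_iff.2 ⟨?_, ?_⟩
  · exact ((continuous_const.add continuous_id).tendsto s).mono_left nhdsWithin_le_nhds
  · filter_upwards [self_mem_nhdsWithin] with u hu
    exact add_lt_add_right hu t

lemma IsSNPath.comp_add {f : ℝ≥0 → ℝ} (hf : IsSNPath f) (t : ℝ≥0) :
    IsSNPath fun s => f (t + s) := by
  have hlim : ∀ s l, Tendsto f (𝓝[<] (t + s)) (𝓝 l) →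
      Tendsto (fun u => f (t + u)) (𝓝[<] s) (𝓝 l) :=
    fun _ _ h => h.comp (tendsto_add_left_nhdsLT t _)
  refine ⟨fun s => ⟨?_, ?_⟩, fun s hs l hl => ?_⟩
  · refine ContinuousWithinAt.comp (f := fun u => t + u) (t := Set.Ici (t + s)) (hf.1 (t + s)).1
      (continuous_const.add continuous_id).continuousWithinAt ?_
    exact fun v hv => add_le_add_right (α := ℝ≥0) hv t
  · obtain ⟨l, hl⟩ := (hf.1 (t + s)).2
    exact ⟨l, hlim s l hl⟩
  · obtain ⟨l', hl'⟩ := (hf.1 (t + s)).2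
    have : (𝓝[<] s).NeBot := nhdsLT_neBot_of_exists_lt ⟨0, hs⟩
    rw [tendsto_nhds_unique hl (hlim s l' hl')]
    exact hf.2 _ (add_pos_of_nonneg_of_pos zero_le hs) l' hl'

lemma IsSNPath.const_add {f : ℝ≥0 → ℝ} (hf : IsSNPath f) (y : ℝ) :
    IsSNPath fun s => y + f s := by
  refine ⟨fun s => ⟨continuousWithinAt_const.add (hf.1 s).1, ?_⟩, fun s hs l hl => ?_⟩
  · obtain ⟨l, hl⟩ := (hf.1 s).2
    exact ⟨y + l, tendsto_const_nhds.add hl⟩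
  · have := hf.2 s hs (-y + l) (by simpa using (tendsto_const_nhds (x := -y)).add hl)
    linarith

/-- The space of càdlàg paths without positive jumps. -/
abbrev SNPath : Type := {f : ℝ≥0 → ℝ // IsSNPath f}

/-- The coordinate process on the space of paths. -/
def coord (t : ℝ≥0) (f : SNPath) : ℝ := f.1 t

lemma measurable_coord (t : ℝ≥0) : Measurable (coord t) :=
  (measurable_pi_apply t).comp measurable_subtype_coe

lemma isSNPath_coord (f : SNPath) : IsSNPath fun t => coord t f := f.2

/-- The path translated in space. -/
def translate (y : ℝ) (f : SNPath) : SNPath := ⟨fun s => y + f.1 s, f.2.const_add y⟩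

lemma measurable_snPath {Ω : Type*} {m : MeasurableSpace Ω} {g : Ω → SNPath}
    (hg : ∀ t, Measurable fun ω => (g ω).1 t) : Measurable g :=
  Measurable.subtype_mk (measurable_pi_iff.2 hg)

lemma measurable_translate : Measurable fun p : ℝ × SNPath => translate p.1 p.2 :=
  measurable_snPath fun t => measurable_fst.add ((measurable_coord t).comp measurable_snd)

/-- The path of a process. -/
def pathMap {Ω : Type*} {X : ℝ≥0 → Ω → ℝ} (hp : ∀ ω, IsSNPath fun t => X t ω) (ω : Ω) : SNPath :=
  ⟨fun t => X t ω, hp ω⟩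

/-- The path of the increments of a process after time `t`. -/
def shiftMap {Ω : Type*} {X : ℝ≥0 → Ω → ℝ} (hp : ∀ ω, IsSNPath fun t => X t ω) (t : ℝ≥0) (ω : Ω) :
    SNPath :=
  ⟨fun s => -X t ω + X (t + s) ω, ((hp ω).comp_add t).const_add _⟩

lemma measurable_pathMap {Ω : Type*} {m : MeasurableSpace Ω} {X : ℝ≥0 → Ω → ℝ}
    (hp : ∀ ω, IsSNPath fun t => X t ω) (hX : ∀ t, Measurable (X t)) : Measurable (pathMap hp) :=
  measurable_snPath hX

lemma measurable_shiftMap {Ω : Type*} {m : MeasurableSpace Ω} {X : ℝ≥0 → Ω → ℝ}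
    (hp : ∀ ω, IsSNPath fun t => X t ω) (hX : ∀ t, Measurable (X t)) (t : ℝ≥0) :
    Measurable (shiftMap hp t) :=
  measurable_snPath fun _ => (hX t).neg.add (hX _)

/-- The cylinders form a π-system generating the trace of the product σ-algebra, so
finite-dimensional laws determine a finite measure on paths. -/
lemma snPath_measure_ext {μ ν : Measure SNPath} [IsFiniteMeasure μ] [IsFiniteMeasure ν]
    (h : ∀ (I : Finset ℝ≥0) (S : ℝ≥0 → Set ℝ), (∀ s, MeasurableSet (S s)) →
      μ {f | ∀ s ∈ I, f.1 s ∈ S s} = ν {f | ∀ s ∈ I, f.1 s ∈ S s}) : μ = ν := by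
  set C := squareCylinders fun _ : ℝ≥0 => {s : Set ℝ | MeasurableSet s}
  have hgen : (inferInstance : MeasurableSpace SNPath) =
      MeasurableSpace.generateFrom (Set.preimage Subtype.val '' C) := by
    rw [← MeasurableSpace.comap_generateFrom, generateFrom_squareCylinders]
    rfl
  have hpi : IsPiSystem (Set.preimage (Subtype.val : SNPath → ℝ≥0 → ℝ) '' C) := by
    have := (isPiSystem_squareCylinders (ι := ℝ≥0)
      (fun _ => MeasurableSpace.isPiSystem_measurableSet)
      (fun _ => MeasurableSet.univ)).comap (Subtype.val : SNPath → ℝ≥0 → ℝ)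
    convert this using 1
    rfl
  have key : ∀ A ∈ Set.preimage (Subtype.val : SNPath → ℝ≥0 → ℝ) '' C, μ A = ν A := by
    rintro _ ⟨B, ⟨I, S, hS, rfl⟩, rfl⟩
    have h1 := h I S (fun s => hS s (Set.mem_univ _))
    convert h1 using 2 <;> ext f <;> simp
  refine ext_of_generate_finite _ hgen hpi key ?_
  have h1 := h ∅ (fun _ => Set.univ) (fun _ => MeasurableSet.univ)
  simpa using h1

/-- Continuous test functions are needed for the strong Markov property: they keep functionals of
the shifted path right-continuous in the shift. -/
lemma snPath_measure_ext_of_integral {μ ν : Measure SNPath} [IsFiniteMeasure μ] [IsFiniteMeasure ν]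
    (h : ∀ (I : Finset ℝ≥0) (g : BoundedContinuousFunction (I → ℝ) ℝ),
      ∫ f, g (fun s => f.1 s) ∂μ = ∫ f, g (fun s => f.1 s) ∂ν) : μ = ν := by
  have hm : ∀ I : Finset ℝ≥0, Measurable fun (f : SNPath) (s : I) => f.1 s :=
    fun I => measurable_pi_iff.2 fun s => measurable_coord (s : ℝ≥0)
  have hI : ∀ I : Finset ℝ≥0, μ.map (fun (f : SNPath) (s : I) => f.1 s) =
      ν.map (fun (f : SNPath) (s : I) => f.1 s) := by
    intro I
    refine ext_of_forall_integral_eq_of_IsFiniteMeasure fun g => ?_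
    rw [integral_map (hm I).aemeasurable g.continuous.aestronglyMeasurable,
      integral_map (hm I).aemeasurable g.continuous.aestronglyMeasurable]
    exact h I g
  refine snPath_measure_ext fun I S hS => ?_
  have hset : {f : SNPath | ∀ s ∈ I, f.1 s ∈ S s} =
      (fun (f : SNPath) (s : I) => f.1 s) ⁻¹' (Set.univ.pi fun s : I => S s) := by
    ext f
    simp
  have hpi : MeasurableSet (Set.univ.pi fun s : I => S s) := MeasurableSet.univ_pi fun s => hS s
  rw [hset, ← Measure.map_apply (hm I) hpi, ← Measure.map_apply (hm I) hpi, hI]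

/-! ### Independence -/

/-- The freezing lemma: the joint law of `U` and `V` is a product, so Tonelli lets `V` be integrated
out with `U` held fixed. -/
lemma lintegral_of_indep {Ω α β : Type*} {𝓐 m : MeasurableSpace Ω} [MeasurableSpace α]
    [MeasurableSpace β] {μ : Measure Ω} [IsProbabilityMeasure μ] (h𝓐 : 𝓐 ≤ m) {V : Ω → β}
    (hV : Measurable V) (hind : Indep 𝓐 (MeasurableSpace.comap V inferInstance) μ)
    {U : Ω → α} (hU : Measurable[𝓐] U) {k : α × β → ℝ≥0∞} (hk : Measurable k) :
    ∫⁻ ω, k (U ω, V ω) ∂μ = ∫⁻ ω, ∫⁻ v, k (U ω, v) ∂(μ.map V) ∂μ := by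
  have hU' : Measurable U := hU.mono h𝓐 le_rfl
  have hI : IndepFun U V μ := indep_of_indep_of_le_left hind hU.comap_le
  have : IsProbabilityMeasure (μ.map V) := Measure.isProbabilityMeasure_map hV.aemeasurable
  calc ∫⁻ ω, k (U ω, V ω) ∂μ = ∫⁻ p, k p ∂(μ.map fun ω => (U ω, V ω)) :=
        (lintegral_map hk (hU'.prodMk hV)).symm
    _ = ∫⁻ p, k p ∂((μ.map U).prod (μ.map V)) := by
        rw [hI.map_prod_eq_prod_map_map hU'.aemeasurable hV.aemeasurable]
    _ = ∫⁻ u, ∫⁻ v, k (u, v) ∂(μ.map V) ∂(μ.map U) := lintegral_prod _ hk.aemeasurable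
    _ = _ := lintegral_map hk.lintegral_prod_right' hU'

/-! ### The Markov property -/

section Markov

variable {Ω : Type*} {m : MeasurableSpace Ω} {P : ℝ → Measure Ω} {X : ℝ≥0 → Ω → ℝ}

lemma IsSpectrallyNegativeLevy.isSNPath (hX : IsSpectrallyNegativeLevy P X) (ω : Ω) :
    IsSNPath fun t => X t ω := ⟨hX.cadlag ω, hX.no_pos_jump ω⟩

/-- The law of the path of the increments after time `0`. -/
noncomputable def IsSpectrallyNegativeLevy.pathLaw (hX : IsSpectrallyNegativeLevy P X) :
    Measure SNPath := (P 0).map (shiftMap hX.isSNPath 0)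

instance (hX : IsSpectrallyNegativeLevy P X) : IsProbabilityMeasure hX.pathLaw :=
  have := hX.prob 0
  Measure.isProbabilityMeasure_map (measurable_shiftMap _ hX.measurable 0).aemeasurable

lemma IsSpectrallyNegativeLevy.map_increment (hX : IsSpectrallyNegativeLevy P X) (x : ℝ)
    (t s : ℝ≥0) : (P x).map (fun ω => X (t + s) ω - X t ω) =
      (P 0).map (fun ω => X s ω - X 0 ω) := by
  rw [← hX.stat_incr t s]
  have hm : Measurable fun f : ℝ≥0 → ℝ => f (t + s) - f t :=
    (measurable_pi_apply _).sub (measurable_pi_apply _)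
  have hp : Measurable fun ω (t : ℝ≥0) => X t ω := measurable_pi_iff.2 hX.measurable
  have hp' : Measurable fun ω (t : ℝ≥0) => x + X t ω :=
    measurable_pi_iff.2 fun t => (hX.measurable t).const_add x
  have h := congrArg (Measure.map fun f : ℝ≥0 → ℝ => f (t + s) - f t) (hX.law_shift x)
  rw [Measure.map_map hm hp, Measure.map_map hm hp'] at h
  simpa [Function.comp_def] using h

lemma IsSpectrallyNegativeLevy.ae_start (hX : IsSpectrallyNegativeLevy P X) (x : ℝ) :
    ∀ᵐ ω ∂(P x), X 0 ω = x := by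
  have hp : Measurable fun ω (t : ℝ≥0) => X t ω := measurable_pi_iff.2 hX.measurable
  have hp' : Measurable fun ω (t : ℝ≥0) => x + X t ω :=
    measurable_pi_iff.2 fun t => (hX.measurable t).const_add x
  have hS : MeasurableSet {f : ℝ≥0 → ℝ | f 0 = x} :=
    measurableSet_eq_fun (measurable_pi_apply 0) measurable_const
  have h : ∀ᵐ f ∂((P x).map fun ω (t : ℝ≥0) => X t ω), f 0 = x := by
    rw [hX.law_shift x, ae_map_iff hp'.aemeasurable hS]
    filter_upwards [hX.start] with ω hω
    simp [hω]
  exact (ae_map_iff hp.aemeasurable hS).1 h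

variable {ℱ : Filtration ℝ≥0 m}

/-- The finite-dimensional laws of the increments after time `t`, on events of `ℱ t`, depend
neither on the starting point nor on `t`. -/
lemma exists_setLIntegral_prod_increment (hX : IsSpectrallyNegativeLevy P X)
    (hℱ : HasIndepIncrementsRel P X ℱ) (I : Finset ℝ≥0) :
    ∀ g : ℝ≥0 → ℝ → ℝ≥0∞, (∀ s, Measurable (g s)) →
      ∃ K : ℝ≥0∞, ∀ (x : ℝ) (t : ℝ≥0) (F : Set Ω), MeasurableSet[ℱ t] F →
        ∫⁻ ω in F, ∏ s ∈ I, g s (X (t + s) ω - X t ω) ∂(P x) = P x F * K := by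
  classical
  induction I using Finset.induction_on_max with
  | empty => exact fun g _ => ⟨1, fun x t F hF => by simp⟩
  | insert u I hu ih =>
    intro g hg
    -- `p` is the time preceding `u`
    obtain ⟨p, hpu, hIp, hp⟩ : ∃ p ≤ u, (∀ s ∈ I, s ≤ p) ∧ (p ∈ I ∨ I = ∅ ∧ p = 0) := by
      rcases I.eq_empty_or_nonempty with rfl | hne
      · exact ⟨0, zero_le, by simp, Or.inr ⟨rfl, rfl⟩⟩
      · exact ⟨I.max' hne, (hu _ (I.max'_mem hne)).le, fun s hs => I.le_max' s hs,
          Or.inl (I.max'_mem hne)⟩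
    set lam := (P 0).map (fun ω => X (u - p) ω - X 0 ω) with hlam
    have := hX.prob 0
    have : IsProbabilityMeasure lam := Measure.isProbabilityMeasure_map
      ((hX.measurable _).sub (hX.measurable 0)).aemeasurable
    -- The last increment, from `t + p` to `t + u`, is independent of `ℱ (t + p)` with law `lam`.
    -- Integrating it out replaces the factor at `u` by `g'` at `p`.
    set g' : ℝ → ℝ≥0∞ := fun y => ∫⁻ d, g u (y + d) ∂lam with hg'def
    have hg' : Measurable g' := by
      have h1 : Measurable fun p : ℝ × ℝ => p.1 + p.2 := measurable_fst.add measurable_snd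
      have h2 : Measurable fun p : ℝ × ℝ => g u (p.1 + p.2) := (hg u).comp h1
      exact h2.lintegral_prod_right'
    have step : ∀ (x : ℝ) (t : ℝ≥0) (F : Set Ω), MeasurableSet[ℱ t] F →
        ∫⁻ ω in F, ∏ s ∈ insert u I, g s (X (t + s) ω - X t ω) ∂(P x) =
        ∫⁻ ω in F, (∏ s ∈ I, g s (X (t + s) ω - X t ω)) * g' (X (t + p) ω - X t ω) ∂(P x) := by
      intro x t F hF
      have := hX.prob x
      have hFm := ℱ.le _ _ hF
      have hF' : MeasurableSet[ℱ (t + p)] F := ℱ.mono le_self_add _ hF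
      have had : ∀ s ≤ t + p, Measurable[ℱ (t + p)] (X s) :=
        fun s hs => (hℱ.adapted s).mono (ℱ.mono hs) le_rfl
      have hUm : Measurable[ℱ (t + p)] fun ω =>
          (F.indicator (fun ω => ∏ s ∈ I, g s (X (t + s) ω - X t ω)) ω, X (t + p) ω - X t ω) := by
        refine Measurable.prodMk (Measurable.indicator ?_ hF') ?_
        · refine Finset.measurable_fun_prod _ fun s hs => (hg s).comp ?_
          exact (had _ (by gcongr; exact hIp s hs)).sub (had _ le_self_add)
        · exact (had _ le_rfl).sub (had _ le_self_add)
      have hk : Measurable fun q : (ℝ≥0∞ × ℝ) × ℝ => q.1.1 * g u (q.1.2 + q.2) :=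
        (measurable_fst.comp measurable_fst).mul
          ((hg u).comp ((measurable_snd.comp measurable_fst).add measurable_snd))
      have h := lintegral_of_indep (V := fun ω => X (t + p + (u - p)) ω - X (t + p) ω)
        (ℱ.le (t + p)) ((hX.measurable (t + p + (u - p))).sub (hX.measurable (t + p)))
        (hℱ.indep x (t + p) (t + p + (u - p)) le_self_add).symm hUm hk
      rw [hX.map_increment, ← hlam] at h
      have htu : t + p + (u - p) = t + u := by rw [add_assoc, add_tsub_cancel_of_le hpu]
      rw [htu] at h
      rw [← lintegral_indicator hFm, ← lintegral_indicator hFm]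
      refine Eq.trans (lintegral_congr fun ω => ?_) (h.trans (lintegral_congr fun ω => ?_))
      · by_cases hω : ω ∈ F
        · have hnot : u ∉ I := fun h => lt_irrefl _ (hu u h)
          simp only [Set.indicator_of_mem hω, Finset.prod_insert hnot]
          rw [mul_comm]
          congr 2
          simp
        · simp [hω]
      · simp only
        have hgu : Measurable fun v => g u (X (t + p) ω - X t ω + v) :=
          (hg u).comp (measurable_const_add _)
        rw [lintegral_const_mul _ hgu]
        by_cases hω : ω ∈ F
        · simp only [Set.indicator_of_mem hω, hg'def]
        · simp [hω]
    rcases hp with hp | ⟨rfl, rfl⟩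
    -- The factor `g'` is absorbed into the one already attached to `p`, which leaves a product over
    -- the earlier times only.
    · obtain ⟨K, hK⟩ := ih (Function.update g p fun y => g p y * g' y) (fun s => by
        rcases eq_or_ne s p with rfl | hs
        · simpa [Function.update_self] using (hg s).fun_mul hg'
        · simpa [hs] using hg s)
      refine ⟨K, fun x t F hF => ?_⟩
      rw [step x t F hF, ← hK x t F hF]
      refine lintegral_congr fun ω => ?_
      rw [← Finset.mul_prod_erase I _ hp, ← Finset.mul_prod_erase I _ hp]
      simp only [Function.update_self]
      have : ∏ s ∈ I.erase p, Function.update g p (fun y => g p y * g' y) s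
          (X (t + s) ω - X t ω) = ∏ s ∈ I.erase p, g s (X (t + s) ω - X t ω) :=
        Finset.prod_congr rfl fun s hs => by
          rw [Function.update_of_ne (Finset.ne_of_mem_erase hs)]
      rw [this]
      ring
    · refine ⟨g' 0, fun x t F hF => ?_⟩
      rw [step x t F hF]
      simp [mul_comm]

/-- The Markov property at fixed times. -/
lemma measure_inter_shiftMap (hX : IsSpectrallyNegativeLevy P X)
    (hℱ : HasIndepIncrementsRel P X ℱ) (x : ℝ) (t : ℝ≥0) {F : Set Ω} (hF : MeasurableSet[ℱ t] F)
    {S : Set SNPath} (hS : MeasurableSet S) :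
    P x (shiftMap hX.isSNPath t ⁻¹' S ∩ F) = P x F * hX.pathLaw S := by
  have := hX.prob x
  have := hX.prob 0
  have hsm := fun t => measurable_shiftMap hX.isSNPath hX.measurable t
  have key : ((P x).restrict F).map (shiftMap hX.isSNPath t) = P x F • hX.pathLaw := by
    have : IsFiniteMeasure (P x F • hX.pathLaw) :=
      ⟨by simp⟩
    refine snPath_measure_ext fun I S hS => ?_
    obtain ⟨K, hK⟩ := exists_setLIntegral_prod_increment hX hℱ I
      (fun s => (S s).indicator 1) (fun s => measurable_one.indicator (hS s))
    have hcyl : MeasurableSet {f : SNPath | ∀ s ∈ I, f.1 s ∈ S s} := by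
      have : {f : SNPath | ∀ s ∈ I, f.1 s ∈ S s} = ⋂ s ∈ I, coord s ⁻¹' S s := by
        ext f; simp [coord]
      rw [this]
      exact Finset.measurableSet_biInter _ fun s _ => measurable_coord s (hS s)
    have h1 : ∀ (x : ℝ) (t : ℝ≥0) (F : Set Ω), MeasurableSet[ℱ t] F →
        P x (shiftMap hX.isSNPath t ⁻¹' {f : SNPath | ∀ s ∈ I, f.1 s ∈ S s} ∩ F) = P x F * K := by
      intro x t F hF
      rw [← hK x t F hF, ← Measure.restrict_apply (hsm t hcyl),
        ← lintegral_indicator_one (hsm t hcyl)]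
      refine lintegral_congr fun ω => ?_
      by_cases hω : ∀ s ∈ I, X (t + s) ω - X t ω ∈ S s
      · rw [Set.indicator_of_mem, Finset.prod_eq_one]
        · rfl
        · exact fun s hs => by simp [hω s hs]
        · intro s hs
          have := hω s hs
          rw [sub_eq_neg_add] at this
          exact this
      · rw [Set.indicator_of_notMem]
        · push Not at hω
          obtain ⟨s, hs, hsS⟩ := hω
          exact (Finset.prod_eq_zero hs (by simp [hsS])).symm
        · intro h
          refine hω fun s hs => ?_
          rw [sub_eq_neg_add]
          exact h s hs
    rw [Measure.map_apply (hsm t) hcyl, Measure.restrict_apply (hsm t hcyl), h1 x t F hF,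
      Measure.smul_apply, IsSpectrallyNegativeLevy.pathLaw, Measure.map_apply (hsm 0) hcyl]
    -- The constant `K` serves every starting point, time and event; the case `0`, `0`, `univ`
    -- identifies it as the mass given by `pathLaw`.
    have h2 := h1 0 0 Set.univ MeasurableSet.univ
    simp only [Set.inter_univ, measure_univ, one_mul] at h2
    rw [h2, smul_eq_mul]
  rw [← Measure.restrict_apply (hsm t hS), ← Measure.map_apply (hsm t) hS, key,
    Measure.smul_apply, smul_eq_mul]

lemma map_shiftMap (hX : IsSpectrallyNegativeLevy P X) (hℱ : HasIndepIncrementsRel P X ℱ)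
    (x : ℝ) (t : ℝ≥0) : (P x).map (shiftMap hX.isSNPath t) = hX.pathLaw := by
  have := hX.prob x
  have hsm := measurable_shiftMap hX.isSNPath hX.measurable t
  ext S hS
  have h := measure_inter_shiftMap hX hℱ x t MeasurableSet.univ hS
  rwa [Set.inter_univ, measure_univ, one_mul, ← Measure.map_apply hsm hS] at h

lemma indep_shiftMap (hX : IsSpectrallyNegativeLevy P X) (hℱ : HasIndepIncrementsRel P X ℱ)
    (x : ℝ) (t : ℝ≥0) :
    Indep (ℱ t) (MeasurableSpace.comap (shiftMap hX.isSNPath t) inferInstance) (P x) := by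
  rw [Indep_iff]
  rintro F _ hF ⟨S, hS, rfl⟩
  rw [Set.inter_comm, measure_inter_shiftMap hX hℱ x t hF hS, ← map_shiftMap hX hℱ x t,
    Measure.map_apply (measurable_shiftMap hX.isSNPath hX.measurable t) hS]

/-- Almost surely `X 0 = x`, so the path is `x` plus the path of increments after time `0`. All
starting points can thus be compared on one probability space. -/
lemma map_pathMap (hX : IsSpectrallyNegativeLevy P X) (hℱ : HasIndepIncrementsRel P X ℱ) (x : ℝ) :
    (P x).map (pathMap hX.isSNPath) = hX.pathLaw.map (translate x) := by
  have htr : Measurable (translate x) := measurable_translate.comp measurable_prodMk_left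
  rw [← map_shiftMap hX hℱ x 0,
    Measure.map_map htr (measurable_shiftMap hX.isSNPath hX.measurable 0)]
  refine Measure.map_congr ?_
  filter_upwards [hX.ae_start x] with ω hω
  refine Subtype.ext (funext fun s => ?_)
  simp [pathMap, translate, shiftMap, hω]

/-- The strong Markov property at optional times. -/
lemma setLIntegral_shiftMap_optional (hX : IsSpectrallyNegativeLevy P X)
    (hℱ : HasIndepIncrementsRel P X ℱ) (x : ℝ) {R : ℝ≥0 → Ω → ℝ}
    (hR : ∀ t, Measurable[ℱ t] (R t))
    (hRc : ∀ ω t, ContinuousWithinAt (fun s => R s ω) (Set.Ici t) t)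
    (hR0 : ∀ t ω, 0 ≤ R t ω) (hR1 : ∀ t ω, R t ω ≤ 1)
    {σ : Ω → ℝ≥0∞} (hσ : IsOptionalTime ℱ σ) {Ψ : SNPath → ℝ≥0∞} (hΨ : Measurable Ψ) :
    ∫⁻ ω in {ω | σ ω < ∞}, ENNReal.ofReal (R (σ ω).toNNReal ω) *
        Ψ (shiftMap hX.isSNPath (σ ω).toNNReal ω) ∂(P x) =
      (∫⁻ ω in {ω | σ ω < ∞}, ENNReal.ofReal (R (σ ω).toNNReal ω) ∂(P x)) *
        ∫⁻ f, Ψ f ∂hX.pathLaw := by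
  have := hX.prob x
  have hRm : ∀ t, Measurable (R t) := fun t => (hR t).mono (ℱ.le t) le_rfl
  have hσm : Measurable fun ω => (σ ω).toNNReal := hσ.measurable.ennreal_toNNReal
  have hRσ : Measurable fun ω => R (σ ω).toNNReal ω :=
    measurable_graph_comp (measurable_uncurry_of_rightCont hRm hRc) hσm
  have hXj := measurable_uncurry_of_rightCont hX.measurable (fun ω => (hX.cadlag ω).rightCont)
  have hsh : Measurable fun ω => shiftMap hX.isSNPath (σ ω).toNNReal ω := by
    refine measurable_snPath fun s => ?_
    exact (measurable_graph_comp hXj hσm).neg.add (measurable_graph_comp hXj (hσm.add_const s))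
  set d : Ω → ℝ≥0∞ := fun ω => ENNReal.ofReal (R (σ ω).toNNReal ω) with hd
  have hdm : Measurable d := hRσ.ennreal_ofReal
  -- Under the measure weighted by `R` at time `σ`, the claim becomes that the shifted path has law
  -- proportional to `pathLaw`.
  set κ := ((P x).restrict {ω | σ ω < ∞}).withDensity d with hκ
  have hκfin : IsFiniteMeasure κ := by
    refine isFiniteMeasure_withDensity ?_
    refine ((lintegral_mono (g := fun _ => 1) fun ω => ?_).trans_lt ?_).ne
    · exact ENNReal.ofReal_le_one.2 (hR1 _ ω)
    · simp [measure_lt_top]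
  have key : κ.map (fun ω => shiftMap hX.isSNPath (σ ω).toNNReal ω) =
      κ Set.univ • hX.pathLaw := by
    have : IsFiniteMeasure (κ Set.univ • hX.pathLaw) :=
      ⟨by simp⟩
    refine snPath_measure_ext_of_integral fun I g => ?_
    have hev : Measurable fun f : SNPath => g (fun s : I => f.1 s) :=
      g.continuous.measurable.comp (measurable_pi_iff.2 fun s => measurable_coord s)
    have hgb : ∀ f : SNPath, |g (fun s : I => f.1 s)| ≤ ‖g‖ := fun f => g.norm_coe_le_norm _
    set C := ∫ f, g (fun s : I => f.1 s) ∂hX.pathLaw with hC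
    have hCb : |C| ≤ ‖g‖ := by
      have h := norm_integral_le_of_norm_le_const (μ := hX.pathLaw)
        (f := fun f : SNPath => g (fun s : I => f.1 s)) (Eventually.of_forall hgb)
      simpa using h
    -- the process to be sampled
    set U : ℝ≥0 → Ω → ℝ := fun t ω =>
      R t ω * (g (fun s : I => (shiftMap hX.isSNPath t ω).1 s) - C) with hU
    have hUm : ∀ t, Measurable (U t) := fun t => (hRm t).mul
      ((hev.comp (measurable_shiftMap hX.isSNPath hX.measurable t)).sub_const C)
    have hUc : ∀ ω t, ContinuousWithinAt (fun s => U s ω) (Set.Ici t) t := by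
      intro ω t
      refine (hRc ω t).mul (ContinuousWithinAt.sub ?_ continuousWithinAt_const)
      refine g.continuous.continuousAt.comp_continuousWithinAt ?_
      refine continuousWithinAt_pi.2 fun s => ?_
      refine ((hX.cadlag ω).rightCont t).neg.add ?_
      refine ContinuousWithinAt.comp (f := fun u => u + (s : ℝ≥0)) (t := Set.Ici (t + s))
        ((hX.cadlag ω).rightCont (t + s)) (continuous_id.add continuous_const).continuousWithinAt ?_
      exact fun v hv => add_le_add_left (α := ℝ≥0) hv s
    have hUb : ∀ ω t, |U t ω| ≤ 1 * (‖g‖ + ‖g‖) := by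
      intro ω t
      rw [hU, abs_mul, abs_of_nonneg (hR0 t ω)]
      gcongr
      · exact hR1 t ω
      · exact (abs_sub _ _).trans (add_le_add (hgb _) hCb)
    -- At a fixed time the shifted path is independent of `ℱ t` with law `pathLaw`, and `C` is the
    -- corresponding mean. Optional sampling then transfers the vanishing to `σ`.
    have hU0 : ∀ t F, MeasurableSet[ℱ t] F → ∫ ω in F, U t ω ∂(P x) = 0 := by
      intro t F hF
      have hsm := measurable_shiftMap hX.isSNPath hX.measurable t
      rw [← integral_indicator (ℱ.le _ _ hF)]
      have hrw : F.indicator (U t) = fun ω => F.indicator (R t) ω *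
          (g (fun s : I => (shiftMap hX.isSNPath t ω).1 s) - C) := by
        funext ω
        by_cases hω : ω ∈ F <;> simp [hω, hU]
      have hind : IndepFun (F.indicator (R t)) (fun ω =>
          g (fun s : I => (shiftMap hX.isSNPath t ω).1 s) - C) (P x) := by
        have h1 : Measurable[MeasurableSpace.comap (shiftMap hX.isSNPath t) inferInstance]
            (fun ω => g (fun s : I => (shiftMap hX.isSNPath t ω).1 s) - C) :=
          (hev.sub_const C).comp (comap_measurable _)
        exact indep_of_indep_of_le_right (indep_of_indep_of_le_left (indep_shiftMap hX hℱ x t)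
          ((hR t).indicator hF).comap_le) h1.comap_le
      have hgi : Integrable (fun f : SNPath => g (fun s : I => f.1 s)) hX.pathLaw :=
        Integrable.mono' (integrable_const ‖g‖) hev.aestronglyMeasurable
          (Eventually.of_forall hgb)
      have hzero : ∫ ω, (g (fun s : I => (shiftMap hX.isSNPath t ω).1 s) - C) ∂(P x) = 0 := by
        have h := integral_map (μ := P x) hsm.aemeasurable
          (f := fun f : SNPath => g (fun s : I => f.1 s) - C)
          (hev.sub_const C).aestronglyMeasurable
        rw [← h, map_shiftMap hX hℱ, integral_sub hgi (integrable_const _)]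
        simp [hC]
      rw [hrw, hind.integral_fun_mul_eq_mul_integral, hzero, mul_zero]
      · exact ((hRm t).indicator (ℱ.le _ _ hF)).aestronglyMeasurable
      · exact ((hev.comp hsm).sub_const C).aestronglyMeasurable
    have hOS := hσ.setIntegral_eq_zero hUm hUc (Eventually.of_forall hUb) hU0 MeasurableSet.univ
      (fun t => by simpa using hσ t)
    rw [Set.univ_inter] at hOS
    have hκint : ∀ h : Ω → ℝ, ∫ ω, h ω ∂κ =
        ∫ ω in {ω | σ ω < ∞}, R (σ ω).toNNReal ω * h ω ∂(P x) := by
      intro h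
      rw [hκ, integral_withDensity_eq_integral_toReal_smul hdm
        (Eventually.of_forall fun ω => ENNReal.ofReal_lt_top)]
      simp only [hd, smul_eq_mul, ENNReal.toReal_ofReal (hR0 _ _)]
    rw [integral_map hsh.aemeasurable hev.aestronglyMeasurable, integral_smul_measure, ← hC]
    have hgκ : Integrable (fun ω => g (fun s : I =>
        (shiftMap hX.isSNPath (σ ω).toNNReal ω).1 s)) κ :=
      Integrable.mono' (integrable_const ‖g‖) (hev.comp hsh).aestronglyMeasurable
        (Eventually.of_forall fun ω => hgb _)
    have h3 : ∫ ω, (g (fun s : I => (shiftMap hX.isSNPath (σ ω).toNNReal ω).1 s) - C) ∂κ = 0 := by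
      rw [hκint]
      exact hOS
    rw [integral_sub hgκ (integrable_const _), integral_const] at h3
    rw [sub_eq_zero.1 h3]
    rfl
  have h4 : ∫⁻ ω, Ψ (shiftMap hX.isSNPath (σ ω).toNNReal ω) ∂κ =
      κ Set.univ * ∫⁻ f, Ψ f ∂hX.pathLaw := by
    rw [← lintegral_map hΨ hsh, key, lintegral_smul_measure, smul_eq_mul]
  have h5 := lintegral_withDensity_eq_lintegral_mul ((P x).restrict {ω | σ ω < ∞}) hdm
    (hΨ.comp hsh)
  simp only [Function.comp_def] at h5
  rw [hκ, h5, withDensity_apply _ MeasurableSet.univ, Measure.restrict_univ] at h4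
  exact h4

end Markov

/-! ### The discount factor at the passage time -/

/-- `exp (-∫_0^τ w (X u) du - q τ) 1_{τ < ∞}`, with `τ` the passage time above `c`. -/
noncomputable def passageDiscount {Ω : Type*} (X : ℝ≥0 → Ω → ℝ) (w : ℝ → ℝ≥0) (q : ℝ≥0) (c : ℝ)
    (ω : Ω) : ℝ :=
  {ω' | passageTime X c ω' < ∞}.indicator
    (fun ω' => Real.exp (-(addFun X w (passageTime X c ω') ω').toReal
      - q * (passageTime X c ω').toReal)) ω

/-- `exp (-∫_0^t w (X u) du - q t)`. -/
noncomputable def discount {Ω : Type*} (X : ℝ≥0 → Ω → ℝ) (w : ℝ → ℝ≥0) (q : ℝ≥0) (t : ℝ≥0)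
    (ω : Ω) : ℝ :=
  Real.exp (-(addFun X w t ω).toReal - q * t)

section Discount

variable {Ω : Type*} {X : ℝ≥0 → Ω → ℝ} {w : ℝ → ℝ≥0} {q : ℝ≥0} {c : ℝ} {ω : Ω}

lemma passageDiscount_of_eq_top (h : passageTime X c ω = ∞) : passageDiscount X w q c ω = 0 := by
  simp [passageDiscount, h]

lemma passageDiscount_of_eq_coe {t : ℝ≥0} (h : passageTime X c ω = t) :
    passageDiscount X w q c ω = discount X w q t ω := by
  simp [passageDiscount, discount, h]

lemma discount_pos (t : ℝ≥0) : 0 < discount X w q t ω := Real.exp_pos _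

lemma discount_le_one (t : ℝ≥0) : discount X w q t ω ≤ 1 := by
  refine Real.exp_le_one_iff.2 ?_
  have : 0 ≤ (addFun X w t ω).toReal := ENNReal.toReal_nonneg
  have : 0 ≤ (q : ℝ) * t := by positivity
  linarith

lemma passageDiscount_nonneg : 0 ≤ passageDiscount X w q c ω :=
  Set.indicator_nonneg (fun _ _ => (Real.exp_pos _).le) _

lemma passageDiscount_le_one : passageDiscount X w q c ω ≤ 1 := by
  by_cases h : passageTime X c ω = ∞
  · simp [passageDiscount_of_eq_top h]
  · rw [passageDiscount_of_eq_coe (ENNReal.coe_toNNReal h).symm]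
    exact discount_le_one _

lemma passageDiscount_pos_iff : 0 < passageDiscount X w q c ω ↔ passageTime X c ω < ∞ := by
  by_cases h : passageTime X c ω = ∞
  · simp [passageDiscount_of_eq_top h, h]
  · simp [passageDiscount_of_eq_coe (ENNReal.coe_toNNReal h).symm, discount_pos,
      lt_top_iff_ne_top, h]

lemma continuous_discount (hw : Measurable w) (hwb : ∀ a b : ℝ, BddAbove (w '' Set.Icc a b))
    (hc : IsCadlag fun t => X t ω) : Continuous fun t => discount X w q t ω :=
  Real.continuous_exp.comp (((continuous_addFun hw hwb hc).neg).sub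
    (continuous_const.mul NNReal.continuous_coe))

/-- Passage time and additive functional are both additive under splitting the path at `t ≤ τ`. This
turns the Markov property into identities for `ℬ`. -/
lemma passageDiscount_eq_mul {Ω' : Type*} {X' : ℝ≥0 → Ω' → ℝ} {ω' : Ω'} (hw : Measurable w)
    (hwb : ∀ a b : ℝ, BddAbove (w '' Set.Icc a b)) (hX : IsSNPath fun t => X t ω)
    (hp' : IsCadlag fun t => X' t ω') (h0 : X 0 ω ≤ c) {t : ℝ≥0}
    (ht : (t : ℝ≥0∞) ≤ passageTime X c ω) (hX' : ∀ s, X' s ω' = X (t + s) ω) :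
    passageDiscount X w q c ω = discount X w q t ω * passageDiscount X' w q c ω' := by
  have h := passageTime_eq_add hX h0 ht hX'
  by_cases htop : passageTime X' c ω' = ∞
  · rw [passageDiscount_of_eq_top htop, passageDiscount_of_eq_top (by simp [h, htop]), mul_zero]
  · have hs := (ENNReal.coe_toNNReal htop).symm
    set s := (passageTime X' c ω').toNNReal
    rw [passageDiscount_of_eq_coe hs, passageDiscount_of_eq_coe (t := t + s) (by rw [h, hs]; rfl),
      discount, discount, discount, ← Real.exp_add, addFun_add hw hwb hX.1 hp' hX']
    push_cast
    ring_nf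

lemma measurable_passageDiscount {m : MeasurableSpace Ω} (hX : ∀ t, Measurable (X t))
    (hc : ∀ ω, IsCadlag fun t => X t ω) (hw : Measurable w) (q : ℝ≥0) (c : ℝ) :
    Measurable (passageDiscount X w q c) := by
  have hτ := measurable_passageTime hX hc c
  refine Measurable.indicator ?_ (measurableSet_lt hτ measurable_const)
  exact Real.measurable_exp.comp
    (((measurable_graph_comp (measurable_addFun hX hc hw) hτ).ennreal_toReal.neg).sub
    (hτ.ennreal_toReal.const_mul _))

lemma measurable_discount_of_adapted {m : MeasurableSpace Ω} {ℱ : Filtration ℝ≥0 m}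
    (hX : ∀ t, Measurable[ℱ t] (X t)) (hc : ∀ ω, IsCadlag fun t => X t ω) (hw : Measurable w)
    (q : ℝ≥0) (t : ℝ≥0) : Measurable[ℱ t] (discount X w q t) :=
  Real.measurable_exp.comp
    ((measurable_addFun_of_adapted hX hc hw t).ennreal_toReal.neg.sub measurable_const)

lemma passageTime_translate (y : ℝ) (f : SNPath) :
    passageTime coord c (translate y f) = passageTime coord (c - y) f := by
  simp [passageTime, coord, translate, sub_lt_iff_lt_add']

lemma measurable_passageDiscount_coord (hw : Measurable w) (q : ℝ≥0) (c : ℝ) :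
    Measurable (passageDiscount coord w q c) :=
  measurable_passageDiscount measurable_coord (fun f => (isSNPath_coord f).1) hw q c

lemma measurable_translate_right (y : ℝ) : Measurable (translate y) :=
  measurable_translate.comp measurable_prodMk_left

end Discount

/-! ### Independent exponential times -/

/-- Given `𝓐`, the event `{σ < e}` has probability `exp (-q σ)` if `σ < ∞`, and it is empty if `σ =
∞`. The restriction to `{σ < ∞}` on the right is essential, as `toReal` sends `∞` to `0`. -/
lemma setLIntegral_lt_of_indep {Ω : Type*} {𝓐 m : MeasurableSpace Ω} {μ : Measure Ω}
    [IsProbabilityMeasure μ] {e : Ω → ℝ≥0∞} (he : Measurable e) {q : ℝ≥0}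
    (hs : ∀ t : ℝ≥0, μ {ω | (t : ℝ≥0∞) < e ω} = ENNReal.ofReal (Real.exp (-((q : ℝ) * t))))
    (h𝓐 : 𝓐 ≤ m) (hind : Indep (MeasurableSpace.comap e inferInstance) 𝓐 μ)
    {k σ : Ω → ℝ≥0∞} (hk : Measurable[𝓐] k) (hσ : Measurable[𝓐] σ) :
    ∫⁻ ω in {ω | σ ω < e ω}, k ω ∂μ =
      ∫⁻ ω in {ω | σ ω < ∞}, k ω * ENNReal.ofReal (Real.exp (-(q * (σ ω).toReal))) ∂μ := by
  have hσ' : Measurable σ := hσ.mono h𝓐 le_rfl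
  have hset : MeasurableSet {p : (ℝ≥0∞ × ℝ≥0∞) × ℝ≥0∞ | p.1.2 < p.2} :=
    measurableSet_lt (measurable_snd.comp measurable_fst) measurable_snd
  have h1 : Measurable fun p : (ℝ≥0∞ × ℝ≥0∞) × ℝ≥0∞ => p.1.1 := measurable_fst.comp measurable_fst
  have h := lintegral_of_indep h𝓐 he hind.symm (hk.prodMk hσ) (h1.indicator hset)
  rw [← lintegral_indicator (measurableSet_lt hσ' he),
    ← lintegral_indicator (measurableSet_lt hσ' measurable_const)]
  refine Eq.trans ?_ (h.trans (lintegral_congr fun ω => ?_))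
  · rfl
  · have h2 : ∀ v, {p : (ℝ≥0∞ × ℝ≥0∞) × ℝ≥0∞ | p.1.2 < p.2}.indicator (fun p => p.1.1)
        ((k ω, σ ω), v) = (Set.Ioi (σ ω)).indicator (fun _ => k ω) v := fun v => rfl
    simp_rw [h2]
    rw [lintegral_indicator_const measurableSet_Ioi, Measure.map_apply he measurableSet_Ioi]
    by_cases htop : σ ω = ∞
    · simp [htop]
    · have h3 := hs (σ ω).toNNReal
      rw [ENNReal.coe_toNNReal htop] at h3
      have h4 : ω ∈ {ω | σ ω < ∞} := lt_top_iff_ne_top.2 htop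
      rw [Set.indicator_of_mem h4]
      congr 1

lemma setIntegral_lt_of_indep {Ω : Type*} {𝓐 m : MeasurableSpace Ω} {μ : Measure Ω}
    [IsProbabilityMeasure μ] {e : Ω → ℝ≥0∞} (he : Measurable e) {q : ℝ≥0}
    (hs : ∀ t : ℝ≥0, μ {ω | (t : ℝ≥0∞) < e ω} = ENNReal.ofReal (Real.exp (-((q : ℝ) * t))))
    (h𝓐 : 𝓐 ≤ m) (hind : Indep (MeasurableSpace.comap e inferInstance) 𝓐 μ)
    {k : Ω → ℝ} {σ : Ω → ℝ≥0∞} (hk : Measurable[𝓐] k) (hk0 : ∀ ω, 0 ≤ k ω)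
    (hσ : Measurable[𝓐] σ) :
    ∫ ω in {ω | σ ω < e ω}, k ω ∂μ =
      ∫ ω in {ω | σ ω < ∞}, k ω * Real.exp (-(q * (σ ω).toReal)) ∂μ := by
  have hk' : Measurable k := hk.mono h𝓐 le_rfl
  have hσ' : Measurable σ := hσ.mono h𝓐 le_rfl
  have hm : Measurable fun ω => k ω * Real.exp (-(q * (σ ω).toReal)) :=
    hk'.mul (Real.measurable_exp.comp (hσ'.ennreal_toReal.const_mul _).neg)
  rw [integral_eq_lintegral_of_nonneg_ae (Eventually.of_forall hk0) hk'.aestronglyMeasurable,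
    integral_eq_lintegral_of_nonneg_ae
      (Eventually.of_forall fun ω => mul_nonneg (hk0 ω) (Real.exp_pos _).le)
      hm.aestronglyMeasurable,
    setLIntegral_lt_of_indep he hs h𝓐 hind hk.ennreal_ofReal hσ]
  simp_rw [ENNReal.ofReal_mul (hk0 _)]

/-! ### Immediate passage above the starting point -/

section Levy

variable {Ω : Type*} {m : MeasurableSpace Ω} {P : ℝ → Measure Ω} {X : ℝ≥0 → Ω → ℝ}
  {ℱ : Filtration ℝ≥0 m}

/-- If the passage above the starting point never happens, then the paths are nonincreasing. -/
lemma ae_antitone_of_pathLaw_eq_zero (hX : IsSpectrallyNegativeLevy P X)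
    (hℱ : HasIndepIncrementsRel P X ℱ) (h : hX.pathLaw {f | passageTime coord 0 f < ∞} = 0) :
    ∀ᵐ ω ∂(P 0), Antitone fun t => X t ω := by
  have hmeas : MeasurableSet {f : SNPath | ¬ passageTime coord 0 f < ∞} :=
    (measurableSet_lt (measurable_passageTime measurable_coord
      (fun f => (isSNPath_coord f).1) 0) measurable_const).compl
  have hae : ∀ᵐ f ∂hX.pathLaw, ¬ passageTime coord 0 f < ∞ := by
    rw [ae_iff]
    simpa only [not_not] using h
  -- By the Markov property the path never exceeds its value at time `r` after `r`, simultaneously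
  -- for all `r` of a countable dense set.
  have hr : ∀ᵐ ω ∂(P 0), ∀ n, ¬ passageTime coord 0
      (shiftMap hX.isSNPath (TopologicalSpace.denseSeq ℝ≥0 n) ω) < ∞ := by
    rw [ae_all_iff]
    intro n
    rw [← map_shiftMap hX hℱ 0 (TopologicalSpace.denseSeq ℝ≥0 n), ae_map_iff
      (measurable_shiftMap _ hX.measurable _).aemeasurable hmeas] at hae
    exact hae
  filter_upwards [hr] with ω hω
  intro s t hst
  rcases hst.eq_or_lt with rfl | hst
  · exact le_rfl
  by_contra! hlt
  -- If `X s < X t`, right-continuity at `s` provides a dense time `r` in `(s, t)` with `X r < X t`,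
  -- an excluded exceedance.
  obtain ⟨b, hb, hb'⟩ := mem_nhdsGE_iff_exists_Ico_subset.1
    (((hX.cadlag ω).rightCont s).tendsto.eventually (gt_mem_nhds hlt))
  obtain ⟨_, ⟨n, rfl⟩, hn⟩ := (TopologicalSpace.denseRange_denseSeq ℝ≥0).exists_between
    (lt_min (Set.mem_Ioi.1 hb) hst)
  set r := TopologicalSpace.denseSeq ℝ≥0 n
  have hrt : r < t := hn.2.trans_le (min_le_right _ _)
  have h1 : X r ω < X t ω := hb' ⟨hn.1.le, hn.2.trans_le (min_le_left _ _)⟩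
  refine hω n (passageTime_lt_iff.2 ⟨t - r, tsub_pos_of_lt hrt, ?_, ENNReal.coe_lt_top⟩)
  simp only [coord, shiftMap]
  rw [add_tsub_cancel_of_le hrt.le]
  linarith

/-- The point `0` is regular for the positive half-line. -/
lemma ae_passageTime_eq_zero (hX : IsSpectrallyNegativeLevy P X)
    (hℱ : HasIndepIncrementsRel P X ℱ) : ∀ᵐ f ∂hX.pathLaw, passageTime coord 0 f = 0 := by
  have := hX.prob 0
  have hτm := measurable_passageTime measurable_coord (fun f => (isSNPath_coord f).1) 0
  have hτm' := measurable_passageTime hX.measurable hX.cadlag 0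
  have hS : MeasurableSet {f : SNPath | passageTime coord 0 f = 0} :=
    measurableSet_eq_fun hτm measurable_const
  have h0 : (P 0).map (pathMap hX.isSNPath) = hX.pathLaw := by
    rw [map_pathMap hX hℱ]
    convert Measure.map_id
    funext f
    refine Subtype.ext (funext fun s => ?_)
    simp [translate]
  -- The strong Markov property at the passage time itself, tested on immediate passage of the
  -- remaining path.
  have hsm := setLIntegral_shiftMap_optional hX hℱ 0 (R := fun _ _ => 1)
    (fun t => measurable_const) (fun ω t => continuousWithinAt_const) (by simp) (by simp)
    (isOptionalTime_passageTime hℱ.adapted (fun ω => (hX.cadlag ω).rightCont) 0)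
    (measurable_one.indicator hS)
  rw [lintegral_indicator_one hS] at hsm
  -- When the passage time is finite the path is then exactly at `0`, and additivity of the passage
  -- time forces the remaining one to be `0`.
  have hleft : ∫⁻ ω in {ω | passageTime X 0 ω < ∞}, ENNReal.ofReal 1 *
      {f : SNPath | passageTime coord 0 f = 0}.indicator 1
        (shiftMap hX.isSNPath (passageTime X 0 ω).toNNReal ω) ∂(P 0) =
      P 0 {ω | passageTime X 0 ω < ∞} := by
    rw [← setLIntegral_one]
    refine setLIntegral_congr_fun_ae (measurableSet_lt hτm' measurable_const) ?_
    filter_upwards [hX.start] with ω hω htop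
    have ht := (ENNReal.coe_toNNReal (ne_of_lt htop)).symm
    set t := (passageTime X 0 ω).toNNReal
    have hXt := apply_passageTime (hX.isSNPath ω) hω.le ht
    have hadd := passageTime_eq_add (X' := coord) (ω' := shiftMap hX.isSNPath t ω)
      (hX.isSNPath ω) hω.le ht.ge (fun s => by simp [coord, shiftMap, hXt])
    rw [ht] at hadd
    have hz : passageTime coord 0 (shiftMap hX.isSNPath t ω) = 0 := by
      have : (t : ℝ≥0∞) + 0 = t + passageTime coord 0 (shiftMap hX.isSNPath t ω) := by
        rw [add_zero, ← hadd]
      exact ((ENNReal.add_right_inj ENNReal.coe_ne_top).1 this).symm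
    simp [hz]
  rw [hleft] at hsm
  simp only [ENNReal.ofReal_one, setLIntegral_one] at hsm
  -- The identity reads `p = p * P(τ = 0)`. The case `p = 0` contradicts non-monotonicity; otherwise
  -- cancelling `p` gives probability one.
  by_cases hp : P 0 {ω | passageTime X 0 ω < ∞} = 0
  · exfalso
    have h1 : hX.pathLaw {f | passageTime coord 0 f < ∞} = 0 := by
      rw [← h0, Measure.map_apply (measurable_pathMap _ hX.measurable)
        (measurableSet_lt hτm measurable_const)]
      exact hp
    have h2 := ae_antitone_of_pathLaw_eq_zero hX hℱ h1
    have h3 : ∀ᵐ ω ∂(P 0), False := by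
      filter_upwards [h2, hX.not_monotone] with ω ha hn using hn.2 ha
    simp [ae_iff] at h3
  · have h1 : hX.pathLaw {f : SNPath | passageTime coord 0 f = 0} = 1 :=
      ((ENNReal.mul_eq_left hp (measure_ne_top _ _)).1 hsm.symm)
    rw [← prob_compl_eq_zero_iff hS] at h1
    exact h1

/-! ### The Laplace transforms at the passage times and the function `ℋ` -/

variable {q : ℝ≥0} {e : Ω → ℝ≥0∞} {w : ℝ → ℝ≥0}

/-- Independence of `e` from the path replaces killing at `e` by the factor `exp (-q τ)`. -/
lemma passageLaplace_eq (hX : IsSpectrallyNegativeLevy P X) (he : IsIndepExpTime P X q e)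
    (hw : Measurable w) (x c : ℝ) :
    passageLaplace P X e w x c = ∫ ω, passageDiscount X w q c ω ∂(P x) := by
  have := hX.prob x
  have hτ := measurable_passageTime hX.measurable hX.cadlag c
  -- measurability with respect to the σ-algebra generated by the path
  have hX𝓐 : ∀ t, Measurable[MeasurableSpace.comap (fun ω (t : ℝ≥0) => X t ω) inferInstance]
      (X t) := fun t => (measurable_pi_apply t).comp
        (comap_measurable (fun ω (t : ℝ≥0) => X t ω))
  have hle : MeasurableSpace.comap (fun ω (t : ℝ≥0) => X t ω) inferInstance ≤ m :=
    (measurable_pi_iff.2 hX.measurable).comap_le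
  have hτ𝓐 := measurable_passageTime hX𝓐 hX.cadlag c
  have hA𝓐 := measurable_graph_comp (measurable_addFun hX𝓐 hX.cadlag hw) hτ𝓐
  have h := setIntegral_lt_of_indep he.measurable (he.survival x) hle (he.indep x)
    (Real.measurable_exp.comp hA𝓐.ennreal_toReal.neg) (fun ω => (Real.exp_pos _).le) hτ𝓐
  simp only [Function.comp_def, Pi.neg_apply] at h
  rw [passageLaplace, h, ← integral_indicator (measurableSet_lt hτ measurable_const)]
  refine integral_congr_ae (Eventually.of_forall fun ω => ?_)
  simp only [passageDiscount, Set.indicator_apply, ← Real.exp_add]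
  rfl

lemma passageLaplace_eq_pathLaw (hX : IsSpectrallyNegativeLevy P X)
    (hℱ : HasIndepIncrementsRel P X ℱ) (he : IsIndepExpTime P X q e) (hw : Measurable w)
    (x c : ℝ) :
    passageLaplace P X e w x c =
      ∫ f, passageDiscount coord w q c (translate x f) ∂hX.pathLaw := by
  have hm := measurable_passageDiscount_coord hw q c
  rw [passageLaplace_eq hX he hw, ← integral_map (measurable_translate_right x).aemeasurable
    hm.aestronglyMeasurable, ← map_pathMap hX hℱ,
    integral_map (measurable_pathMap _ hX.measurable).aemeasurable hm.aestronglyMeasurable]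
  rfl

lemma integrable_passageDiscount_translate (hX : IsSpectrallyNegativeLevy P X)
    (hw : Measurable w) (q : ℝ≥0) (x c : ℝ) :
    Integrable (fun f => passageDiscount coord w q c (translate x f)) hX.pathLaw :=
  Integrable.mono' (integrable_const 1)
    ((measurable_passageDiscount_coord hw q c).comp
      (measurable_translate_right x)).aestronglyMeasurable
    (Eventually.of_forall fun f => by
      rw [Real.norm_of_nonneg passageDiscount_nonneg]
      exact passageDiscount_le_one)

lemma passageLaplace_nonneg (x c : ℝ) : 0 ≤ passageLaplace P X e w x c :=
  integral_nonneg fun _ => (Real.exp_pos _).le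

lemma passageLaplace_le_one (hX : IsSpectrallyNegativeLevy P X) (he : IsIndepExpTime P X q e)
    (hw : Measurable w) (x c : ℝ) : passageLaplace P X e w x c ≤ 1 := by
  have := hX.prob x
  rw [passageLaplace_eq hX he hw]
  have hi : Integrable (passageDiscount X w q c) (P x) :=
    Integrable.mono' (integrable_const 1)
      (measurable_passageDiscount hX.measurable hX.cadlag hw q c).aestronglyMeasurable
      (Eventually.of_forall fun f => by
        rw [Real.norm_of_nonneg passageDiscount_nonneg]
        exact passageDiscount_le_one)
  calc _ ≤ ∫ _, (1 : ℝ) ∂(P x) :=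
        integral_mono hi (integrable_const 1) fun ω => passageDiscount_le_one
    _ = 1 := by simp

/-- The discount is positive exactly when the passage time is finite. Positivity therefore depends
only on `c - x`, although `ℬ` itself is not translation invariant. -/
lemma passageLaplace_pos_iff (hX : IsSpectrallyNegativeLevy P X)
    (hℱ : HasIndepIncrementsRel P X ℱ) (he : IsIndepExpTime P X q e) (hw : Measurable w)
    (x c : ℝ) : 0 < passageLaplace P X e w x c ↔
      0 < hX.pathLaw {f | passageTime coord (c - x) f < ∞} := by
  rw [passageLaplace_eq_pathLaw hX hℱ he hw, integral_pos_iff_support_of_nonneg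
    (fun f => passageDiscount_nonneg) (integrable_passageDiscount_translate hX hw q x c)]
  have : (Function.support fun f => passageDiscount coord w q c (translate x f)) =
      {f | passageTime coord (c - x) f < ∞} := by
    ext f
    rw [Function.mem_support, Set.mem_ofPred_eq, ← passageTime_translate,
      ← passageDiscount_pos_iff (w := w) (q := q)]
    exact ⟨fun h => lt_of_le_of_ne passageDiscount_nonneg h.symm, fun h => h.ne'⟩
  rw [this]

/-- The Laplace transforms are multiplicative along successive levels. -/
lemma passageLaplace_mul (hX : IsSpectrallyNegativeLevy P X) (hℱ : HasIndepIncrementsRel P X ℱ)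
    (he : IsIndepExpTime P X q e) (hw : Measurable w)
    (hwb : ∀ a b : ℝ, BddAbove (w '' Set.Icc a b)) {x b c : ℝ} (hxb : x ≤ b) (hbc : b ≤ c) :
    passageLaplace P X e w x c = passageLaplace P X e w x b * passageLaplace P X e w b c := by
  have := hX.prob x
  have hτ := measurable_passageTime hX.measurable hX.cadlag b
  have hΨ : Measurable fun f => ENNReal.ofReal (passageDiscount coord w q c (translate b f)) :=
    ((measurable_passageDiscount_coord hw q c).comp (measurable_translate_right b)).ennreal_ofReal
  -- At the passage above `b` the path is at `b`, so the remaining path is a fresh one started from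
  -- `b`, weighted by the discount accrued so far.
  have hsm := setLIntegral_shiftMap_optional hX hℱ x (R := discount X w q)
    (measurable_discount_of_adapted hℱ.adapted hX.cadlag hw q)
    (fun ω t => (continuous_discount hw hwb (hX.cadlag ω)).continuousWithinAt)
    (fun t ω => (discount_pos t).le) (fun t ω => discount_le_one t)
    (isOptionalTime_passageTime hℱ.adapted (fun ω => (hX.cadlag ω).rightCont) b) hΨ
  have hR : ∫⁻ ω in {ω | passageTime X b ω < ∞},
      ENNReal.ofReal (discount X w q (passageTime X b ω).toNNReal ω) ∂(P x) =
      ∫⁻ ω, ENNReal.ofReal (passageDiscount X w q b ω) ∂(P x) := by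
    rw [← lintegral_indicator (measurableSet_lt hτ measurable_const)]
    refine lintegral_congr fun ω => ?_
    by_cases hω : passageTime X b ω < ∞
    · rw [Set.indicator_of_mem (by exact hω),
        passageDiscount_of_eq_coe (ENNReal.coe_toNNReal hω.ne).symm]
    · rw [Set.indicator_of_notMem (by exact hω),
        passageDiscount_of_eq_top (by simpa using hω), ENNReal.ofReal_zero]
  have hL : ∫⁻ ω in {ω | passageTime X b ω < ∞},
      ENNReal.ofReal (discount X w q (passageTime X b ω).toNNReal ω) *
        ENNReal.ofReal (passageDiscount coord w q c
          (translate b (shiftMap hX.isSNPath (passageTime X b ω).toNNReal ω))) ∂(P x) =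
      ∫⁻ ω, ENNReal.ofReal (passageDiscount X w q c ω) ∂(P x) := by
    rw [← lintegral_indicator (measurableSet_lt hτ measurable_const)]
    refine lintegral_congr_ae ?_
    filter_upwards [hX.ae_start x] with ω h0
    have hmono : passageTime X b ω ≤ passageTime X c ω :=
      le_iInf₂ fun t ht => passageTime_le ht.1 (hbc.trans_lt ht.2)
    by_cases hω : passageTime X b ω < ∞
    · have ht := (ENNReal.coe_toNNReal hω.ne).symm
      rw [Set.indicator_of_mem (by exact hω), ← ENNReal.ofReal_mul (discount_pos _).le]
      set t := (passageTime X b ω).toNNReal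
      have hXt := apply_passageTime (hX.isSNPath ω) (h0.le.trans hxb) ht
      rw [passageDiscount_eq_mul (X' := coord) (ω' := translate b (shiftMap hX.isSNPath t ω))
        hw hwb (hX.isSNPath ω) (isSNPath_coord _).1 (h0.le.trans (hxb.trans hbc))
        (ht.ge.trans hmono) (fun s => by simp [coord, translate, shiftMap, hXt])]
    · rw [Set.indicator_of_notMem (by exact hω), passageDiscount_of_eq_top, ENNReal.ofReal_zero]
      rw [← top_le_iff]
      exact (not_lt.1 hω).trans hmono
  rw [hL, hR] at hsm
  have conv : ∀ c, passageLaplace P X e w x c =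
      (∫⁻ ω, ENNReal.ofReal (passageDiscount X w q c ω) ∂(P x)).toReal := fun c => by
    rw [passageLaplace_eq hX he hw, integral_eq_lintegral_of_nonneg_ae
      (Eventually.of_forall fun ω => passageDiscount_nonneg)
      (measurable_passageDiscount hX.measurable hX.cadlag hw q c).aestronglyMeasurable]
  rw [conv c, conv b, hsm, ENNReal.toReal_mul, passageLaplace_eq_pathLaw hX hℱ he hw b c,
    integral_eq_lintegral_of_nonneg_ae (Eventually.of_forall fun ω => passageDiscount_nonneg)
    (integrable_passageDiscount_translate hX hw q b c).aestronglyMeasurable]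

/-- Almost every path is positive at some arbitrarily small time `t`. Once the two levels differ by
less than its value there, the passage occurs by time `t`; with the weight bounded by `K` up to time
`1`, the discount is close to `1`. Dominated convergence concludes. -/
lemma tendsto_passageLaplace (hX : IsSpectrallyNegativeLevy P X)
    (hℱ : HasIndepIncrementsRel P X ℱ) (he : IsIndepExpTime P X q e) (hw : Measurable w)
    (hwb : ∀ a b : ℝ, BddAbove (w '' Set.Icc a b)) (x : ℝ) :
    Tendsto (fun p : ℝ × ℝ => passageLaplace P X e w p.1 p.2) (𝓝 (x, x)) (𝓝 1) := by
  simp_rw [passageLaplace_eq_pathLaw hX hℱ he hw]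
  have h1 : (1 : ℝ) = ∫ _, (1 : ℝ) ∂hX.pathLaw := by simp
  rw [h1]
  refine tendsto_integral_filter_of_dominated_convergence (fun _ => 1)
    (Eventually.of_forall fun p =>
      (integrable_passageDiscount_translate hX hw q p.1 p.2).aestronglyMeasurable)
    (Eventually.of_forall fun p => Eventually.of_forall fun f => ?_) (integrable_const _) ?_
  · rw [Real.norm_of_nonneg passageDiscount_nonneg]
    exact passageDiscount_le_one
  filter_upwards [ae_passageTime_eq_zero hX hℱ] with f hf
  obtain ⟨K, hK⟩ := exists_weight_bound (X := coord) (ω := f) hwb (isSNPath_coord f).1 1 (|x| + 1)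
  refine tendsto_order.2 ⟨fun a ha => ?_, fun a ha => Eventually.of_forall fun p =>
    passageDiscount_le_one.trans_lt ha⟩
  -- a time `δ` so short that the discount factor exceeds `a` before `δ`
  have hcont : Tendsto (fun t : ℝ≥0 => Real.exp (-((K : ℝ) + q) * t)) (𝓝 0) (𝓝 1) := by
    have : Continuous fun t : ℝ≥0 => Real.exp (-((K : ℝ) + q) * t) := by fun_prop
    simpa using this.tendsto 0
  obtain ⟨δ, hδ, hδ'⟩ := mem_nhdsGE_iff_exists_Ico_subset.1
    (nhdsWithin_le_nhds (hcont.eventually (lt_mem_nhds ha)) (s := Set.Ici 0))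
  have hlt : passageTime coord 0 f < (min δ 1 : ℝ≥0) := by
    rw [hf]
    exact_mod_cast lt_min (Set.mem_Ioi.1 hδ) one_pos
  obtain ⟨t, ht0, hft, htδ⟩ := passageTime_lt_iff.1 hlt
  have htδ : t < min δ 1 := by exact_mod_cast htδ
  have hev1 : ∀ᶠ p : ℝ × ℝ in 𝓝 (x, x), p.2 - p.1 < coord t f := by
    have : Tendsto (fun p : ℝ × ℝ => p.2 - p.1) (𝓝 (x, x)) (𝓝 (x - x)) :=
      (continuous_snd.sub continuous_fst).tendsto _
    rw [sub_self] at this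
    exact this.eventually (gt_mem_nhds hft)
  have hev2 : ∀ᶠ p : ℝ × ℝ in 𝓝 (x, x), |p.1| ≤ |x| + 1 := by
    have : Tendsto (fun p : ℝ × ℝ => |p.1|) (𝓝 (x, x)) (𝓝 |x|) :=
      continuous_fst.abs.tendsto _
    exact (this.eventually (gt_mem_nhds (lt_add_one _))).mono fun p hp => hp.le
  filter_upwards [hev1, hev2] with p hp1 hp2
  have hτt : passageTime coord p.2 (translate p.1 f) ≤ t := by
    rw [passageTime_translate]
    exact passageTime_le ht0 hp1
  have hs := (ENNReal.coe_toNNReal (ne_top_of_le_ne_top ENNReal.coe_ne_top hτt)).symm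
  rw [passageDiscount_of_eq_coe hs]
  set s := (passageTime coord p.2 (translate p.1 f)).toNNReal
  have hst : s ≤ t := by
    rw [hs] at hτt
    exact_mod_cast hτt
  have hA : (addFun coord w s (translate p.1 f)).toReal ≤ K * s := by
    have h := addFun_le (X := coord) (w := w) (ω := translate p.1 f) s (K := K) fun u hu =>
      hK u (hu.trans (hst.trans (htδ.le.trans (min_le_right _ _)))) p.1 hp2
    have := ENNReal.toReal_mono (ENNReal.mul_ne_top ENNReal.coe_ne_top ENNReal.coe_ne_top) h
    simpa using this
  have h2 : a < Real.exp (-((K : ℝ) + q) * s) :=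
    hδ' ⟨zero_le, hst.trans_lt (htδ.trans_le (min_le_left _ _))⟩
  refine h2.trans_le (Real.exp_le_exp.2 ?_)
  linarith

lemma passageLaplace_self (hX : IsSpectrallyNegativeLevy P X)
    (hℱ : HasIndepIncrementsRel P X ℱ) (he : IsIndepExpTime P X q e) (hw : Measurable w)
    (x : ℝ) : passageLaplace P X e w x x = 1 := by
  rw [passageLaplace_eq_pathLaw hX hℱ he hw]
  have : ∀ᵐ f ∂hX.pathLaw, passageDiscount coord w q x (translate x f) = 1 := by
    filter_upwards [ae_passageTime_eq_zero hX hℱ] with f hf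
    rw [passageDiscount_of_eq_coe (t := 0)]
    · simp [discount, addFun_zero]
    · rw [passageTime_translate, sub_self, hf, ENNReal.coe_zero]
  rw [integral_congr_ae this]
  simp

/-- Continuity at the diagonal makes some step `ε` possible from `0`, hence from any point, since
positivity is translation invariant. Chaining steps reaches a level beyond `c`, and multiplicativity
exhibits `ℬ(x,c)` as a factor of a positive number. -/
lemma passageLaplace_pos (hX : IsSpectrallyNegativeLevy P X)
    (hℱ : HasIndepIncrementsRel P X ℱ) (he : IsIndepExpTime P X q e) (hw : Measurable w)
    (hwb : ∀ a b : ℝ, BddAbove (w '' Set.Icc a b)) {x c : ℝ} (hxc : x ≤ c) :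
    0 < passageLaplace P X e w x c := by
  have h0 : ∀ᶠ ε in 𝓝[>] (0 : ℝ), 0 < passageLaplace P X e w 0 (0 + ε) := by
    have h : Tendsto (fun ε : ℝ => ((0 : ℝ), 0 + ε)) (𝓝[>] 0) (𝓝 (0, 0)) := by
      have : Continuous fun ε : ℝ => ((0 : ℝ), 0 + ε) := by fun_prop
      simpa using (this.tendsto 0).mono_left nhdsWithin_le_nhds
    exact ((tendsto_passageLaplace hX hℱ he hw hwb 0).comp h).eventually
      (lt_mem_nhds one_pos)
  obtain ⟨ε, hε, hε0⟩ := (h0.and self_mem_nhdsWithin).exists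
  have hstep : ∀ y, 0 < passageLaplace P X e w y (y + ε) := fun y => by
    rw [passageLaplace_pos_iff hX hℱ he hw] at hε ⊢
    simpa using hε
  have hn : ∀ n : ℕ, 0 < passageLaplace P X e w x (x + n * ε) := by
    intro n
    induction n with
    | zero => simp [passageLaplace_self hX hℱ he hw]
    | succ n ih =>
      have := passageLaplace_mul hX hℱ he hw hwb (x := x) (b := x + n * ε)
        (c := x + (n + 1 : ℕ) * ε) (by simp; positivity) (by push_cast; nlinarith)
      rw [this]
      refine mul_pos ih ?_
      have h : x + (n + 1 : ℕ) * ε = x + n * ε + ε := by push_cast; ring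
      rw [h]
      exact hstep _
  obtain ⟨n, hn'⟩ := exists_nat_gt ((c - x) / ε)
  rw [div_lt_iff₀ hε0] at hn'
  have hmul := passageLaplace_mul hX hℱ he hw hwb hxc (c := x + n * ε) (by linarith)
  have hpos := hn n
  rw [hmul] at hpos
  exact pos_of_mul_pos_left hpos (passageLaplace_nonneg _ _)

lemma scaleH_eq_div (hX : IsSpectrallyNegativeLevy P X)
    (hℱ : HasIndepIncrementsRel P X ℱ) (he : IsIndepExpTime P X q e) (hw : Measurable w)
    (hwb : ∀ a b : ℝ, BddAbove (w '' Set.Icc a b)) {x c : ℝ} (hxc : x ≤ c) (hc : 0 ≤ c) :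
    scaleH P X e w x = passageLaplace P X e w x c / passageLaplace P X e w 0 c := by
  have hmax : max x 0 ≤ c := max_le hxc hc
  rw [scaleH, passageLaplace_mul hX hℱ he hw hwb (le_max_left x 0) hmax,
    passageLaplace_mul hX hℱ he hw hwb (le_max_right x 0) hmax,
    mul_div_mul_right _ _ (passageLaplace_pos hX hℱ he hw hwb hmax).ne']

lemma scaleH_pos (hX : IsSpectrallyNegativeLevy P X)
    (hℱ : HasIndepIncrementsRel P X ℱ) (he : IsIndepExpTime P X q e) (hw : Measurable w)
    (hwb : ∀ a b : ℝ, BddAbove (w '' Set.Icc a b)) (x : ℝ) : 0 < scaleH P X e w x :=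
  div_pos (passageLaplace_pos hX hℱ he hw hwb (le_max_left _ _))
    (passageLaplace_pos hX hℱ he hw hwb (le_max_right _ _))

/-- This is the characteristic property of `ℋ`. The level `max c 0` in the quotients makes room for
negative `c`. -/
lemma scaleH_eq_mul (hX : IsSpectrallyNegativeLevy P X)
    (hℱ : HasIndepIncrementsRel P X ℱ) (he : IsIndepExpTime P X q e) (hw : Measurable w)
    (hwb : ∀ a b : ℝ, BddAbove (w '' Set.Icc a b)) {x c : ℝ} (hxc : x ≤ c) :
    scaleH P X e w x = passageLaplace P X e w x c * scaleH P X e w c := by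
  rw [scaleH_eq_div hX hℱ he hw hwb (hxc.trans (le_max_left c 0)) (le_max_right c 0), scaleH,
    passageLaplace_mul hX hℱ he hw hwb hxc (le_max_left c 0), mul_div_assoc]

lemma scaleH_mono (hX : IsSpectrallyNegativeLevy P X)
    (hℱ : HasIndepIncrementsRel P X ℱ) (he : IsIndepExpTime P X q e) (hw : Measurable w)
    (hwb : ∀ a b : ℝ, BddAbove (w '' Set.Icc a b)) : Monotone (scaleH P X e w) := by
  intro x c hxc
  rw [scaleH_eq_mul hX hℱ he hw hwb hxc]
  exact mul_le_of_le_one_left (scaleH_pos hX hℱ he hw hwb c).le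
    (passageLaplace_le_one hX he hw x c)

/-- To the left of `x`, `ℋ(y) = ℬ(y,x) ℋ(x)`; to the right, `ℋ(y) = ℋ(x) / ℬ(x,y)`. Both factors `ℬ`
tend to `1`. -/
lemma continuous_scaleH (hX : IsSpectrallyNegativeLevy P X)
    (hℱ : HasIndepIncrementsRel P X ℱ) (he : IsIndepExpTime P X q e) (hw : Measurable w)
    (hwb : ∀ a b : ℝ, BddAbove (w '' Set.Icc a b)) : Continuous (scaleH P X e w) := by
  refine continuous_iff_continuousAt.2 fun x => ?_
  have ht := tendsto_passageLaplace hX hℱ he hw hwb x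
  have hl : Tendsto (fun y : ℝ => (y, x)) (𝓝 x) (𝓝 (x, x)) :=
    (continuous_id.prodMk continuous_const).tendsto x
  have hr : Tendsto (fun y : ℝ => (x, y)) (𝓝 x) (𝓝 (x, x)) :=
    (continuous_const.prodMk continuous_id).tendsto x
  have h1 := ht.comp hl
  have h2 := ht.comp hr
  simp only [Function.comp_def] at h1 h2
  have hleft : Tendsto (scaleH P X e w) (𝓝[≤] x) (𝓝 (scaleH P X e w x)) := by
    have h := (h1.mul_const (scaleH P X e w x)).mono_left (nhdsWithin_le_nhds (s := Set.Iic x))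
    rw [one_mul] at h
    refine h.congr' ?_
    filter_upwards [self_mem_nhdsWithin] with y hy
    exact (scaleH_eq_mul hX hℱ he hw hwb hy).symm
  have hright : Tendsto (scaleH P X e w) (𝓝[≥] x) (𝓝 (scaleH P X e w x)) := by
    have h : Tendsto (fun y => scaleH P X e w x / passageLaplace P X e w x y) (𝓝[≥] x)
        (𝓝 (scaleH P X e w x / 1)) :=
      tendsto_const_nhds.div (h2.mono_left nhdsWithin_le_nhds) one_ne_zero
    rw [div_one] at h
    refine h.congr' ?_
    filter_upwards [self_mem_nhdsWithin] with y hy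
    rw [scaleH_eq_mul hX hℱ he hw hwb (Set.mem_Ici.1 hy),
      mul_div_cancel_left₀ _ (passageLaplace_pos hX hℱ he hw hwb hy).ne']
  have h := hleft.sup hright
  rwa [nhdsLE_sup_nhdsGE] at h

end Levy

/-! ### The stopped process `Z`: closed martingale and terminal value -/

section ProcessZ

variable {Ω : Type*} {m : MeasurableSpace Ω} {P : ℝ → Measure Ω} {X : ℝ≥0 → Ω → ℝ}
  {ℱ : Filtration ℝ≥0 m} {q : ℝ≥0} {e : Ω → ℝ≥0∞} {w : ℝ → ℝ≥0} {c : ℝ}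

lemma procZ_eq (t : ℝ≥0) (ω : Ω) :
    procZ P X q e w t ω = discount X w q t ω * scaleH P X e w (X t ω) := rfl

lemma terminalZ_eq (ω : Ω) :
    terminalZ P X q e w c ω = scaleH P X e w c * passageDiscount X w q c ω := rfl

lemma stoppedZ_apply (t : ℝ≥0) (ω : Ω) : stoppedZ P X q e w c t ω =
    procZ P X q e w (min (t : ℝ≥0∞) (passageTime X c ω)).toNNReal ω :=
  stoppedProcess_apply _ _ _ _

lemma stoppedZ_of_le {t : ℝ≥0} {ω : Ω} (h : (t : ℝ≥0∞) ≤ passageTime X c ω) :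
    stoppedZ P X q e w c t ω = procZ P X q e w t ω := by
  rw [stoppedZ_apply, min_eq_left h, ENNReal.toNNReal_coe]

lemma isCadlag_procZ (hX : IsSpectrallyNegativeLevy P X)
    (hℱ : HasIndepIncrementsRel P X ℱ) (he : IsIndepExpTime P X q e) (hw : Measurable w)
    (hwb : ∀ a b : ℝ, BddAbove (w '' Set.Icc a b)) (ω : Ω) :
    IsCadlag fun t => procZ P X q e w t ω := by
  have hd := continuous_discount (q := q) hw hwb (hX.cadlag ω)
  have hH := continuous_scaleH hX hℱ he hw hwb
  intro t
  refine ⟨hd.continuousWithinAt.mul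
    (hH.continuousAt.comp_continuousWithinAt ((hX.cadlag ω).rightCont t)), ?_⟩
  obtain ⟨l, hl⟩ := (hX.cadlag ω t).2
  exact ⟨_, ((hd.tendsto t).mono_left nhdsWithin_le_nhds).mul ((hH.tendsto l).comp hl)⟩

lemma isCadlag_stoppedZ (hX : IsSpectrallyNegativeLevy P X)
    (hℱ : HasIndepIncrementsRel P X ℱ) (he : IsIndepExpTime P X q e) (hw : Measurable w)
    (hwb : ∀ a b : ℝ, BddAbove (w '' Set.Icc a b)) (ω : Ω) :
    IsCadlag fun t => stoppedZ P X q e w c t ω := by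
  have h := isCadlag_procZ hX hℱ he hw hwb ω
  simp_rw [stoppedZ_apply]
  exact isCadlag_stop (fun t _ => (h t).1) (fun t _ => (h t).2)

lemma measurable_stoppedZ (hX : IsSpectrallyNegativeLevy P X)
    (hℱ : HasIndepIncrementsRel P X ℱ) (he : IsIndepExpTime P X q e) (hw : Measurable w)
    (hwb : ∀ a b : ℝ, BddAbove (w '' Set.Icc a b)) (t : ℝ≥0) :
    Measurable[ℱ t] (stoppedZ P X q e w c t) := by
  have hτ := isOptionalTime_passageTime hℱ.adapted (fun ω => (hX.cadlag ω).rightCont) c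
  refine hτ.measurable_stopped (fun t => ?_)
    (fun ω => (isCadlag_procZ hX hℱ he hw hwb ω).rightCont) t
  exact (measurable_discount_of_adapted hℱ.adapted hX.cadlag hw q t).mul
    ((continuous_scaleH hX hℱ he hw hwb).measurable.comp (hℱ.adapted t))

lemma measurable_terminalZ (hX : IsSpectrallyNegativeLevy P X) (hw : Measurable w) :
    Measurable (terminalZ P X q e w c) :=
  (measurable_passageDiscount hX.measurable hX.cadlag hw q c).const_mul _

lemma stoppedZ_nonneg (hX : IsSpectrallyNegativeLevy P X)
    (hℱ : HasIndepIncrementsRel P X ℱ) (he : IsIndepExpTime P X q e) (hw : Measurable w)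
    (hwb : ∀ a b : ℝ, BddAbove (w '' Set.Icc a b)) (t : ℝ≥0) (ω : Ω) :
    0 ≤ stoppedZ P X q e w c t ω := by
  rw [stoppedZ_apply]
  exact mul_nonneg (discount_pos _).le (scaleH_pos hX hℱ he hw hwb _).le

lemma stoppedZ_le (hX : IsSpectrallyNegativeLevy P X)
    (hℱ : HasIndepIncrementsRel P X ℱ) (he : IsIndepExpTime P X q e) (hw : Measurable w)
    (hwb : ∀ a b : ℝ, BddAbove (w '' Set.Icc a b)) {ω : Ω} (h0 : X 0 ω ≤ c) (t : ℝ≥0) :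
    stoppedZ P X q e w c t ω ≤ scaleH P X e w c := by
  rw [stoppedZ_apply, procZ_eq]
  have hle : X (min (t : ℝ≥0∞) (passageTime X c ω)).toNNReal ω ≤ c := by
    refine le_of_le_passageTime (hX.isSNPath ω) h0 ?_
    rw [ENNReal.coe_toNNReal (ne_top_of_le_ne_top ENNReal.coe_ne_top (min_le_left _ _))]
    exact min_le_right _ _
  calc _ ≤ 1 * scaleH P X e w c := mul_le_mul (discount_le_one _)
        (scaleH_mono hX hℱ he hw hwb hle) (scaleH_pos hX hℱ he hw hwb _).le zero_le_one
    _ = _ := one_mul _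

lemma terminalZ_nonneg (hX : IsSpectrallyNegativeLevy P X)
    (hℱ : HasIndepIncrementsRel P X ℱ) (he : IsIndepExpTime P X q e) (hw : Measurable w)
    (hwb : ∀ a b : ℝ, BddAbove (w '' Set.Icc a b)) (ω : Ω) : 0 ≤ terminalZ P X q e w c ω :=
  mul_nonneg (scaleH_pos hX hℱ he hw hwb c).le passageDiscount_nonneg

lemma terminalZ_le (hX : IsSpectrallyNegativeLevy P X)
    (hℱ : HasIndepIncrementsRel P X ℱ) (he : IsIndepExpTime P X q e) (hw : Measurable w)
    (hwb : ∀ a b : ℝ, BddAbove (w '' Set.Icc a b)) (ω : Ω) :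
    terminalZ P X q e w c ω ≤ scaleH P X e w c :=
  mul_le_of_le_one_right (scaleH_pos hX hℱ he hw hwb c).le passageDiscount_le_one

lemma stoppedZ_eq_terminalZ (hX : IsSpectrallyNegativeLevy P X) {ω : Ω} (h0 : X 0 ω ≤ c)
    {t : ℝ≥0} (ht : passageTime X c ω ≤ t) :
    stoppedZ P X q e w c t ω = terminalZ P X q e w c ω := by
  have hs := (ENNReal.coe_toNNReal (ne_top_of_le_ne_top ENNReal.coe_ne_top ht)).symm
  rw [stoppedZ_apply, min_eq_right ht, procZ_eq, terminalZ_eq, passageDiscount_of_eq_coe hs,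
    apply_passageTime (hX.isSNPath ω) h0 hs, mul_comm]

lemma integrable_terminalZ (hX : IsSpectrallyNegativeLevy P X)
    (hℱ : HasIndepIncrementsRel P X ℱ) (he : IsIndepExpTime P X q e) (hw : Measurable w)
    (hwb : ∀ a b : ℝ, BddAbove (w '' Set.Icc a b)) (x : ℝ) :
    Integrable (terminalZ P X q e w c) (P x) := by
  have := hX.prob x
  refine Integrable.mono' (integrable_const (scaleH P X e w c))
    (measurable_terminalZ hX hw).aestronglyMeasurable (Eventually.of_forall fun ω => ?_)
  rw [Real.norm_of_nonneg (terminalZ_nonneg hX hℱ he hw hwb ω)]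
  exact terminalZ_le hX hℱ he hw hwb ω

lemma integrable_stoppedZ (hX : IsSpectrallyNegativeLevy P X)
    (hℱ : HasIndepIncrementsRel P X ℱ) (he : IsIndepExpTime P X q e) (hw : Measurable w)
    (hwb : ∀ a b : ℝ, BddAbove (w '' Set.Icc a b)) {x : ℝ} (hx : x ≤ c) (t : ℝ≥0) :
    Integrable (stoppedZ P X q e w c t) (P x) := by
  have := hX.prob x
  refine Integrable.mono' (integrable_const (scaleH P X e w c))
    ((measurable_stoppedZ hX hℱ he hw hwb t).mono (ℱ.le t) le_rfl).aestronglyMeasurable ?_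
  filter_upwards [hX.ae_start x] with ω h0
  rw [Real.norm_of_nonneg (stoppedZ_nonneg hX hℱ he hw hwb t ω)]
  exact stoppedZ_le hX hℱ he hw hwb (h0.le.trans hx) t

/-- The terminal value and the stopped process have the same integrals over the events of `ℱ t`. -/
lemma setIntegral_terminalZ (hX : IsSpectrallyNegativeLevy P X)
    (hℱ : HasIndepIncrementsRel P X ℱ) (he : IsIndepExpTime P X q e) (hw : Measurable w)
    (hwb : ∀ a b : ℝ, BddAbove (w '' Set.Icc a b)) {x : ℝ} (hx : x ≤ c) (t : ℝ≥0) {F : Set Ω}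
    (hF : MeasurableSet[ℱ t] F) :
    ∫ ω in F, terminalZ P X q e w c ω ∂(P x) = ∫ ω in F, stoppedZ P X q e w c t ω ∂(P x) := by
  have := hX.prob x
  have hG : MeasurableSet[ℱ t] {ω | passageTime X c ω < t} :=
    isOptionalTime_passageTime hℱ.adapted (fun ω => (hX.cadlag ω).rightCont) c t
  have hGm := ℱ.le _ _ hG
  have hFm := ℱ.le _ _ hF
  -- The split is along `{τ < t}` rather than `{τ ≤ t}`, since only the former is known to lie in `ℱ
  -- t`; splitting the path at `t` remains valid when `t = τ`.
  rw [← integral_inter_add_sdiff hGm (integrable_terminalZ hX hℱ he hw hwb x).integrableOn,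
    ← integral_inter_add_sdiff hGm (integrable_stoppedZ hX hℱ he hw hwb hx t).integrableOn]
  congr 1
  · refine setIntegral_congr_ae (hFm.inter hGm) ?_
    filter_upwards [hX.ae_start x] with ω h0 hω
    exact (stoppedZ_eq_terminalZ hX (h0.le.trans hx) (le_of_lt hω.2)).symm
  -- on `{t ≤ τ}` the Markov property is used
  set S := F \ {ω | passageTime X c ω < t} with hS
  have hSt : MeasurableSet[ℱ t] S := hF.diff hG
  have hSm := ℱ.le _ _ hSt
  have hdm := measurable_discount_of_adapted hℱ.adapted hX.cadlag hw q t
  have hU : Measurable[ℱ t] fun ω =>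
      (S.indicator (fun ω => ENNReal.ofReal (discount X w q t ω)) ω, X t ω) :=
    (hdm.ennreal_ofReal.indicator hSt).prodMk (hℱ.adapted t)
  have hk : Measurable fun p : (ℝ≥0∞ × ℝ) × SNPath =>
      p.1.1 * ENNReal.ofReal (passageDiscount coord w q c (translate p.1.2 p.2)) := by
    have h1 : Measurable fun p : (ℝ≥0∞ × ℝ) × SNPath => translate p.1.2 p.2 :=
      measurable_translate.comp ((measurable_snd.comp measurable_fst).prodMk measurable_snd)
    exact (measurable_fst.comp measurable_fst).mul
      ((measurable_passageDiscount_coord hw q c).comp h1).ennreal_ofReal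
  have h := lintegral_of_indep (ℱ.le t) (measurable_shiftMap hX.isSNPath hX.measurable t)
    (indep_shiftMap hX hℱ x t) hU hk
  rw [map_shiftMap hX hℱ] at h
  -- Integrating out the future from `X t = y` leaves `ℬ(y,c)`, and `ℬ(y,c) ℋ(c) = ℋ(y)` recovers
  -- the value of `Z`.
  have hB : ∀ y, ∫⁻ f, ENNReal.ofReal (passageDiscount coord w q c (translate y f)) ∂hX.pathLaw =
      ENNReal.ofReal (passageLaplace P X e w y c) := fun y => by
    rw [passageLaplace_eq_pathLaw hX hℱ he hw, ofReal_integral_eq_lintegral_ofReal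
      (integrable_passageDiscount_translate hX hw q y c)
      (Eventually.of_forall fun f => passageDiscount_nonneg)]
  have hH := (scaleH_pos hX hℱ he hw hwb c).le
  have hleft : ∫⁻ ω in S, ENNReal.ofReal (terminalZ P X q e w c ω) ∂(P x) =
      ENNReal.ofReal (scaleH P X e w c) * ∫⁻ ω, S.indicator
        (fun ω => ENNReal.ofReal (discount X w q t ω)) ω *
          ENNReal.ofReal (passageDiscount coord w q c
          (translate (X t ω) (shiftMap hX.isSNPath t ω))) ∂(P x) := by
    rw [← lintegral_const_mul' _ _ ENNReal.ofReal_ne_top, ← lintegral_indicator hSm]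
    refine lintegral_congr_ae ?_
    filter_upwards [hX.ae_start x] with ω h0
    by_cases hω : ω ∈ S
    · simp only [Set.indicator_of_mem hω]
      have ht : (t : ℝ≥0∞) ≤ passageTime X c ω := not_lt.1 hω.2
      rw [terminalZ_eq, ENNReal.ofReal_mul hH, passageDiscount_eq_mul (X' := coord)
        (ω' := translate (X t ω) (shiftMap hX.isSNPath t ω)) hw hwb (hX.isSNPath ω)
        (isSNPath_coord _).1 (h0.le.trans hx) ht (fun s => by simp [coord, translate, shiftMap]),
        ENNReal.ofReal_mul (discount_pos t).le]
    · simp [hω]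
  have hright : ∫⁻ ω in S, ENNReal.ofReal (stoppedZ P X q e w c t ω) ∂(P x) =
      ENNReal.ofReal (scaleH P X e w c) * ∫⁻ ω, S.indicator
        (fun ω => ENNReal.ofReal (discount X w q t ω)) ω *
          ENNReal.ofReal (passageLaplace P X e w (X t ω) c) ∂(P x) := by
    rw [← lintegral_const_mul' _ _ ENNReal.ofReal_ne_top, ← lintegral_indicator hSm]
    refine lintegral_congr_ae ?_
    filter_upwards [hX.ae_start x] with ω h0
    by_cases hω : ω ∈ S
    · simp only [Set.indicator_of_mem hω]
      have ht : (t : ℝ≥0∞) ≤ passageTime X c ω := not_lt.1 hω.2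
      have hXt := le_of_le_passageTime (hX.isSNPath ω) (h0.le.trans hx) ht
      rw [stoppedZ_of_le ht, procZ_eq, scaleH_eq_mul hX hℱ he hw hwb hXt,
        ← ENNReal.ofReal_mul (discount_pos t).le, ← ENNReal.ofReal_mul hH]
      congr 1
      ring
    · simp [hω]
  have hmid : ∫⁻ ω in S, ENNReal.ofReal (terminalZ P X q e w c ω) ∂(P x) =
      ∫⁻ ω in S, ENNReal.ofReal (stoppedZ P X q e w c t ω) ∂(P x) := by
    rw [hleft, hright]
    congr 1
    refine h.trans (lintegral_congr fun ω => ?_)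
    have hm : Measurable fun f => ENNReal.ofReal
        (passageDiscount coord w q c (translate (X t ω) f)) :=
      ((measurable_passageDiscount_coord hw q c).comp
        (measurable_translate_right _)).ennreal_ofReal
    simp only
    rw [lintegral_const_mul _ hm, hB]
  rw [integral_eq_lintegral_of_nonneg_ae
      (Eventually.of_forall fun ω => terminalZ_nonneg hX hℱ he hw hwb ω)
      (measurable_terminalZ hX hw).aestronglyMeasurable,
    integral_eq_lintegral_of_nonneg_ae
      (Eventually.of_forall fun ω => stoppedZ_nonneg hX hℱ he hw hwb t ω)
      ((measurable_stoppedZ hX hℱ he hw hwb t).mono (ℱ.le t) le_rfl).aestronglyMeasurable, hmid]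

lemma stoppedZ_ae_eq_condExp (hX : IsSpectrallyNegativeLevy P X)
    (hℱ : HasIndepIncrementsRel P X ℱ) (he : IsIndepExpTime P X q e) (hw : Measurable w)
    (hwb : ∀ a b : ℝ, BddAbove (w '' Set.Icc a b)) {x : ℝ} (hx : x ≤ c) (t : ℝ≥0) :
    stoppedZ P X q e w c t =ᵐ[P x] (P x)[terminalZ P X q e w c | ℱ t] := by
  have := hX.prob x
  exact ae_eq_condExp_of_forall_setIntegral_eq (ℱ.le t)
    (integrable_terminalZ hX hℱ he hw hwb x)
    (fun F _ _ => (integrable_stoppedZ hX hℱ he hw hwb hx t).integrableOn)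
    (fun F hF _ => (setIntegral_terminalZ hX hℱ he hw hwb hx t hF).symm)
    (measurable_stoppedZ hX hℱ he hw hwb t).stronglyMeasurable.aestronglyMeasurable

/-- Although time `0` is excluded from the infimum, right-continuity keeps the path above `c` at
arbitrarily small positive times. -/
lemma passageTime_eq_zero (hX : IsSpectrallyNegativeLevy P X) {ω : Ω} (h0 : c < X 0 ω) :
    passageTime X c ω = 0 := by
  by_contra hne
  obtain ⟨r, hr0, hr⟩ := ENNReal.lt_iff_exists_nnreal_btwn.1 (pos_iff_ne_zero.2 hne)
  obtain ⟨b, hb, hb'⟩ := mem_nhdsGE_iff_exists_Ico_subset.1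
    (((hX.cadlag ω).rightCont 0).tendsto.eventually (lt_mem_nhds h0))
  have hr0 : 0 < r := by exact_mod_cast hr0
  obtain ⟨s, hs0, hs⟩ := exists_between (lt_min hr0 (Set.mem_Ioi.1 hb))
  have h1 : c < X s ω := hb' ⟨zero_le, hs.trans_le (min_le_right _ _)⟩
  refine absurd (passageTime_le hs0 h1) (not_le.2 (lt_trans ?_ hr))
  exact_mod_cast hs.trans_le (min_le_left _ _)

/-- An adapted process that is almost surely constant is a martingale. -/
lemma martingale_of_ae_const {μ : Measure Ω} [IsFiniteMeasure μ] {𝒢 : Filtration ℝ≥0 m}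
    {U : ℝ≥0 → Ω → ℝ} (hU : ∀ t, Measurable[𝒢 t] (U t)) {a : ℝ}
    (h : ∀ t, ∀ᵐ ω ∂μ, U t ω = a) : Martingale U 𝒢 μ := by
  refine ⟨fun t => (hU t).stronglyMeasurable, fun s t _ => ?_⟩
  have h1 : μ[U t | 𝒢 s] =ᵐ[μ] μ[fun _ => a | 𝒢 s] := condExp_congr_ae (h t)
  rw [condExp_const (𝒢.le s)] at h1
  exact h1.trans (h s |>.mono fun ω hω => hω.symm)

lemma stoppedZ_of_lt_start (hX : IsSpectrallyNegativeLevy P X) {ω : Ω} (h0 : c < X 0 ω) (t : ℝ≥0) :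
    stoppedZ P X q e w c t ω = scaleH P X e w (X 0 ω) := by
  rw [stoppedZ_apply, passageTime_eq_zero hX h0]
  simp [procZ_eq, discount, addFun_zero]

lemma martingale_stoppedZ (hX : IsSpectrallyNegativeLevy P X)
    (hℱ : HasIndepIncrementsRel P X ℱ) (he : IsIndepExpTime P X q e) (hw : Measurable w)
    (hwb : ∀ a b : ℝ, BddAbove (w '' Set.Icc a b)) (x : ℝ) :
    Martingale (stoppedZ P X q e w c) ℱ (P x) := by
  have := hX.prob x
  rcases le_or_gt x c with hx | hx
  · refine ⟨fun t => (measurable_stoppedZ hX hℱ he hw hwb t).stronglyMeasurable, fun s t hst => ?_⟩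
    calc (P x)[stoppedZ P X q e w c t | ℱ s]
        =ᵐ[P x] (P x)[(P x)[terminalZ P X q e w c | ℱ t] | ℱ s] :=
          condExp_congr_ae (stoppedZ_ae_eq_condExp hX hℱ he hw hwb hx t)
      _ =ᵐ[P x] (P x)[terminalZ P X q e w c | ℱ s] :=
          condExp_condExp_of_le (ℱ.mono hst) (ℱ.le t)
      _ =ᵐ[P x] stoppedZ P X q e w c s :=
          (stoppedZ_ae_eq_condExp hX hℱ he hw hwb hx s).symm
  · refine martingale_of_ae_const (fun t => measurable_stoppedZ hX hℱ he hw hwb t)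
      (a := scaleH P X e w x) fun t => ?_
    filter_upwards [hX.ae_start x] with ω h0
    rw [stoppedZ_of_lt_start hX (by rwa [h0]), h0]

lemma stoppedZ_bounded (hX : IsSpectrallyNegativeLevy P X)
    (hℱ : HasIndepIncrementsRel P X ℱ) (he : IsIndepExpTime P X q e) (hw : Measurable w)
    (hwb : ∀ a b : ℝ, BddAbove (w '' Set.Icc a b)) (x : ℝ) :
    ∃ C : ℝ, ∀ᵐ ω ∂(P x), ∀ t, |stoppedZ P X q e w c t ω| ≤ C := by
  refine ⟨max (scaleH P X e w c) (scaleH P X e w x), ?_⟩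
  filter_upwards [hX.ae_start x] with ω h0 t
  rw [abs_of_nonneg (stoppedZ_nonneg hX hℱ he hw hwb t ω)]
  rcases le_or_gt (X 0 ω) c with hx | hx
  · exact (stoppedZ_le hX hℱ he hw hwb hx t).trans (le_max_left _ _)
  · rw [stoppedZ_of_lt_start hX hx, h0]
    exact le_max_right _ _

/-- Optional sampling for the stopped process and its terminal value. -/
lemma setIntegral_stoppedZ_optional (hX : IsSpectrallyNegativeLevy P X)
    (hℱ : HasIndepIncrementsRel P X ℱ) (he : IsIndepExpTime P X q e) (hw : Measurable w)
    (hwb : ∀ a b : ℝ, BddAbove (w '' Set.Icc a b)) {x : ℝ} (hx : x ≤ c)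
    {σ : Ω → ℝ≥0∞} (hσ : IsOptionalTime ℱ σ) {F : Set Ω} (hF : MeasurableSet F)
    (hFσ : ∀ t : ℝ≥0, MeasurableSet[ℱ t] (F ∩ {ω | σ ω < t})) :
    ∫ ω in F ∩ {ω | σ ω < ∞}, (stoppedZ P X q e w c (σ ω).toNNReal ω -
      terminalZ P X q e w c ω) ∂(P x) = 0 := by
  have := hX.prob x
  refine hσ.setIntegral_eq_zero (U := fun t ω => stoppedZ P X q e w c t ω -
    terminalZ P X q e w c ω) (C := scaleH P X e w c) (fun t => ?_) (fun ω t => ?_) ?_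
    (fun t F hF => ?_) hF hFσ
  · exact ((measurable_stoppedZ hX hℱ he hw hwb t).mono (ℱ.le t) le_rfl).sub
      (measurable_terminalZ hX hw)
  · exact ((isCadlag_stoppedZ hX hℱ he hw hwb ω).rightCont t).sub continuousWithinAt_const
  · filter_upwards [hX.ae_start x] with ω h0 t
    have h1 := stoppedZ_nonneg (c := c) hX hℱ he hw hwb t ω
    have h2 := stoppedZ_le hX hℱ he hw hwb (h0.le.trans hx) t
    have h3 := terminalZ_nonneg (c := c) hX hℱ he hw hwb ω
    have h4 := terminalZ_le (c := c) hX hℱ he hw hwb ω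
    exact abs_le.2 ⟨by linarith, by linarith⟩
  · rw [integral_sub (integrable_stoppedZ hX hℱ he hw hwb hx t).integrableOn
      (integrable_terminalZ hX hℱ he hw hwb x).integrableOn,
      setIntegral_terminalZ hX hℱ he hw hwb hx t hF, sub_self]

/-- The path, set to zero before time `n`. -/
lemma rightCont_ite_le {f : ℝ≥0 → ℝ} (hf : ∀ t, ContinuousWithinAt f (Set.Ici t) t) (n t : ℝ≥0) :
    ContinuousWithinAt (fun t => if n ≤ t then f t else 0) (Set.Ici t) t := by
  rcases le_or_gt n t with h | h
  · refine (hf t).congr (fun u hu => ?_) (by simp [h])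
    simp [h.trans hu]
  · refine (continuousWithinAt_const (b := (0 : ℝ))).congr_of_eventuallyEq ?_ (by simp [h])
    filter_upwards [nhdsWithin_le_nhds (gt_mem_nhds h)] with u hu
    simp [not_le.2 hu]

/-- If the level is never passed, the stopped process is eventually at most `ε`. -/
lemma ae_eventually_stoppedZ_le (hX : IsSpectrallyNegativeLevy P X)
    (hℱ : HasIndepIncrementsRel P X ℱ) (he : IsIndepExpTime P X q e) (hw : Measurable w)
    (hwb : ∀ a b : ℝ, BddAbove (w '' Set.Icc a b)) {x : ℝ} (hx : x ≤ c) {ε : ℝ} (hε : 0 < ε) :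
    ∀ᵐ ω ∂(P x), passageTime X c ω = ∞ →
      ∀ᶠ t in atTop, stoppedZ P X q e w c t ω ≤ ε := by
  have := hX.prob x
  -- Erasing the process before time `n` makes the first exceedance of `ε` after `n` a passage time
  -- `σ n`, hence an optional time.
  set V : ℕ → ℝ≥0 → Ω → ℝ := fun n t ω =>
    if (n : ℝ≥0) ≤ t then stoppedZ P X q e w c t ω else 0 with hV
  have hVc : ∀ n ω t, ContinuousWithinAt (fun t => V n t ω) (Set.Ici t) t := fun n ω =>
    rightCont_ite_le (isCadlag_stoppedZ hX hℱ he hw hwb ω).rightCont n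
  have hVm : ∀ n t, Measurable[ℱ t] (V n t) := fun n t =>
    Measurable.ite (MeasurableSet.const _) (measurable_stoppedZ hX hℱ he hw hwb t) measurable_const
  set σ : ℕ → Ω → ℝ≥0∞ := fun n => passageTime (V n) ε with hσdef
  have hσ : ∀ n, IsOptionalTime ℱ (σ n) := fun n =>
    isOptionalTime_passageTime (hVm n) (hVc n) ε
  have hτm := measurable_passageTime hX.measurable hX.cadlag c
  set H := scaleH P X e w c with hH
  have hH0 : 0 ≤ H := (scaleH_pos hX hℱ he hw hwb c).le
  have hA : ∀ n, MeasurableSet {ω | σ n ω < ∞ ∧ passageTime X c ω = ∞} := fun n =>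
    (measurableSet_lt (hσ n).measurable measurable_const).inter
      (measurableSet_eq_fun hτm measurable_const)
  have hB : ∀ n : ℕ, MeasurableSet {ω | (n : ℝ≥0∞) ≤ passageTime X c ω ∧ passageTime X c ω < ∞} :=
    fun n => (measurableSet_le measurable_const hτm).inter (measurableSet_lt hτm measurable_const)
  -- Sampling at `σ n` says that `Z - ξ` integrates to zero over `{σ n < ∞}`. It is at least `ε` if
  -- `τ = ∞`, zero if `τ ≤ σ n`, and at least `-ℋ(c)` if `σ n < τ < ∞`, in which case `n ≤ τ`. The
  -- right side tends to `0` as `n` grows.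
  have hineq : ∀ n : ℕ, ε * (P x).real {ω | σ n ω < ∞ ∧ passageTime X c ω = ∞} ≤
      H * (P x).real {ω | (n : ℝ≥0∞) ≤ passageTime X c ω ∧ passageTime X c ω < ∞} := by
    intro n
    have hos := setIntegral_stoppedZ_optional hX hℱ he hw hwb hx (hσ n) MeasurableSet.univ
      (fun t => by simpa using hσ n t)
    rw [Set.univ_inter] at hos
    have hSm : MeasurableSet {ω | σ n ω < ∞} :=
      measurableSet_lt (hσ n).measurable measurable_const
    set D : Ω → ℝ := fun ω => {ω | σ n ω < ∞ ∧ passageTime X c ω = ∞}.indicator (fun _ => ε) ω -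
      {ω | (n : ℝ≥0∞) ≤ passageTime X c ω ∧ passageTime X c ω < ∞}.indicator (fun _ => H) ω with hD
    have hDi : Integrable D (P x) :=
      ((integrable_const ε).indicator (hA n)).sub ((integrable_const H).indicator (hB n))
    have hle : ∫ ω, D ω ∂(P x) ≤ ∫ ω in {ω | σ n ω < ∞}, (stoppedZ P X q e w c
        (σ n ω).toNNReal ω - terminalZ P X q e w c ω) ∂(P x) := by
      rw [← integral_indicator hSm]
      refine integral_mono_ae hDi (Integrable.indicator ?_ hSm) ?_
      · have hj := measurable_uncurry_of_rightCont
          (fun t => (measurable_stoppedZ (c := c) hX hℱ he hw hwb t).mono (ℱ.le t) le_rfl)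
          (fun ω => (isCadlag_stoppedZ hX hℱ he hw hwb ω).rightCont)
        have hZm := measurable_graph_comp hj (hσ n).measurable.ennreal_toNNReal
        refine Integrable.sub ?_ (integrable_terminalZ hX hℱ he hw hwb x)
        refine Integrable.mono' (integrable_const H) hZm.aestronglyMeasurable ?_
        filter_upwards [hX.ae_start x] with ω h0
        rw [Real.norm_of_nonneg (stoppedZ_nonneg hX hℱ he hw hwb _ ω)]
        exact stoppedZ_le hX hℱ he hw hwb (h0.le.trans hx) _
      · filter_upwards [hX.ae_start x] with ω h0
        by_cases hfin : σ n ω < ∞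
        swap
        · rw [Set.indicator_of_notMem (by exact hfin)]
          have h1 : D ω = 0 - {ω | (n : ℝ≥0∞) ≤ passageTime X c ω ∧
              passageTime X c ω < ∞}.indicator (fun _ => H) ω := by
            simp only [hD]
            rw [Set.indicator_of_notMem (fun h => hfin h.1)]
          rw [h1, zero_sub]
          exact neg_nonpos.2 (Set.indicator_nonneg (fun _ _ => hH0) _)
        rw [Set.indicator_of_mem (by exact hfin)]
        have hs := (ENNReal.coe_toNNReal hfin.ne).symm
        set s := (σ n ω).toNNReal
        have hVs : ε ≤ V n s ω := le_apply_passageTime (hVc n ω) hs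
        have hns : (n : ℝ≥0) ≤ s := by
          by_contra h
          simp only [hV, h, if_false] at hVs
          linarith
        have hZs : ε ≤ stoppedZ P X q e w c s ω := by simpa [hV, hns] using hVs
        by_cases htop : passageTime X c ω = ∞
        · simp only [hD, terminalZ_eq, passageDiscount_of_eq_top htop]
          rw [Set.indicator_of_mem (by exact ⟨hfin, htop⟩),
            Set.indicator_of_notMem (fun h => h.2.ne htop)]
          linarith
        · have hA' : ω ∉ {ω | σ n ω < ∞ ∧ passageTime X c ω = ∞} := fun h => htop h.2
          simp only [hD, Set.indicator_of_notMem hA', zero_sub]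
          rcases le_or_gt (passageTime X c ω) s with hle | hgt
          · rw [stoppedZ_eq_terminalZ hX (h0.le.trans hx) hle, sub_self]
            exact neg_nonpos.2 (Set.indicator_nonneg (fun _ _ => hH0) _)
          · rw [Set.indicator_of_mem]
            · have h3 := terminalZ_le (c := c) hX hℱ he hw hwb ω
              linarith
            · refine ⟨le_trans ?_ hgt.le, lt_top_iff_ne_top.2 htop⟩
              exact_mod_cast hns
    rw [hos] at hle
    have hDint : ∫ ω, D ω ∂(P x) = ε * (P x).real {ω | σ n ω < ∞ ∧ passageTime X c ω = ∞} -
        H * (P x).real {ω | (n : ℝ≥0∞) ≤ passageTime X c ω ∧ passageTime X c ω < ∞} := by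
      rw [hD, integral_sub ((integrable_const ε).indicator (hA n))
        ((integrable_const H).indicator (hB n)), integral_indicator_const _ (hA n),
        integral_indicator_const _ (hB n), smul_eq_mul, smul_eq_mul, mul_comm ε, mul_comm H]
    linarith
  have hBlim : Tendsto (fun n : ℕ => (P x).real
      {ω | (n : ℝ≥0∞) ≤ passageTime X c ω ∧ passageTime X c ω < ∞}) atTop (𝓝 0) := by
    have hanti : Antitone fun n : ℕ =>
        {ω | (n : ℝ≥0∞) ≤ passageTime X c ω ∧ passageTime X c ω < ∞} := by
      intro n k hnk ω hω
      exact ⟨le_trans (by exact_mod_cast hnk) hω.1, hω.2⟩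
    have h := tendsto_measure_iInter_atTop (μ := P x) (fun n => (hB n).nullMeasurableSet) hanti
      ⟨0, measure_ne_top _ _⟩
    have hempty : ⋂ n : ℕ, {ω | (n : ℝ≥0∞) ≤ passageTime X c ω ∧ passageTime X c ω < ∞} = ∅ := by
      ext ω
      simp only [Set.mem_iInter, Set.mem_ofPred_eq, Set.mem_empty_iff_false, iff_false]
      intro h
      obtain ⟨n, hn⟩ := ENNReal.exists_nat_gt (h 0).2.ne
      exact absurd (h n).1 (not_le.2 hn)
    rw [hempty, measure_empty] at h
    have h2 := (ENNReal.tendsto_toReal ENNReal.zero_ne_top).comp h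
    simpa [Function.comp_def, Measure.real] using h2
  have hzero : (P x) (⋂ n, {ω | σ n ω < ∞ ∧ passageTime X c ω = ∞}) = 0 := by
    rw [← measureReal_eq_zero_iff]
    refine le_antisymm ?_ measureReal_nonneg
    have hlim := (hBlim.const_mul (H / ε))
    rw [mul_zero] at hlim
    refine ge_of_tendsto' hlim fun n => ?_
    calc (P x).real (⋂ n, {ω | σ n ω < ∞ ∧ passageTime X c ω = ∞})
        ≤ (P x).real {ω | σ n ω < ∞ ∧ passageTime X c ω = ∞} :=
          measureReal_mono (Set.iInter_subset _ n)
      _ ≤ _ := by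
          rw [div_mul_eq_mul_div, le_div_iff₀ hε, mul_comm]
          exact hineq n
  have hae : ∀ᵐ ω ∂(P x), ω ∉ ⋂ n, {ω | σ n ω < ∞ ∧ passageTime X c ω = ∞} :=
    measure_eq_zero_iff_ae_notMem.1 hzero
  filter_upwards [hae] with ω hω htop
  simp only [Set.mem_iInter, Set.mem_ofPred_eq, htop, and_true, not_forall, not_lt] at hω
  obtain ⟨n, hn⟩ := hω
  -- Taking `n + 1` instead of `n` ensures `t > 0` even for `n = 0`, as passage times ignore time
  -- `0`.
  filter_upwards [eventually_ge_atTop ((n : ℝ≥0) + 1)] with t ht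
  have h1 : V n t ω ≤ ε := le_of_lt_passageTime (lt_of_lt_of_le (by positivity) ht)
    (lt_of_lt_of_le ENNReal.coe_lt_top hn)
  have hnt : (n : ℝ≥0) ≤ t := le_trans le_self_add ht
  simpa [hV, hnt] using h1

/-- If `τ < ∞` the stopped process is eventually equal to its terminal value; if `τ = ∞` that value
is `0`, and the bounds `1 / (k + 1)` hold eventually for all `k` at once. -/
lemma tendsto_stoppedZ (hX : IsSpectrallyNegativeLevy P X)
    (hℱ : HasIndepIncrementsRel P X ℱ) (he : IsIndepExpTime P X q e) (hw : Measurable w)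
    (hwb : ∀ a b : ℝ, BddAbove (w '' Set.Icc a b)) {x : ℝ} (hx : x ≤ c) :
    ∀ᵐ ω ∂(P x), Tendsto (fun t => stoppedZ P X q e w c t ω) atTop
      (𝓝 (terminalZ P X q e w c ω)) := by
  have h : ∀ᵐ ω ∂(P x), ∀ k : ℕ, passageTime X c ω = ∞ →
      ∀ᶠ t in atTop, stoppedZ P X q e w c t ω ≤ 1 / ((k : ℝ) + 1) :=
    ae_all_iff.2 fun k => ae_eventually_stoppedZ_le hX hℱ he hw hwb hx (by positivity)
  filter_upwards [h, hX.ae_start x] with ω hω h0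
  by_cases htop : passageTime X c ω = ∞
  · rw [terminalZ_eq, passageDiscount_of_eq_top htop, mul_zero]
    refine tendsto_order.2 ⟨fun a ha => Eventually.of_forall fun t =>
      ha.trans_le (stoppedZ_nonneg hX hℱ he hw hwb t ω), fun a ha => ?_⟩
    obtain ⟨k, hk⟩ := exists_nat_one_div_lt ha
    exact (hω k htop).mono fun t ht => ht.trans_lt hk
  · refine tendsto_const_nhds.congr' ?_
    filter_upwards [eventually_ge_atTop (passageTime X c ω).toNNReal] with t ht
    refine (stoppedZ_eq_terminalZ hX (h0.le.trans hx) ?_).symm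
    rw [← ENNReal.coe_toNNReal htop]
    exact_mod_cast ht

end ProcessZ

/-! ### The time change along a path -/

section TimeChange

variable {Ω : Type*} {X : ℝ≥0 → Ω → ℝ} {w : ℝ → ℝ≥0} {e : Ω → ℝ≥0∞} {ω : Ω}

/-- The additive functional at finite times. -/
noncomputable def clock (X : ℝ≥0 → Ω → ℝ) (w : ℝ → ℝ≥0) (ω : Ω) (t : ℝ≥0) : ℝ≥0 :=
  (addFun X w t ω).toNNReal

lemma coe_clock (hwb : ∀ a b : ℝ, BddAbove (w '' Set.Icc a b)) (hc : IsCadlag fun t => X t ω)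
    (t : ℝ≥0) : (clock X w ω t : ℝ≥0∞) = addFun X w t ω :=
  ENNReal.coe_toNNReal (addFun_lt_top hwb hc t).ne

lemma clock_zero : clock X w ω 0 = 0 := by simp [clock, addFun_zero]

lemma continuous_clock (hw : Measurable w) (hwb : ∀ a b : ℝ, BddAbove (w '' Set.Icc a b))
    (hc : IsCadlag fun t => X t ω) : Continuous (clock X w ω) := by
  have h : Continuous fun t : ℝ≥0 => (addFun X w t ω).toNNReal := by
    simpa [Function.comp_def, ENNReal.toReal] using
      continuous_real_toNNReal.comp (continuous_addFun hw hwb hc)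
  exact h

lemma strictMono_clock (hw : Measurable w) (hwb : ∀ a b : ℝ, BddAbove (w '' Set.Icc a b))
    (hc : IsCadlag fun t => X t ω) (hpos : ∀ y, 0 < w y) : StrictMono (clock X w ω) := by
  intro s t hst
  have h := strictMono_addFun hw hwb hc hpos hst
  exact_mod_cast h

lemma exists_clock_eq (hw : Measurable w) (hwb : ∀ a b : ℝ, BddAbove (w '' Set.Icc a b))
    (hc : IsCadlag fun t => X t ω) {s t : ℝ≥0} (h : s ≤ clock X w ω t) :
    ∃ u ≤ t, clock X w ω u = s := by
  have := intermediate_value_Icc (zero_le (a := t)) (continuous_clock hw hwb hc).continuousOn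
  obtain ⟨u, hu, rfl⟩ := this ⟨by rw [clock_zero]; exact zero_le, h⟩
  exact ⟨u, hu.2, rfl⟩

lemma timeChange_lt_iff (hwb : ∀ a b : ℝ, BddAbove (w '' Set.Icc a b))
    (hc : IsCadlag fun t => X t ω) {s : ℝ≥0} {T : ℝ≥0∞} :
    timeChange X w s ω < T ↔ ∃ t : ℝ≥0, (t : ℝ≥0∞) < T ∧ s < clock X w ω t := by
  simp only [timeChange, iInf_lt_iff, exists_prop, ← coe_clock hwb hc, ENNReal.coe_lt_coe]
  exact exists_congr fun _ => and_comm

/-- Positivity of the weight makes the clock strictly increasing, so the time change inverts it.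
Beyond the range of the clock the time change is `∞`. -/
lemma timeChange_clock (hw : Measurable w) (hwb : ∀ a b : ℝ, BddAbove (w '' Set.Icc a b))
    (hc : IsCadlag fun t => X t ω) (hpos : ∀ y, 0 < w y) (t : ℝ≥0) :
    timeChange X w (clock X w ω t) ω = t := by
  have hmono := strictMono_clock hw hwb hc hpos
  apply le_antisymm
  · refine le_of_forall_gt fun S hS => ?_
    obtain ⟨u, hu, hu'⟩ := ENNReal.lt_iff_exists_nnreal_btwn.1 hS
    exact (timeChange_lt_iff hwb hc).2 ⟨u, hu', hmono (by exact_mod_cast hu)⟩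
  · by_contra! h
    obtain ⟨u, hu, hu'⟩ := (timeChange_lt_iff hwb hc).1 h
    exact absurd (hmono (by exact_mod_cast hu)) (not_lt.2 hu'.le)

lemma exists_eq_clock (hw : Measurable w) (hwb : ∀ a b : ℝ, BddAbove (w '' Set.Icc a b))
    (hc : IsCadlag fun t => X t ω) {s : ℝ≥0} (h : timeChange X w s ω < ∞) :
    ∃ t, s = clock X w ω t := by
  obtain ⟨t, -, ht⟩ := (timeChange_lt_iff hwb hc).1 h
  obtain ⟨u, -, hu⟩ := exists_clock_eq hw hwb hc ht.le
  exact ⟨u, hu.symm⟩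

lemma timeChange_le_iff (hw : Measurable w) (hwb : ∀ a b : ℝ, BddAbove (w '' Set.Icc a b))
    (hc : IsCadlag fun t => X t ω) (hpos : ∀ y, 0 < w y) {s t : ℝ≥0} :
    timeChange X w s ω ≤ t ↔ s ≤ clock X w ω t := by
  constructor
  · intro h
    obtain ⟨u, rfl⟩ := exists_eq_clock hw hwb hc (h.trans_lt ENNReal.coe_lt_top)
    rw [timeChange_clock hw hwb hc hpos] at h
    exact (strictMono_clock hw hwb hc hpos).monotone (by exact_mod_cast h)
  · intro h
    obtain ⟨u, hu, rfl⟩ := exists_clock_eq hw hwb hc h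
    rw [timeChange_clock hw hwb hc hpos]
    exact_mod_cast hu

lemma timeChange_mono : Monotone fun s => timeChange X w s ω := by
  intro s t hst
  simp only [timeChange]
  refine le_iInf₂ fun u hu => iInf₂_le u ?_
  exact lt_of_le_of_lt (by exact_mod_cast hst) hu

lemma timeChange_lt_of_lt (hw : Measurable w) (hwb : ∀ a b : ℝ, BddAbove (w '' Set.Icc a b))
    (hc : IsCadlag fun t => X t ω) (hpos : ∀ y, 0 < w y) {u s : ℝ≥0} (hus : u < s)
    (h : timeChange X w u ω < ∞) : timeChange X w u ω < timeChange X w s ω := by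
  obtain ⟨t, rfl⟩ := exists_eq_clock hw hwb hc h
  rw [timeChange_clock hw hwb hc hpos]
  by_contra! hle
  exact absurd ((timeChange_le_iff hw hwb hc hpos).1 hle) (not_le.2 hus)

/-- Continuity holds with values in `[0,∞]`, including where the time change reaches `∞`: strict
growth of the clock excludes jumps from the right, its finiteness at finite times controls the
approach to `∞`. -/
lemma continuous_timeChange (hw : Measurable w) (hwb : ∀ a b : ℝ, BddAbove (w '' Set.Icc a b))
    (hc : IsCadlag fun t => X t ω) (hpos : ∀ y, 0 < w y) :
    Continuous fun s => timeChange X w s ω := by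
  refine continuous_iff_continuousAt.2 fun s => tendsto_order.2 ⟨fun a ha => ?_, fun a ha => ?_⟩
  · obtain ⟨r, har, hr⟩ := ENNReal.lt_iff_exists_nnreal_btwn.1 ha
    have h1 : clock X w ω r < s := by
      rw [← not_le, ← timeChange_le_iff hw hwb hc hpos]
      exact not_le.2 hr
    filter_upwards [lt_mem_nhds h1] with u hu
    refine har.trans ?_
    rw [← not_le, timeChange_le_iff hw hwb hc hpos]
    exact not_le.2 hu
  · obtain ⟨t, hta, ht⟩ := (timeChange_lt_iff hwb hc).1 ha
    filter_upwards [gt_mem_nhds ht] with u hu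
    exact (timeChange_lt_iff hwb hc).2 ⟨t, hta, hu⟩

/-- Both sides say that the clock exceeds `s` at some time before `e`; for the lifetime this is
left-continuity of the additive functional. -/
lemma lt_lifetime_iff (hwb : ∀ a b : ℝ, BddAbove (w '' Set.Icc a b))
    (hc : IsCadlag fun t => X t ω) {s : ℝ≥0} :
    (s : ℝ≥0∞) < lifetime X e w ω ↔ timeChange X w s ω < e ω := by
  rw [lifetime, lt_addFun_iff, timeChange_lt_iff hwb hc]
  simp only [← coe_clock hwb hc, ENNReal.coe_lt_coe]

/-- The process `f`, time-changed and set to `k` from the lifetime on. -/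
noncomputable def timeChanged (X : ℝ≥0 → Ω → ℝ) (w : ℝ → ℝ≥0) (e : Ω → ℝ≥0∞)
    (f : ℝ≥0 → Ω → ℝ) (k : ℝ) (s : ℝ≥0) (ω : Ω) : ℝ :=
  {ω | timeChange X w s ω < e ω}.indicator (fun ω => f (timeChange X w s ω).toNNReal ω - k) ω + k

lemma timeChanged_of_lt {f : ℝ≥0 → Ω → ℝ} {k : ℝ} {s : ℝ≥0} (h : timeChange X w s ω < e ω) :
    timeChanged X w e f k s ω = f (timeChange X w s ω).toNNReal ω := by
  rw [timeChanged, Set.indicator_of_mem (by exact h), sub_add_cancel]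

lemma timeChanged_of_le {f : ℝ≥0 → Ω → ℝ} {k : ℝ} {s : ℝ≥0} (h : e ω ≤ timeChange X w s ω) :
    timeChanged X w e f k s ω = k := by
  rw [timeChanged, Set.indicator_of_notMem (by exact not_lt.2 h), zero_add]

lemma rightCont_timeChanged (hw : Measurable w) (hwb : ∀ a b : ℝ, BddAbove (w '' Set.Icc a b))
    (hc : IsCadlag fun t => X t ω) (hpos : ∀ y, 0 < w y) {f : ℝ≥0 → Ω → ℝ}
    (hf : ∀ t, ContinuousWithinAt (fun t => f t ω) (Set.Ici t) t) (k : ℝ) (s : ℝ≥0) :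
    ContinuousWithinAt (fun s => timeChanged X w e f k s ω) (Set.Ici s) s := by
  have hρ := continuous_timeChange hw hwb hc hpos
  rcases lt_or_ge (timeChange X w s ω) (e ω) with h | h
  · have hlim : Tendsto (fun u => (timeChange X w u ω).toNNReal) (𝓝[≥] s)
        (𝓝[≥] (timeChange X w s ω).toNNReal) := by
      refine tendsto_nhdsWithin_iff.2 ⟨?_, ?_⟩
      · exact (ENNReal.tendsto_toNNReal h.ne_top).comp
          ((hρ.tendsto s).mono_left nhdsWithin_le_nhds)
      · filter_upwards [self_mem_nhdsWithin, nhdsWithin_le_nhds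
          ((hρ.tendsto s).eventually (gt_mem_nhds h))] with u hu hu'
        exact ENNReal.toNNReal_mono hu'.ne_top (timeChange_mono hu)
    have h1 := (hf _).tendsto.comp hlim
    rw [ContinuousWithinAt, timeChanged_of_lt h]
    refine h1.congr' ?_
    filter_upwards [nhdsWithin_le_nhds ((hρ.tendsto s).eventually (gt_mem_nhds h))] with u hu
    exact (timeChanged_of_lt hu).symm
  · exact (continuousWithinAt_const (b := k)).congr
      (fun u hu => timeChanged_of_le (h.trans (timeChange_mono hu))) (timeChanged_of_le h)

lemma procY_eq (hwb : ∀ a b : ℝ, BddAbove (w '' Set.Icc a b))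
    (hc : IsCadlag fun t => X t ω) (s : ℝ≥0) : procY X e w s ω =
      open Classical in if timeChange X w s ω < e ω then
        some (X (timeChange X w s ω).toNNReal ω) else none := by
  simp only [procY, lt_lifetime_iff hwb hc]

/-- With the cemetery replaced by the real value `c`, which is not above `c`, the passage time of
`Y` becomes one of a real right-continuous process, so the earlier results apply. -/
lemma passageTimeY_eq (hwb : ∀ a b : ℝ, BddAbove (w '' Set.Icc a b))
    (hc : IsCadlag fun t => X t ω) (c : ℝ) :
    passageTimeY X e w c ω = passageTime (timeChanged X w e X c) c ω := by
  unfold passageTimeY passageTime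
  refine iInf_congr fun s => iInf_congr_Prop (and_congr_right fun _ => ?_) fun _ => rfl
  rw [procY_eq hwb hc]
  by_cases h : timeChange X w s ω < e ω
  · simp [h, timeChanged_of_lt h]
  · simp [h, timeChanged_of_le (not_lt.1 h)]

lemma passageTimeY_lt_iff (hw : Measurable w) (hwb : ∀ a b : ℝ, BddAbove (w '' Set.Icc a b))
    (hc : IsCadlag fun t => X t ω) (hpos : ∀ y, 0 < w y) {c : ℝ} {S : ℝ≥0∞} :
    passageTimeY X e w c ω < S ↔ ∃ t : ℝ≥0, 0 < t ∧ (t : ℝ≥0∞) < e ω ∧ c < X t ω ∧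
      (clock X w ω t : ℝ≥0∞) < S := by
  rw [passageTimeY_eq hwb hc, passageTime_lt_iff]
  have hmono := strictMono_clock hw hwb hc hpos
  constructor
  · rintro ⟨s, hs0, hs, hsS⟩
    have hlt : timeChange X w s ω < e ω := by
      by_contra! h
      rw [timeChanged_of_le h] at hs
      exact lt_irrefl _ hs
    rw [timeChanged_of_lt hlt] at hs
    obtain ⟨t, rfl⟩ := exists_eq_clock hw hwb hc (hlt.trans_le le_top)
    rw [timeChange_clock hw hwb hc hpos] at hs hlt
    refine ⟨t, ?_, hlt, hs, hsS⟩
    rw [pos_iff_ne_zero]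
    rintro rfl
    simp [clock_zero] at hs0
  · rintro ⟨t, ht0, hte, hct, htS⟩
    have hρ := timeChange_clock hw hwb hc hpos t
    refine ⟨clock X w ω t, ?_, ?_, htS⟩
    · rw [← clock_zero (X := X) (w := w) (ω := ω)]
      exact hmono ht0
    · rw [timeChanged_of_lt (by rwa [hρ]), hρ]
      exact hct

lemma passageTimeY_of_le (hw : Measurable w) (hwb : ∀ a b : ℝ, BddAbove (w '' Set.Icc a b))
    (hc : IsCadlag fun t => X t ω) (hpos : ∀ y, 0 < w y) {c : ℝ}
    (h : e ω ≤ passageTime X c ω) : passageTimeY X e w c ω = ∞ := by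
  by_contra hne
  obtain ⟨t, ht0, hte, hct, -⟩ := (passageTimeY_lt_iff hw hwb hc hpos).1 (lt_top_iff_ne_top.2 hne)
  exact absurd (h.trans (passageTime_le ht0 hct)) (not_le.2 hte)

/-- `X` exceeds `c` at times arbitrarily close to `r` and still before `e`; the continuous clock
carries these to times of `Y` close to `clock r`, and monotonicity excludes earlier ones. -/
lemma passageTimeY_of_lt (hw : Measurable w) (hwb : ∀ a b : ℝ, BddAbove (w '' Set.Icc a b))
    (hc : IsCadlag fun t => X t ω) (hpos : ∀ y, 0 < w y) {c : ℝ} {r : ℝ≥0}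
    (hr : passageTime X c ω = r) (h : (r : ℝ≥0∞) < e ω) :
    passageTimeY X e w c ω = clock X w ω r := by
  apply le_antisymm
  · refine le_of_forall_gt fun S hS => ?_
    rw [passageTimeY_lt_iff hw hwb hc hpos]
    have h1 : ∀ᶠ t : ℝ≥0 in 𝓝 r, (clock X w ω t : ℝ≥0∞) < S :=
      (ENNReal.continuous_coe.comp (continuous_clock hw hwb hc)).continuousAt.eventually
        (gt_mem_nhds hS)
    have h2 : ∀ᶠ t : ℝ≥0 in 𝓝 r, (t : ℝ≥0∞) < e ω :=
      ENNReal.continuous_coe.continuousAt.eventually (gt_mem_nhds h)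
    obtain ⟨b, hb, hb'⟩ := mem_nhdsGE_iff_exists_Ico_subset.1
      (nhdsWithin_le_nhds (h1.and h2) (s := Set.Ici r))
    have hlt : passageTime X c ω < b := by rw [hr]; exact_mod_cast hb
    obtain ⟨t, ht0, hct, htb⟩ := passageTime_lt_iff.1 hlt
    have hrt : r ≤ t := by
      have := passageTime_le ht0 hct
      rw [hr] at this
      exact_mod_cast this
    have := hb' ⟨hrt, by exact_mod_cast htb⟩
    exact ⟨t, ht0, this.2, hct, this.1⟩
  · by_contra! hlt
    obtain ⟨t, ht0, hte, hct, htS⟩ := (passageTimeY_lt_iff hw hwb hc hpos).1 hlt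
    have hrt : r ≤ t := by
      have := passageTime_le ht0 hct
      rw [hr] at this
      exact_mod_cast this
    have h3 := (strictMono_clock hw hwb hc hpos).monotone hrt
    exact absurd h3 (not_le.2 (by exact_mod_cast htS))

end TimeChange

/-! ### The time-changed filtration -/

section TimeChangedFiltration

variable {Ω : Type*} {m : MeasurableSpace Ω} {ℱ : Filtration ℝ≥0 m} {X : ℝ≥0 → Ω → ℝ}
  {w : ℝ → ℝ≥0} {e : Ω → ℝ≥0∞}

/-- Strict growth of the clock gives `{ρ s ≤ t} = {s ≤ A t}`, so this is a genuine stopping time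
without right-continuity of the filtration. -/
lemma isStoppingTime_timeChange (hX : ∀ t, Measurable[ℱ t] (X t))
    (hc : ∀ ω, IsCadlag fun t => X t ω) (hw : Measurable w)
    (hwb : ∀ a b : ℝ, BddAbove (w '' Set.Icc a b)) (hpos : ∀ y, 0 < w y) (s : ℝ≥0) :
    IsStoppingTime ℱ (timeChange X w s) := by
  intro t
  have h : {ω | timeChange X w s ω ≤ (t : ℝ≥0∞)} = {ω | (s : ℝ≥0∞) ≤ addFun X w t ω} := by
    ext ω
    simp only [Set.mem_ofPred_eq]
    rw [timeChange_le_iff hw hwb (hc ω) hpos, ← coe_clock hwb (hc ω), ENNReal.coe_le_coe]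
  change MeasurableSet[ℱ t] {ω | timeChange X w s ω ≤ (t : ℝ≥0∞)}
  rw [h]
  exact measurableSet_le measurable_const (measurable_addFun_of_adapted hX hc hw t)

lemma isOptionalTime_of_isStoppingTime {σ : Ω → ℝ≥0∞} (hσ : IsStoppingTime ℱ σ) :
    IsOptionalTime ℱ σ := fun t => hσ.measurableSet_lt t

/-- A right-continuous adapted process evaluated at a stopping time. -/
lemma measurable_apply_stoppingTime {σ : Ω → ℝ≥0∞} (hσ : IsStoppingTime ℱ σ) {f : ℝ≥0 → Ω → ℝ}
    (hf : ∀ t, Measurable[ℱ t] (f t))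
    (hfc : ∀ ω t, ContinuousWithinAt (fun t => f t ω) (Set.Ici t) t) :
    Measurable[hσ.measurableSpace] fun ω => f (σ ω).toNNReal ω := by
  have hopt := isOptionalTime_of_isStoppingTime hσ
  intro B hB
  refine ⟨?_, fun t => ?_⟩
  · have hj := measurable_uncurry_of_rightCont (m := ⨆ t, ℱ t)
      (fun t => (hf t).mono (le_iSup (fun t => ℱ t) t) le_rfl) hfc
    exact measurable_graph_comp (m := ⨆ t, ℱ t) hj
      (ENNReal.measurable_toNNReal.comp hopt.measurable_iSup) hB
  -- On `{σ ≤ t}` the sampled value is that of the process stopped at `σ`, which is adapted.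
  · have h : (fun ω => f (σ ω).toNNReal ω) ⁻¹' B ∩ {ω | σ ω ≤ (t : ℝ≥0∞)} =
        stoppedProcess f σ t ⁻¹' B ∩ {ω | σ ω ≤ (t : ℝ≥0∞)} := by
      ext ω
      simp only [Set.mem_inter_iff, Set.mem_preimage, Set.mem_ofPred_eq, and_congr_left_iff]
      intro h
      rw [stoppedProcess_apply, min_eq_right h]
    change MeasurableSet[ℱ t] (_ ∩ {ω | σ ω ≤ (t : ℝ≥0∞)})
    rw [h]
    exact (hopt.measurable_stopped hf hfc t hB).inter (hσ t)

/-- The filtration of the stopped sigma-fields, enlarged by the events `{ρ u < e}`. -/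
noncomputable def killedFiltration (hρ : ∀ s, IsStoppingTime ℱ (timeChange X w s))
    (he : Measurable e) : Filtration ℝ≥0 m where
  seq s := (hρ s).measurableSpace ⊔ MeasurableSpace.generateFrom
    {A : Set Ω | ∃ u ≤ s, A = {ω | timeChange X w u ω < e ω}}
  mono' s t hst := sup_le_sup
    (IsStoppingTime.measurableSpace_mono (hρ s) (hρ t) fun _ => timeChange_mono hst)
    (MeasurableSpace.generateFrom_mono fun _ ⟨u, hu, h⟩ => ⟨u, hu.trans hst, h⟩)
  le' s := by
    refine sup_le (hρ s).measurableSpace_le (MeasurableSpace.generateFrom_le ?_)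
    rintro _ ⟨u, -, rfl⟩
    exact measurableSet_lt (isOptionalTime_of_isStoppingTime (hρ u)).measurable he

lemma killedFiltration_apply (hρ : ∀ s, IsStoppingTime ℱ (timeChange X w s)) (he : Measurable e)
    (s : ℝ≥0) : killedFiltration hρ he s = (hρ s).measurableSpace ⊔
      MeasurableSpace.generateFrom
        {A : Set Ω | ∃ u ≤ s, A = {ω | timeChange X w u ω < e ω}} := rfl

lemma measurableSet_timeChange_lt (hρ : ∀ s, IsStoppingTime ℱ (timeChange X w s))
    (he : Measurable e) (s : ℝ≥0) :
    MeasurableSet[killedFiltration hρ he s] {ω | timeChange X w s ω < e ω} := by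
  have h : MeasurableSpace.generateFrom
      {A : Set Ω | ∃ u ≤ s, A = {ω | timeChange X w u ω < e ω}} ≤ killedFiltration hρ he s :=
    le_sup_right
  exact h _ (MeasurableSpace.measurableSet_generateFrom ⟨s, le_rfl, rfl⟩)

lemma measurable_timeChanged (hρ : ∀ s, IsStoppingTime ℱ (timeChange X w s)) (he : Measurable e)
    {f : ℝ≥0 → Ω → ℝ} (hf : ∀ t, Measurable[ℱ t] (f t))
    (hfc : ∀ ω t, ContinuousWithinAt (fun t => f t ω) (Set.Ici t) t) (k : ℝ) (s : ℝ≥0) :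
    Measurable[killedFiltration hρ he s] (timeChanged X w e f k s) := by
  have h1 : Measurable[killedFiltration hρ he s] fun ω => f (timeChange X w s ω).toNNReal ω :=
    (measurable_apply_stoppingTime (hρ s) hf hfc).mono le_sup_left le_rfl
  exact ((h1.sub_const k).indicator (measurableSet_timeChange_lt hρ he s)).add_const k

/-- Before the lifetime the enlarged sigma-field is the stopped one. -/
lemma exists_inter_eq_of_killedFiltration (hρ : ∀ s, IsStoppingTime ℱ (timeChange X w s))
    (he : Measurable e) {s : ℝ≥0} {G : Set Ω} (hG : MeasurableSet[killedFiltration hρ he s] G) :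
    ∃ F, MeasurableSet[(hρ s).measurableSpace] F ∧
      G ∩ {ω | timeChange X w s ω < e ω} = F ∩ {ω | timeChange X w s ω < e ω} := by
  set B := {ω | timeChange X w s ω < e ω} with hB
  -- The sets whose trace on `B` is the trace of an event of the stopped sigma-field form a
  -- σ-algebra. It contains each `{ρ u < e}` with `u ≤ s`, whose trace is all of `B`.
  let 𝓣 : MeasurableSpace Ω :=
    ((hρ s).measurableSpace.comap (Subtype.val : B → Ω)).map Subtype.val
  have hle : killedFiltration hρ he s ≤ 𝓣 := by
    refine sup_le (fun F hF => ⟨F, hF, rfl⟩) (MeasurableSpace.generateFrom_le ?_)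
    rintro _ ⟨u, hu, rfl⟩
    refine ⟨Set.univ, MeasurableSet.univ, ?_⟩
    ext ⟨ω, hω⟩
    simpa using lt_of_le_of_lt (timeChange_mono hu) hω
  obtain ⟨F, hF, hFG⟩ := hle G hG
  refine ⟨F, hF, ?_⟩
  rw [Set.inter_comm G, Set.inter_comm F]
  exact (Subtype.preimage_coe_eq_preimage_coe_iff.1 hFG).symm

end TimeChangedFiltration

/-! ### The stopped process `W`: relation to `Z`, bounds and path regularity -/

section ProcessW

variable {Ω : Type*} {m : MeasurableSpace Ω} {P : ℝ → Measure Ω} {X : ℝ≥0 → Ω → ℝ}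
  {ℱ : Filtration ℝ≥0 m} {q : ℝ≥0} {e : Ω → ℝ≥0∞} {w : ℝ → ℝ≥0} {c : ℝ} {γ : ℝ≥0}

lemma bddAbove_const_mul (hwb : ∀ a b : ℝ, BddAbove (w '' Set.Icc a b)) (γ : ℝ≥0) (a b : ℝ) :
    BddAbove ((fun z => γ * w z) '' Set.Icc a b) := by
  obtain ⟨K, hK⟩ := hwb a b
  refine ⟨γ * K, ?_⟩
  rintro _ ⟨z, hz, rfl⟩
  exact mul_le_mul_right (hK ⟨z, hz, rfl⟩) γ

lemma procW_eq (hwb : ∀ a b : ℝ, BddAbove (w '' Set.Icc a b)) {ω : Ω}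
    (hc : IsCadlag fun t => X t ω) (s : ℝ≥0) :
    procW P X e w γ s ω = Real.exp (-((γ : ℝ) * s)) *
      timeChanged X w e (fun t ω => scaleH P X e (fun z => γ * w z) (X t ω)) 0 s ω := by
  rw [procW, procY_eq hwb hc]
  by_cases h : timeChange X w s ω < e ω
  · simp [h, timeChanged_of_lt h]
  · simp [h, timeChanged_of_le (not_lt.1 h)]

lemma procW_of_le (hwb : ∀ a b : ℝ, BddAbove (w '' Set.Icc a b)) {ω : Ω}
    (hc : IsCadlag fun t => X t ω) {s : ℝ≥0} (h : e ω ≤ timeChange X w s ω) :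
    procW P X e w γ s ω = 0 := by
  rw [procW_eq hwb hc, timeChanged_of_le h, mul_zero]

lemma procW_of_lt (hwb : ∀ a b : ℝ, BddAbove (w '' Set.Icc a b)) {ω : Ω}
    (hc : IsCadlag fun t => X t ω) {s : ℝ≥0} (h : timeChange X w s ω < e ω) :
    procW P X e w γ s ω = Real.exp (-((γ : ℝ) * s)) *
      scaleH P X e (fun z => γ * w z) (X (timeChange X w s ω).toNNReal ω) := by
  rw [procW_eq hwb hc, timeChanged_of_lt h]

lemma toReal_addFun_timeChange (hw : Measurable w) (hwb : ∀ a b : ℝ, BddAbove (w '' Set.Icc a b))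
    {ω : Ω} (hc : IsCadlag fun t => X t ω) (hpos : ∀ y, 0 < w y) {s : ℝ≥0}
    (h : timeChange X w s ω < ∞) :
    (addFun X (fun z => γ * w z) (timeChange X w s ω) ω).toReal = γ * s := by
  obtain ⟨t, rfl⟩ := exists_eq_clock hw hwb hc h
  rw [timeChange_clock hw hwb hc hpos, addFun_const_mul, ← coe_clock hwb hc]
  simp

/-- At time `ρ s` the clock shows `s`, so `exp (-γ s)` is the discount of `Z` for the weight `γ w`,
except that the `q`-part has to be undone. -/
lemma procW_eq_procZ (hw : Measurable w) (hwb : ∀ a b : ℝ, BddAbove (w '' Set.Icc a b))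
    {ω : Ω} (hc : IsCadlag fun t => X t ω) (hpos : ∀ y, 0 < w y) (q : ℝ≥0) {s : ℝ≥0}
    (h : timeChange X w s ω < e ω) :
    procW P X e w γ s ω =
      procZ P X q e (fun z => γ * w z) (timeChange X w s ω).toNNReal ω *
        Real.exp (q * (timeChange X w s ω).toReal) := by
  have hne : timeChange X w s ω ≠ ∞ := h.ne_top
  have h1 := toReal_addFun_timeChange (γ := γ) hw hwb hc hpos (lt_top_iff_ne_top.2 hne)
  rw [procW_of_lt hwb hc h, procZ, ENNReal.coe_toNNReal hne, h1, mul_right_comm, ← Real.exp_add]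
  congr 2
  rw [← ENNReal.coe_toNNReal_eq_toReal]
  ring

lemma stoppedW_apply (s : ℝ≥0) (ω : Ω) : stoppedW P X e w γ c s ω =
    procW P X e w γ (min (s : ℝ≥0∞) (passageTimeY X e w c ω)).toNNReal ω :=
  stoppedProcess_apply _ _ _ _

/-- The value of the stopped process `W` at the passage time, zero if the lifetime comes first. -/
noncomputable def terminalW (P : ℝ → Measure Ω) (X : ℝ≥0 → Ω → ℝ) (e : Ω → ℝ≥0∞) (w : ℝ → ℝ≥0)
    (γ : ℝ≥0) (c : ℝ) : Ω → ℝ :=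
  {ω | passageTime X c ω < e ω}.indicator fun ω => scaleH P X e (fun z => γ * w z) c *
    Real.exp (-(addFun X (fun z => γ * w z) (passageTime X c ω) ω).toReal)

lemma le_passageTimeY (hw : Measurable w) (hwb : ∀ a b : ℝ, BddAbove (w '' Set.Icc a b))
    {ω : Ω} (hc : IsCadlag fun t => X t ω) (hpos : ∀ y, 0 < w y) {s : ℝ≥0}
    (h : timeChange X w s ω ≤ passageTime X c ω) : (s : ℝ≥0∞) ≤ passageTimeY X e w c ω := by
  rcases le_or_gt (e ω) (passageTime X c ω) with he | he
  · rw [passageTimeY_of_le hw hwb hc hpos he]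
    exact le_top
  · have hr := (ENNReal.coe_toNNReal he.ne_top).symm
    rw [passageTimeY_of_lt hw hwb hc hpos hr (by rwa [← hr])]
    rw [hr, timeChange_le_iff hw hwb hc hpos] at h
    exact_mod_cast h

lemma stoppedW_of_le (hw : Measurable w) (hwb : ∀ a b : ℝ, BddAbove (w '' Set.Icc a b))
    {ω : Ω} (hc : IsCadlag fun t => X t ω) (hpos : ∀ y, 0 < w y) {s : ℝ≥0}
    (h : timeChange X w s ω ≤ passageTime X c ω) :
    stoppedW P X e w γ c s ω = procW P X e w γ s ω := by
  rw [stoppedW_apply, min_eq_left (le_passageTimeY hw hwb hc hpos h), ENNReal.toNNReal_coe]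

/-- Once `ρ s` has reached the earlier of `τ` and `e`, the process is frozen: at `0` if `e ≤ τ`, and
otherwise at its value at time `clock τ`, where the path is at `c`. -/
lemma stoppedW_eq_terminalW (hX : IsSpectrallyNegativeLevy P X) (hw : Measurable w)
    (hwb : ∀ a b : ℝ, BddAbove (w '' Set.Icc a b)) (hpos : ∀ y, 0 < w y) {ω : Ω}
    (h0 : X 0 ω ≤ c) {s : ℝ≥0}
    (h : ¬ (timeChange X w s ω < passageTime X c ω ∧ timeChange X w s ω < e ω)) :
    stoppedW P X e w γ c s ω = terminalW P X e w γ c ω := by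
  have hc := hX.cadlag ω
  rcases le_or_gt (e ω) (passageTime X c ω) with he | he
  · have hρ : e ω ≤ timeChange X w s ω := by
      by_contra! hlt
      exact h ⟨hlt.trans_le he, hlt⟩
    rw [stoppedW_apply, passageTimeY_of_le hw hwb hc hpos he, min_eq_left le_top,
      ENNReal.toNNReal_coe, procW_of_le hwb hc hρ, terminalW,
      Set.indicator_of_notMem (by exact not_lt.2 he)]
  · have hρ : passageTime X c ω ≤ timeChange X w s ω := by
      by_contra! hlt
      exact h ⟨hlt, hlt.trans he⟩
    have hr := (ENNReal.coe_toNNReal he.ne_top).symm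
    have hX' := apply_passageTime (hX.isSNPath ω) h0 hr
    rw [terminalW, Set.indicator_of_mem (by exact he)]
    set r := (passageTime X c ω).toNNReal
    have hre : (r : ℝ≥0∞) < e ω := by rwa [← hr]
    have hrs : clock X w ω r ≤ s := by
      by_contra! hlt
      have h1 : timeChange X w s ω ≤ r := (timeChange_le_iff hw hwb hc hpos).2 hlt.le
      have h2 := timeChange_lt_of_lt hw hwb hc hpos hlt (h1.trans_lt ENNReal.coe_lt_top)
      rw [timeChange_clock hw hwb hc hpos, ← hr] at h2
      exact absurd h2 (not_lt.2 hρ)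
    have hρr := timeChange_clock hw hwb hc hpos r
    rw [stoppedW_apply, passageTimeY_of_lt hw hwb hc hpos hr hre,
      min_eq_right (by exact_mod_cast hrs), ENNReal.toNNReal_coe,
      procW_of_lt hwb hc (by rwa [hρr]), ← toReal_addFun_timeChange hw hwb hc hpos
        (by rw [hρr]; exact ENNReal.coe_lt_top), hρr, ENNReal.toNNReal_coe, hX', hr, mul_comm]

lemma stoppedW_of_lt_start (hX : IsSpectrallyNegativeLevy P X) (hw : Measurable w)
    (hwb : ∀ a b : ℝ, BddAbove (w '' Set.Icc a b)) (hpos : ∀ y, 0 < w y) {ω : Ω}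
    (h0 : c < X 0 ω) (he : 0 < e ω) (s : ℝ≥0) :
    stoppedW P X e w γ c s ω = scaleH P X e (fun z => γ * w z) (X 0 ω) := by
  have hc := hX.cadlag ω
  have hρ : timeChange X w 0 ω = 0 := by
    have := timeChange_clock hw hwb hc hpos 0
    rwa [clock_zero] at this
  rw [stoppedW_apply, passageTimeY_of_lt hw hwb hc hpos (r := 0)
    (by rw [passageTime_eq_zero hX h0]; rfl) (by simpa using he), clock_zero]
  simp [procW_of_lt hwb hc (s := 0) (by rwa [hρ]), hρ]

lemma procW_nonneg (hX : IsSpectrallyNegativeLevy P X)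
    (hℱ : HasIndepIncrementsRel P X ℱ) (he : IsIndepExpTime P X q e) (hw : Measurable w)
    (hwb : ∀ a b : ℝ, BddAbove (w '' Set.Icc a b)) (s : ℝ≥0) (ω : Ω) :
    0 ≤ procW P X e w γ s ω := by
  rcases lt_or_ge (timeChange X w s ω) (e ω) with h | h
  · rw [procW_of_lt hwb (hX.cadlag ω) h]
    exact mul_nonneg (Real.exp_pos _).le
      (scaleH_pos hX hℱ he (hw.const_mul γ) (bddAbove_const_mul hwb γ) _).le
  · rw [procW_of_le hwb (hX.cadlag ω) h]

lemma terminalW_nonneg (hX : IsSpectrallyNegativeLevy P X)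
    (hℱ : HasIndepIncrementsRel P X ℱ) (he : IsIndepExpTime P X q e) (hw : Measurable w)
    (hwb : ∀ a b : ℝ, BddAbove (w '' Set.Icc a b)) (ω : Ω) : 0 ≤ terminalW P X e w γ c ω :=
  Set.indicator_nonneg (fun _ _ => mul_nonneg
    (scaleH_pos hX hℱ he (hw.const_mul γ) (bddAbove_const_mul hwb γ) c).le (Real.exp_pos _).le) ω

lemma terminalW_le (hX : IsSpectrallyNegativeLevy P X)
    (hℱ : HasIndepIncrementsRel P X ℱ) (he : IsIndepExpTime P X q e) (hw : Measurable w)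
    (hwb : ∀ a b : ℝ, BddAbove (w '' Set.Icc a b)) (ω : Ω) :
    terminalW P X e w γ c ω ≤ scaleH P X e (fun z => γ * w z) c := by
  have h := (scaleH_pos hX hℱ he (hw.const_mul γ) (bddAbove_const_mul hwb γ) c).le
  exact Set.indicator_le' (fun ω _ => mul_le_of_le_one_right h
    (Real.exp_le_one_iff.2 (neg_nonpos.2 ENNReal.toReal_nonneg))) (fun _ _ => h) ω

lemma stoppedW_le (hX : IsSpectrallyNegativeLevy P X)
    (hℱ : HasIndepIncrementsRel P X ℱ) (he : IsIndepExpTime P X q e) (hw : Measurable w)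
    (hwb : ∀ a b : ℝ, BddAbove (w '' Set.Icc a b)) (hpos : ∀ y, 0 < w y) {ω : Ω}
    (h0 : X 0 ω ≤ c) (s : ℝ≥0) :
    stoppedW P X e w γ c s ω ≤ scaleH P X e (fun z => γ * w z) c := by
  by_cases h : timeChange X w s ω < passageTime X c ω ∧ timeChange X w s ω < e ω
  · rw [stoppedW_of_le hw hwb (hX.cadlag ω) hpos h.1.le, procW_of_lt hwb (hX.cadlag ω) h.2]
    have hle : X (timeChange X w s ω).toNNReal ω ≤ c := by
      refine le_of_le_passageTime (hX.isSNPath ω) h0 ?_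
      rw [ENNReal.coe_toNNReal h.2.ne_top]
      exact h.1.le
    have hH := scaleH_mono hX hℱ he (hw.const_mul γ) (bddAbove_const_mul hwb γ) hle
    refine le_trans (mul_le_of_le_one_left
      (scaleH_pos hX hℱ he (hw.const_mul γ) (bddAbove_const_mul hwb γ) _).le
      (Real.exp_le_one_iff.2 (neg_nonpos.2 (by positivity)))) hH
  · rw [stoppedW_eq_terminalW hX hw hwb hpos h0 h]
    exact terminalW_le hX hℱ he hw hwb ω

lemma IsIndepExpTime.ae_pos [∀ x, IsProbabilityMeasure (P x)] (he : IsIndepExpTime P X q e)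
    (x : ℝ) : ∀ᵐ ω ∂(P x), 0 < e ω := by
  have h := he.survival x 0
  simp only [ENNReal.coe_zero, NNReal.coe_zero, mul_zero, neg_zero, Real.exp_zero,
    ENNReal.ofReal_one] at h
  exact (prob_compl_eq_zero_iff (measurableSet_lt measurable_const he.measurable)).2 h

lemma IsIndepExpTime.ae_ne_top (he : IsIndepExpTime P X q e) (hq : q ≠ 0) (x : ℝ) :
    ∀ᵐ ω ∂(P x), e ω ≠ ∞ := by
  have hle : ∀ n : ℕ, P x {ω | e ω = ∞} ≤ ENNReal.ofReal (Real.exp (-((q : ℝ) * n))) := fun n => by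
    have h := he.survival x n
    rw [NNReal.coe_natCast] at h
    rw [← h]
    exact measure_mono fun ω (hω : e ω = ∞) => by simp [hω]
  have hlim : Tendsto (fun n : ℕ => ENNReal.ofReal (Real.exp (-((q : ℝ) * n)))) atTop (𝓝 0) := by
    have h1 : Tendsto (fun n : ℕ => (q : ℝ) * n) atTop atTop :=
      tendsto_natCast_atTop_atTop.const_mul_atTop (by positivity)
    have h2 := ENNReal.tendsto_ofReal (Real.tendsto_exp_neg_atTop_nhds_zero.comp h1)
    simpa using h2
  have h0 : P x {ω | e ω = ∞} = 0 := le_antisymm (ge_of_tendsto' hlim hle) zero_le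
  exact measure_eq_zero_iff_ae_notMem.1 h0

lemma stoppedW_bounded (hX : IsSpectrallyNegativeLevy P X)
    (hℱ : HasIndepIncrementsRel P X ℱ) (he : IsIndepExpTime P X q e) (hw : Measurable w)
    (hwb : ∀ a b : ℝ, BddAbove (w '' Set.Icc a b)) (hpos : ∀ y, 0 < w y) (x : ℝ) :
    ∃ C : ℝ, ∀ᵐ ω ∂(P x), ∀ s, |stoppedW P X e w γ c s ω| ≤ C := by
  have := hX.prob
  refine ⟨max (scaleH P X e (fun z => γ * w z) c) (scaleH P X e (fun z => γ * w z) x), ?_⟩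
  filter_upwards [hX.ae_start x, he.ae_pos x] with ω h0 hep s
  have hn : 0 ≤ stoppedW P X e w γ c s ω := by
    rw [stoppedW_apply]
    exact procW_nonneg hX hℱ he hw hwb _ ω
  rw [abs_of_nonneg hn]
  rcases le_or_gt (X 0 ω) c with hx | hx
  · exact (stoppedW_le hX hℱ he hw hwb hpos hx s).trans (le_max_left _ _)
  · rw [stoppedW_of_lt_start hX hw hwb hpos hx hep, h0]
    exact le_max_right _ _

lemma rightCont_procW (hX : IsSpectrallyNegativeLevy P X)
    (hℱ : HasIndepIncrementsRel P X ℱ) (he : IsIndepExpTime P X q e) (hw : Measurable w)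
    (hwb : ∀ a b : ℝ, BddAbove (w '' Set.Icc a b)) (hpos : ∀ y, 0 < w y) (ω : Ω) (s : ℝ≥0) :
    ContinuousWithinAt (fun s => procW P X e w γ s ω) (Set.Ici s) s := by
  have hc := hX.cadlag ω
  simp_rw [procW_eq hwb hc]
  refine ContinuousWithinAt.mul (Continuous.continuousWithinAt (by fun_prop))
    (rightCont_timeChanged hw hwb hc hpos (fun t => ?_) 0 s)
  exact (continuous_scaleH hX hℱ he (hw.const_mul γ)
    (bddAbove_const_mul hwb γ)).continuousAt.comp_continuousWithinAt (hc.rightCont t)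

lemma measurable_stoppedW (hX : IsSpectrallyNegativeLevy P X)
    (hℱ : HasIndepIncrementsRel P X ℱ) (he : IsIndepExpTime P X q e) (hw : Measurable w)
    (hwb : ∀ a b : ℝ, BddAbove (w '' Set.Icc a b)) (hpos : ∀ y, 0 < w y)
    (hρ : ∀ s, IsStoppingTime ℱ (timeChange X w s)) (s : ℝ≥0) :
    Measurable[killedFiltration hρ he.measurable s] (stoppedW P X e w γ c s) := by
  have hH := continuous_scaleH hX hℱ he (hw.const_mul γ) (bddAbove_const_mul hwb γ)
  have hrc := fun ω => (hX.cadlag ω).rightCont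
  have hT : IsOptionalTime (killedFiltration hρ he.measurable) (passageTimeY X e w c) := by
    have h := isOptionalTime_passageTime (measurable_timeChanged hρ he.measurable hℱ.adapted hrc c)
      (fun ω => rightCont_timeChanged hw hwb (hX.cadlag ω) hpos (hrc ω) c) c
    have heq : passageTimeY X e w c = passageTime (timeChanged X w e X c) c :=
      funext fun ω => passageTimeY_eq hwb (hX.cadlag ω) c
    rwa [heq]
  refine hT.measurable_stopped (fun u => ?_)
    (fun ω => rightCont_procW hX hℱ he hw hwb hpos ω) s
  have heq : procW P X e w γ u = fun ω => Real.exp (-((γ : ℝ) * u)) *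
      timeChanged X w e (fun t ω => scaleH P X e (fun z => γ * w z) (X t ω)) 0 u ω :=
    funext fun ω => procW_eq hwb (hX.cadlag ω) u
  rw [heq]
  exact (measurable_timeChanged hρ he.measurable (fun t => hH.measurable.comp (hℱ.adapted t))
    (fun ω t => hH.continuousAt.comp_continuousWithinAt (hrc ω t)) 0 u).const_mul _

/-- Only left limits need care. While the time change is finite they come from those of `X`; where
it first reaches `∞`, the left limit of `W` is the limit of the stopped `Z` at infinity, hence the
hypothesis `hlim`. -/
lemma isCadlag_stoppedW (hX : IsSpectrallyNegativeLevy P X)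
    (hℱ : HasIndepIncrementsRel P X ℱ) (he : IsIndepExpTime P X q e) (hw : Measurable w)
    (hwb : ∀ a b : ℝ, BddAbove (w '' Set.Icc a b)) (hpos : ∀ y, 0 < w y) {ω : Ω}
    (hq : e ω = ∞ → q = 0) (hlim : passageTime X c ω = ∞ → ∃ l, Tendsto
      (fun t => stoppedZ P X q e (fun z => γ * w z) c t ω) atTop (𝓝 l)) :
    IsCadlag fun s => stoppedW P X e w γ c s ω := by
  have hc := hX.cadlag ω
  simp_rw [stoppedW_apply]
  refine isCadlag_stop (fun s _ => rightCont_procW hX hℱ he hw hwb hpos ω s) fun s hs => ?_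
  have hcont := (continuous_timeChange hw hwb hc hpos).tendsto s
  rcases lt_or_ge (e ω) (timeChange X w s ω) with hes | hes
  · refine ⟨0, tendsto_const_nhds.congr' ?_⟩
    filter_upwards [nhdsWithin_le_nhds (hcont.eventually (lt_mem_nhds hes))] with u hu
    exact (procW_of_le hwb hc hu.le).symm
  by_cases hfin : timeChange X w s ω < ∞
  · have hlt : ∀ u < s, timeChange X w u ω < timeChange X w s ω := fun u hu =>
      timeChange_lt_of_lt hw hwb hc hpos hu ((timeChange_mono hu.le).trans_lt hfin)
    have hleft : Tendsto (fun u => (timeChange X w u ω).toNNReal) (𝓝[<] s)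
        (𝓝[<] (timeChange X w s ω).toNNReal) := by
      refine tendsto_nhdsWithin_iff.2 ⟨(ENNReal.tendsto_toNNReal hfin.ne).comp
        (hcont.mono_left nhdsWithin_le_nhds), ?_⟩
      filter_upwards [self_mem_nhdsWithin] with u hu
      exact (ENNReal.toNNReal_lt_toNNReal (hlt u hu).ne_top hfin.ne).2 (hlt u hu)
    obtain ⟨l, hl⟩ := (hc (timeChange X w s ω).toNNReal).2
    have hH := continuous_scaleH hX hℱ he (hw.const_mul γ) (bddAbove_const_mul hwb γ)
    have hexp : Tendsto (fun u : ℝ≥0 => Real.exp (-((γ : ℝ) * u))) (𝓝[<] s)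
        (𝓝 (Real.exp (-((γ : ℝ) * s)))) :=
      (Continuous.tendsto (by fun_prop) s).mono_left nhdsWithin_le_nhds
    refine ⟨_, (hexp.mul ((hH.tendsto l).comp (hl.comp hleft))).congr' ?_⟩
    filter_upwards [self_mem_nhdsWithin] with u hu
    exact (procW_of_lt hwb hc ((hlt u hu).trans_le hes)).symm
  have hρ : timeChange X w s ω = ∞ := by simpa using hfin
  have he_top : e ω = ∞ := top_le_iff.1 (hρ ▸ hes)
  by_cases hu : ∃ u < s, timeChange X w u ω = ∞
  · obtain ⟨u, hus, hu⟩ := hu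
    refine ⟨0, tendsto_const_nhds.congr' ?_⟩
    filter_upwards [nhdsWithin_le_nhds (lt_mem_nhds hus)] with v hv
    refine (procW_of_le hwb hc ?_).symm
    exact le_top.trans (hu ▸ timeChange_mono hv.le)
  push Not at hu
  -- A finite passage time `r` would give `s ≤ clock r`, hence `ρ s ≤ r < ∞`.
  have hτ : passageTime X c ω = ∞ := by
    by_contra hne
    have hr := (ENNReal.coe_toNNReal hne).symm
    rw [passageTimeY_of_lt hw hwb hc hpos hr (by rw [he_top]; exact ENNReal.coe_lt_top),
      ENNReal.coe_le_coe, ← timeChange_le_iff hw hwb hc hpos, hρ] at hs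
    exact ENNReal.coe_ne_top (top_le_iff.1 hs)
  obtain ⟨l, hl⟩ := hlim hτ
  have htop : Tendsto (fun u => (timeChange X w u ω).toNNReal) (𝓝[<] s) atTop := by
    rw [hρ] at hcont
    refine tendsto_atTop.2 fun b => ?_
    filter_upwards [self_mem_nhdsWithin, nhdsWithin_le_nhds
      (hcont.eventually (lt_mem_nhds (ENNReal.coe_lt_top (r := b))))] with u hus hb
    rw [← ENNReal.coe_le_coe, ENNReal.coe_toNNReal (hu u hus)]
    exact hb.le
  refine ⟨l, (hl.comp htop).congr' ?_⟩
  filter_upwards [self_mem_nhdsWithin] with u hus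
  -- As `e = ∞`, the rate `q` is `0`, and the factor `exp (q ρ)` separating `W` from `Z` is `1`.
  rw [procW_eq_procZ hw hwb hc hpos q (by rw [he_top]; exact lt_top_iff_ne_top.2 (hu u hus)),
    Function.comp_apply, stoppedZ_of_le (by rw [hτ]; exact le_top), hq he_top]
  simp

lemma ae_isCadlag_stoppedW (hX : IsSpectrallyNegativeLevy P X)
    (hℱ : HasIndepIncrementsRel P X ℱ) (he : IsIndepExpTime P X q e) (hw : Measurable w)
    (hwb : ∀ a b : ℝ, BddAbove (w '' Set.Icc a b)) (hpos : ∀ y, 0 < w y) (x : ℝ) :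
    ∀ᵐ ω ∂(P x), IsCadlag fun s => stoppedW P X e w γ c s ω := by
  have hqe : ∀ᵐ ω ∂(P x), e ω = ∞ → q = 0 := by
    by_cases hq : q = 0
    · exact Eventually.of_forall fun _ _ => hq
    · exact (he.ae_ne_top hq x).mono fun ω h h' => absurd h' h
  rcases le_or_gt x c with hx | hx
  · filter_upwards [hqe, tendsto_stoppedZ hX hℱ he (hw.const_mul γ)
      (bddAbove_const_mul hwb γ) hx] with ω h1 h2
    exact isCadlag_stoppedW hX hℱ he hw hwb hpos h1 fun _ => ⟨_, h2⟩
  · filter_upwards [hqe, hX.ae_start x] with ω h1 h0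
    refine isCadlag_stoppedW hX hℱ he hw hwb hpos h1 fun h => ?_
    rw [passageTime_eq_zero hX (by rwa [h0])] at h
    exact absurd h ENNReal.zero_ne_top

end ProcessW

/-! ### The martingale property of the stopped process `W` -/

section MartingaleW

variable {Ω : Type*} {m : MeasurableSpace Ω} {P : ℝ → Measure Ω} {X : ℝ≥0 → Ω → ℝ}
  {ℱ : Filtration ℝ≥0 m} {q : ℝ≥0} {e : Ω → ℝ≥0∞} {w : ℝ → ℝ≥0} {c : ℝ} {γ : ℝ≥0}

lemma stoppedW_nonneg (hX : IsSpectrallyNegativeLevy P X)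
    (hℱ : HasIndepIncrementsRel P X ℱ) (he : IsIndepExpTime P X q e) (hw : Measurable w)
    (hwb : ∀ a b : ℝ, BddAbove (w '' Set.Icc a b)) (s : ℝ≥0) (ω : Ω) :
    0 ≤ stoppedW P X e w γ c s ω := by
  rw [stoppedW_apply]
  exact procW_nonneg hX hℱ he hw hwb _ ω

lemma measurable_terminalW (hX : IsSpectrallyNegativeLevy P X) (he : IsIndepExpTime P X q e)
    (hw : Measurable w) : Measurable (terminalW P X e w γ c) := by
  have hτ := measurable_passageTime hX.measurable hX.cadlag c
  refine Measurable.indicator ?_ (measurableSet_lt hτ he.measurable)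
  exact (Real.measurable_exp.comp (measurable_graph_comp (measurable_addFun hX.measurable
    hX.cadlag (hw.const_mul γ)) hτ).ennreal_toReal.neg).const_mul _

lemma integrable_terminalW (hX : IsSpectrallyNegativeLevy P X)
    (hℱ : HasIndepIncrementsRel P X ℱ) (he : IsIndepExpTime P X q e) (hw : Measurable w)
    (hwb : ∀ a b : ℝ, BddAbove (w '' Set.Icc a b)) (x : ℝ) :
    Integrable (terminalW P X e w γ c) (P x) := by
  have := hX.prob x
  refine Integrable.mono' (integrable_const (scaleH P X e (fun z => γ * w z) c))
    (measurable_terminalW hX he hw).aestronglyMeasurable (Eventually.of_forall fun ω => ?_)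
  rw [Real.norm_of_nonneg (terminalW_nonneg hX hℱ he hw hwb ω)]
  exact terminalW_le hX hℱ he hw hwb ω

lemma integrable_stoppedW (hX : IsSpectrallyNegativeLevy P X)
    (hℱ : HasIndepIncrementsRel P X ℱ) (he : IsIndepExpTime P X q e) (hw : Measurable w)
    (hwb : ∀ a b : ℝ, BddAbove (w '' Set.Icc a b)) (hpos : ∀ y, 0 < w y)
    (hρ : ∀ s, IsStoppingTime ℱ (timeChange X w s)) {x : ℝ} (hx : x ≤ c) (s : ℝ≥0) :
    Integrable (stoppedW P X e w γ c s) (P x) := by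
  have := hX.prob x
  refine Integrable.mono' (integrable_const (scaleH P X e (fun z => γ * w z) c))
    ((measurable_stoppedW hX hℱ he hw hwb hpos hρ s).mono
      ((killedFiltration hρ he.measurable).le s) le_rfl).aestronglyMeasurable ?_
  filter_upwards [hX.ae_start x] with ω h0
  rw [Real.norm_of_nonneg (stoppedW_nonneg hX hℱ he hw hwb s ω)]
  exact stoppedW_le hX hℱ he hw hwb hpos (h0.le.trans hx) s

/-- The identity of integrals over events of the stopped sigma-field, before the lifetime. -/
lemma setIntegral_stoppedW_of_stopped (hX : IsSpectrallyNegativeLevy P X)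
    (hℱ : HasIndepIncrementsRel P X ℱ) (he : IsIndepExpTime P X q e) (hw : Measurable w)
    (hwb : ∀ a b : ℝ, BddAbove (w '' Set.Icc a b)) (hpos : ∀ y, 0 < w y)
    (hρ : ∀ s, IsStoppingTime ℱ (timeChange X w s))
    {x : ℝ} (hx : x ≤ c)
    (hind : Indep (MeasurableSpace.comap e inferInstance) (⨆ t, ℱ t) (P x)) (s : ℝ≥0)
    {F : Set Ω} (hF : MeasurableSet[(hρ s).measurableSpace] F) :
    ∫ ω in F ∩ {ω | timeChange X w s ω < passageTime X c ω} ∩ {ω | timeChange X w s ω < e ω},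
      stoppedW P X e w γ c s ω ∂(P x) =
    ∫ ω in F ∩ {ω | timeChange X w s ω < passageTime X c ω} ∩ {ω | timeChange X w s ω < e ω},
      terminalW P X e w γ c ω ∂(P x) := by
  have := hX.prob x
  have hw' : Measurable fun z => γ * w z := hw.const_mul γ
  have hwb' := bddAbove_const_mul hwb γ
  have hH := (scaleH_pos hX hℱ he hw' hwb' c).le
  have hle : ⨆ t, ℱ t ≤ m := iSup_le ℱ.le
  have hρo := isOptionalTime_of_isStoppingTime (hρ s)
  have hρm := hρo.measurable_iSup
  have hτm := (isOptionalTime_passageTime hℱ.adapted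
    (fun ω => (hX.cadlag ω).rightCont) c).measurable_iSup
  set D := F ∩ {ω | timeChange X w s ω < passageTime X c ω} with hD
  have hDm : MeasurableSet[⨆ t, ℱ t] D := hF.1.inter (measurableSet_lt hρm hτm)
  have hZρ : Measurable[⨆ t, ℱ t] fun ω =>
      stoppedZ P X q e (fun z => γ * w z) c (timeChange X w s ω).toNNReal ω :=
    (measurable_apply_stoppingTime (hρ s) (fun t => measurable_stoppedZ hX hℱ he hw' hwb' t)
      (fun ω => (isCadlag_stoppedZ hX hℱ he hw' hwb' ω).rightCont)).mono
      (hρ s).measurableSpace_le' le_rfl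
  -- `k₁` and `k₂` are the two integrands with the dependence on `e` stripped off. They are
  -- measurable for `ℱ_∞`, so `e` can be integrated out, against `ρ s` for the first and `τ` for the
  -- second.
  set k₁ : Ω → ℝ := D.indicator fun ω =>
    stoppedZ P X q e (fun z => γ * w z) c (timeChange X w s ω).toNNReal ω *
      Real.exp (q * (timeChange X w s ω).toReal) with hk₁
  set k₂ : Ω → ℝ := D.indicator fun ω => scaleH P X e (fun z => γ * w z) c *
    Real.exp (-(addFun X (fun z => γ * w z) (passageTime X c ω) ω).toReal) with hk₂
  have hk₁m : Measurable[⨆ t, ℱ t] k₁ :=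
    (hZρ.mul (Real.measurable_exp.comp (hρm.ennreal_toReal.const_mul _))).indicator hDm
  have hk₂m : Measurable[⨆ t, ℱ t] k₂ :=
    ((Real.measurable_exp.comp (measurable_graph_comp (m := ⨆ t, ℱ t) (measurable_addFun
      (m := ⨆ t, ℱ t) (fun t => (hℱ.adapted t).mono (le_iSup (fun t => ℱ t) t) le_rfl)
      hX.cadlag hw') hτm).ennreal_toReal.neg).const_mul _).indicator hDm
  have hk₁0 : ∀ ω, 0 ≤ k₁ ω := Set.indicator_nonneg fun ω _ =>
    mul_nonneg (stoppedZ_nonneg hX hℱ he hw' hwb' _ ω) (Real.exp_pos _).le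
  have hk₂0 : ∀ ω, 0 ≤ k₂ ω := Set.indicator_nonneg fun ω _ =>
    mul_nonneg hH (Real.exp_pos _).le
  have hA := setIntegral_lt_of_indep he.measurable (he.survival x) hle hind hk₁m hk₁0 hρm
  have hB := setIntegral_lt_of_indep he.measurable (he.survival x) hle hind hk₂m hk₂0 hτm
  have hDm' := hle _ hDm
  have hρm' := hρo.measurable
  have hτm' : Measurable (passageTime X c) := hτm.mono hle le_rfl
  have hρe : MeasurableSet {ω | timeChange X w s ω < e ω} := measurableSet_lt hρm' he.measurable
  have hτe : MeasurableSet {ω | passageTime X c ω < e ω} := measurableSet_lt hτm' he.measurable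
  have hleft : ∫ ω in D ∩ {ω | timeChange X w s ω < e ω}, stoppedW P X e w γ c s ω ∂(P x) =
      ∫ ω in {ω | timeChange X w s ω < e ω}, k₁ ω ∂(P x) := by
    rw [← integral_indicator (hDm'.inter hρe), ← integral_indicator hρe]
    refine integral_congr_ae (Eventually.of_forall fun ω => ?_)
    by_cases h1 : ω ∈ {ω | timeChange X w s ω < e ω}
    · by_cases h2 : ω ∈ D
      · simp only [Set.indicator_of_mem h1, Set.indicator_of_mem (Set.mem_inter h2 h1), hk₁,
          Set.indicator_of_mem h2]
        have h3 : timeChange X w s ω ≤ passageTime X c ω := le_of_lt h2.2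
        rw [stoppedW_of_le hw hwb (hX.cadlag ω) hpos h3,
          procW_eq_procZ hw hwb (hX.cadlag ω) hpos q h1, stoppedZ_of_le]
        rwa [ENNReal.coe_toNNReal (ne_of_lt (lt_of_lt_of_le h1 le_top))]
      · have h3 : ω ∉ D ∩ {ω | timeChange X w s ω < e ω} := fun h => h2 h.1
        simp only [Set.indicator_of_mem h1, Set.indicator_of_notMem h3, hk₁,
          Set.indicator_of_notMem h2]
    · have h3 : ω ∉ D ∩ {ω | timeChange X w s ω < e ω} := fun h => h1 h.2
      simp only [Set.indicator_of_notMem h1, Set.indicator_of_notMem h3]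
  have hright : ∫ ω in D ∩ {ω | timeChange X w s ω < e ω}, terminalW P X e w γ c ω ∂(P x) =
      ∫ ω in {ω | passageTime X c ω < e ω}, k₂ ω ∂(P x) := by
    rw [← integral_indicator (hDm'.inter hρe), ← integral_indicator hτe]
    refine integral_congr_ae (Eventually.of_forall fun ω => ?_)
    by_cases h1 : ω ∈ {ω | passageTime X c ω < e ω}
    · by_cases h2 : ω ∈ D
      · have h3 : ω ∈ D ∩ {ω | timeChange X w s ω < e ω} := ⟨h2,
          show timeChange X w s ω < e ω from lt_trans (b := passageTime X c ω) h2.2 h1⟩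
        simp only [Set.indicator_of_mem h1, Set.indicator_of_mem h3, hk₂,
          Set.indicator_of_mem h2, terminalW]
      · have h3 : ω ∉ D ∩ {ω | timeChange X w s ω < e ω} := fun h => h2 h.1
        simp only [Set.indicator_of_mem h1, Set.indicator_of_notMem h3, hk₂,
          Set.indicator_of_notMem h2]
    · simp only [Set.indicator_of_notMem h1, terminalW]
      simp only [Set.mem_ofPred_eq] at h1
      simp [h1]
  have hlt_top : D ⊆ {ω | timeChange X w s ω < ∞} := fun ω h =>
    show timeChange X w s ω < ∞ from lt_of_lt_of_le (b := passageTime X c ω) h.2 le_top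
  -- The survival factor `exp (-q ρ)` cancels `exp (q ρ)`, leaving `Z` sampled at `ρ s`; likewise
  -- below, `exp (-q τ)` completes `k₂` to the terminal value of `Z`.
  have hleft' : ∫ ω in {ω | timeChange X w s ω < ∞}, k₁ ω *
      Real.exp (-(q * (timeChange X w s ω).toReal)) ∂(P x) = ∫ ω in D,
        stoppedZ P X q e (fun z => γ * w z) c (timeChange X w s ω).toNNReal ω ∂(P x) := by
    rw [← integral_indicator (measurableSet_lt hρm' measurable_const), ← integral_indicator hDm']
    refine integral_congr_ae (Eventually.of_forall fun ω => ?_)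
    by_cases h2 : ω ∈ D
    · simp only [Set.indicator_of_mem (hlt_top h2), hk₁, Set.indicator_of_mem h2]
      rw [mul_assoc, ← Real.exp_add, add_neg_cancel, Real.exp_zero, mul_one]
    · simp [hk₁, Set.indicator_apply, h2]
  have hright' : ∫ ω in {ω | passageTime X c ω < ∞}, k₂ ω *
      Real.exp (-(q * (passageTime X c ω).toReal)) ∂(P x) = ∫ ω in D,
        terminalZ P X q e (fun z => γ * w z) c ω ∂(P x) := by
    rw [← integral_indicator (measurableSet_lt hτm' measurable_const), ← integral_indicator hDm']
    refine integral_congr_ae (Eventually.of_forall fun ω => ?_)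
    by_cases h2 : ω ∈ D
    · by_cases h1 : passageTime X c ω < ∞
      · rw [Set.indicator_of_mem (by exact h1), Set.indicator_of_mem h2, hk₂,
          Set.indicator_of_mem h2, terminalZ, Set.indicator_of_mem (by exact h1), mul_assoc,
          ← Real.exp_add, sub_eq_add_neg]
      · rw [Set.indicator_of_notMem (by exact h1), Set.indicator_of_mem h2, terminalZ,
          Set.indicator_of_notMem (by exact h1), mul_zero]
    · simp [hk₂, Set.indicator_apply, h2]
  rw [hleft, hright, hA, hB, hleft', hright', ← sub_eq_zero]
  have hZi : Integrable (fun ω => stoppedZ P X q e (fun z => γ * w z) c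
      (timeChange X w s ω).toNNReal ω) (P x) := by
    refine Integrable.mono' (integrable_const (scaleH P X e (fun z => γ * w z) c))
      (hZρ.mono hle le_rfl).aestronglyMeasurable ?_
    filter_upwards [hX.ae_start x] with ω h0
    rw [Real.norm_of_nonneg (stoppedZ_nonneg hX hℱ he hw' hwb' _ ω)]
    exact stoppedZ_le hX hℱ he hw' hwb' (h0.le.trans hx) _
  rw [← integral_sub hZi.integrableOn (integrable_terminalZ hX hℱ he hw' hwb' x).integrableOn]
  have hFm : MeasurableSet F := (hρ s).measurableSpace_le _ hF
  -- Sampling applies on all of `F ∩ {ρ s < ∞}`. The part outside `D` contributes nothing: there `τ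
  -- ≤ ρ s`, so the stopped `Z` is already at its terminal value.
  have hopt := setIntegral_stoppedZ_optional hX hℱ he hw' hwb' hx hρo hFm fun t => by
    have h1 : F ∩ {ω | timeChange X w s ω < t} =
        F ∩ {ω | timeChange X w s ω ≤ t} ∩ {ω | timeChange X w s ω < t} := by
      ext ω
      simp only [Set.mem_inter_iff, Set.mem_ofPred_eq]
      exact ⟨fun h => ⟨⟨h.1, h.2.le⟩, h.2⟩, fun h => ⟨h.1.1, h.2⟩⟩
    rw [h1]
    exact (hF.2 t).inter (hρo t)
  refine Eq.trans ?_ hopt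
  rw [← integral_indicator hDm', ← integral_indicator
    (hFm.inter (measurableSet_lt hρm' measurable_const))]
  refine integral_congr_ae ?_
  filter_upwards [hX.ae_start x] with ω h0
  by_cases h2 : ω ∈ D
  · rw [Set.indicator_of_mem h2, Set.indicator_of_mem (by exact ⟨h2.1, hlt_top h2⟩)]
  · rw [Set.indicator_of_notMem h2]
    by_cases h3 : ω ∈ F ∩ {ω | timeChange X w s ω < ∞}
    · rw [Set.indicator_of_mem h3]
      have h4 : passageTime X c ω ≤ timeChange X w s ω := not_lt.1 fun h => h2 ⟨h3.1, h⟩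
      rw [stoppedZ_eq_terminalZ hX (h0.le.trans hx), sub_self]
      rwa [ENNReal.coe_toNNReal (ne_of_lt h3.2)]
    · rw [Set.indicator_of_notMem h3]

/-- Off `{ρ s < τ, ρ s < e}` the process is already terminal. On it an event of the enlarged
sigma-field has the trace of an event of the stopped one, for which the integrals agree. -/
lemma stoppedW_ae_eq_condExp (hX : IsSpectrallyNegativeLevy P X)
    (hℱ : HasIndepIncrementsRel P X ℱ) (he : IsIndepExpTime P X q e) (hw : Measurable w)
    (hwb : ∀ a b : ℝ, BddAbove (w '' Set.Icc a b)) (hpos : ∀ y, 0 < w y)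
    (hρ : ∀ s, IsStoppingTime ℱ (timeChange X w s))
    {x : ℝ} (hx : x ≤ c)
    (hind : Indep (MeasurableSpace.comap e inferInstance) (⨆ t, ℱ t) (P x)) (s : ℝ≥0) :
    stoppedW P X e w γ c s =ᵐ[P x]
      (P x)[terminalW P X e w γ c | killedFiltration hρ he.measurable s] := by
  have := hX.prob x
  have hW := integrable_stoppedW (γ := γ) hX hℱ he hw hwb hpos hρ hx s
  have hη := integrable_terminalW (γ := γ) (c := c) hX hℱ he hw hwb x
  refine ae_eq_condExp_of_forall_setIntegral_eq ((killedFiltration hρ he.measurable).le s) hη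
    (fun G _ _ => hW.integrableOn) (fun G hG _ => ?_)
    (measurable_stoppedW hX hℱ he hw hwb hpos hρ s).stronglyMeasurable.aestronglyMeasurable
  obtain ⟨F, hF, hGF⟩ := exists_inter_eq_of_killedFiltration hρ he.measurable hG
  have hρm := (isOptionalTime_of_isStoppingTime (hρ s)).measurable
  have hGm := (killedFiltration hρ he.measurable).le s _ hG
  set S := {ω | timeChange X w s ω < passageTime X c ω} ∩ {ω | timeChange X w s ω < e ω} with hS
  have hSm : MeasurableSet S := (measurableSet_lt hρm
    (measurable_passageTime hX.measurable hX.cadlag c)).inter (measurableSet_lt hρm he.measurable)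
  have hGS : G ∩ S = F ∩ {ω | timeChange X w s ω < passageTime X c ω} ∩
      {ω | timeChange X w s ω < e ω} := by
    rw [hS, Set.inter_comm {ω | timeChange X w s ω < passageTime X c ω}, ← Set.inter_assoc, hGF,
      Set.inter_right_comm]
  rw [← integral_inter_add_sdiff hSm hW.integrableOn, ← integral_inter_add_sdiff hSm
    hη.integrableOn, hGS, setIntegral_stoppedW_of_stopped hX hℱ he hw hwb hpos hρ hx hind s hF]
  congr 1
  refine setIntegral_congr_ae (hGm.diff hSm) ?_
  filter_upwards [hX.ae_start x] with ω h0 hω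
  exact stoppedW_eq_terminalW hX hw hwb hpos (h0.le.trans hx) fun h => hω.2 h

lemma martingale_stoppedW (hX : IsSpectrallyNegativeLevy P X)
    (hℱ : HasIndepIncrementsRel P X ℱ) (he : IsIndepExpTime P X q e) (hw : Measurable w)
    (hwb : ∀ a b : ℝ, BddAbove (w '' Set.Icc a b)) (hpos : ∀ y, 0 < w y)
    (hρ : ∀ s, IsStoppingTime ℱ (timeChange X w s)) {x : ℝ}
    (hind : Indep (MeasurableSpace.comap e inferInstance) (⨆ t, ℱ t) (P x)) :
    Martingale (stoppedW P X e w γ c) (killedFiltration hρ he.measurable) (P x) := by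
  have := hX.prob
  set 𝒢 := killedFiltration hρ he.measurable with h𝒢
  have hm := measurable_stoppedW (γ := γ) (c := c) hX hℱ he hw hwb hpos hρ
  rcases le_or_gt x c with hx | hx
  · have hce := stoppedW_ae_eq_condExp (γ := γ) hX hℱ he hw hwb hpos hρ hx hind
    refine ⟨fun t => (hm t).stronglyMeasurable, fun s t hst => ?_⟩
    calc (P x)[stoppedW P X e w γ c t | 𝒢 s]
        =ᵐ[P x] (P x)[(P x)[terminalW P X e w γ c | 𝒢 t] | 𝒢 s] := condExp_congr_ae (hce t)
      _ =ᵐ[P x] (P x)[terminalW P X e w γ c | 𝒢 s] :=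
          condExp_condExp_of_le (𝒢.mono hst) (𝒢.le t)
      _ =ᵐ[P x] stoppedW P X e w γ c s := (hce s).symm
  · refine martingale_of_ae_const hm (a := scaleH P X e (fun z => γ * w z) x) fun t => ?_
    filter_upwards [hX.ae_start x, he.ae_pos x] with ω h0 hep
    rw [stoppedW_of_lt_start hX hw hwb hpos (by rwa [h0]) hep, h0]

end MartingaleW

end SNLP

theorem proposition3 {Ω : Type*} {m : MeasurableSpace Ω}
    (P : ℝ → Measure Ω) (X : ℝ≥0 → Ω → ℝ) (hX : IsSpectrallyNegativeLevy P X)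
    (q : ℝ≥0) (e : Ω → ℝ≥0∞) (he : IsIndepExpTime P X q e)
    (w : ℝ → ℝ≥0) (hw : Measurable w) (hwb : ∀ a b : ℝ, BddAbove (w '' Set.Icc a b))
    (c : ℝ) (γ : ℝ≥0) (hγ : 0 < γ)
    (ℱ : Filtration ℝ≥0 m) (hℱ : HasIndepIncrementsRel P X ℱ) :
    -- the stopped process `Z` is a bounded càdlàg martingale, with the given terminal value
    ((∀ ω, IsCadlag (fun t => stoppedZ P X q e w c t ω)) ∧
      (∀ x : ℝ,
        Martingale (stoppedZ P X q e w c) ℱ (P x) ∧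
        ∃ C : ℝ, ∀ᵐ ω ∂(P x), ∀ t,
          |stoppedZ P X q e w c t ω| ≤ C) ∧
      (∀ x : ℝ, x ≤ c →
        (∀ᵐ ω ∂(P x), Tendsto
          (fun t => stoppedZ P X q e w c t ω) atTop
          (𝓝 (terminalZ P X q e w c ω))) ∧
        (∀ t, stoppedZ P X q e w c t
          =ᵐ[P x] (P x)[terminalZ P X q e w c | ℱ t]))) ∧
    -- if `w > 0` and `e` is independent of `ℱ_∞`, then the stopped process `W` is a bounded
    -- càdlàg martingale in the time-changed filtration `𝒢`
    ((∀ y, 0 < w y) →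
      (∀ x : ℝ, Indep (MeasurableSpace.comap e inferInstance) (⨆ t, ℱ t) (P x)) →
      ∃ (hρ : ∀ s, IsStoppingTime ℱ (timeChange X w s)) (𝒢 : Filtration ℝ≥0 m),
        (∀ s, 𝒢 s = (hρ s).measurableSpace ⊔
          MeasurableSpace.generateFrom
            {A : Set Ω | ∃ u ≤ s, A = {ω | timeChange X w u ω < e ω}}) ∧
        ∀ x : ℝ,
          Martingale (stoppedW P X e w γ c) 𝒢 (P x) ∧
          (∀ᵐ ω ∂(P x), IsCadlag
            (fun s => stoppedW P X e w γ c s ω)) ∧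
          ∃ C : ℝ, ∀ᵐ ω ∂(P x), ∀ s,
            |stoppedW P X e w γ c s ω| ≤ C) := by
  refine ⟨⟨isCadlag_stoppedZ hX hℱ he hw hwb, fun x => ⟨martingale_stoppedZ hX hℱ he hw hwb x,
    stoppedZ_bounded hX hℱ he hw hwb x⟩, fun x hx => ⟨tendsto_stoppedZ hX hℱ he hw hwb hx,
    stoppedZ_ae_eq_condExp hX hℱ he hw hwb hx⟩⟩, fun hpos hind => ?_⟩
  have hρ := isStoppingTime_timeChange hℱ.adapted hX.cadlag hw hwb hpos
  exact ⟨hρ, killedFiltration hρ he.measurable, killedFiltration_apply hρ he.measurable,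
    fun x => ⟨martingale_stoppedW hX hℱ he hw hwb hpos hρ (hind x),
      ae_isCadlag_stoppedW hX hℱ he hw hwb hpos x, stoppedW_bounded hX hℱ he hw hwb hpos x⟩⟩
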